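/- Maximum Matching Edge Interdiction (MMEI) is the following decision problem. Given are a finite simple undirected graph $G=(V,E)$ with edge weights $w:E\to\mathbb{Z}_{\ge 0}$, interdiction costs $c:E\to\mathbb{Z}_{\ge 1}$, and two positive integers $b$ and $m$. Is there a set $I\subseteq E$ with $c(I)=\sum_{e\in I}c(e)\le b$ such that $\nu(G-I)\le m$? Here $G-I$ is the graph obtained from $G$ by removing the edges in $I$, and $\nu(H)$ is the maximum total weight of a matching of $H$, a matching being a set of edges no two of which share an endpoint. Numbers are encoded in binary, and a graph is given by its vertices and a list of its edges. A parameterized problem is a set $Q\subseteq\Gamma^*\times\mathbb{N}$ with $\Gamma$ a finite alphabet. A parameterized reduction from $Q$ to $R$ is a map $(x,k)\mapsto(x',k')$, computed by a Turing machine in at most $t(k)\cdot(|x|+k+1)^{d}$ steps for some computable $t$ and some constant $d$, such that $(x,k)\in Q$ if and only if $(x',k')\in R$, and $k'\le g(k)$ for some computable $g$. The class $W[1]$ consists of all parameterized problems that have a parameterized reduction to Weighted 2-CNF-Satisfiability (given a CNF formula with at most two literals per clause and a number $k$, is there a satisfying assignment with exactly $k$ true variables?), parameterized by $k$. A parameterized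 problem is $W[1]$-hard if every problem in $W[1]$ has a parameterized reduction to it. Theorem. MMEI parameterized by $m$ is $W[1]$-hard, and so is its restriction to instances with unit edge weights and unit interdiction costs ($w(e)=c(e)=1$ for all $e\in E$). -/

import Mathlib

/-! ### Parameterized problems, parameterized reductions -/

/-- A parameterized problem over the alphabet `Γ`: a set of pairs (input word, parameter). -/
abbrev ParamProblem (Γ : Type) : Type := Set (List Γ × ℕ)

/-- The word on the input (or output) stack of a machine that represents `(x, k)`:
`k` marks `none` followed by the word `x`. -/
def encodePair {Γ : Type} (p : List Γ × ℕ) : List (Option Γ) :=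
  List.replicate p.2 none ++ p.1.map some

/-- The Turing machine `M` maps `(x, k)` to `f (x, k)` in at most
`t k * (‖(x, k)‖ + 1) ^ c` steps, where `‖(x, k)‖ = |x| + k`. -/
def ComputesInFPTTime {Γ Δ : Type} (M : Turing.TM2ComputableAux (Option Γ) (Option Δ))
    (f : List Γ × ℕ → List Δ × ℕ) (t : ℕ → ℕ) (c : ℕ) : Prop :=
  ∀ p : List Γ × ℕ, Nonempty (Turing.TM2OutputsInTime M.tm
    ((encodePair p).map M.inputAlphabet.symm)
    (some ((encodePair (f p)).map M.outputAlphabet.symm))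
    (t p.2 * ((encodePair p).length + 1) ^ c))

/-- `Q` has a parameterized (many-one) reduction to `R`: a map `f`, computed by a Turing machine
in time `t k * (size + 1) ^ c` with `t` computable, that preserves membership in both directions
and whose new parameter is at most `g k` for a computable `g`. -/
def FPTReduces {Γ Δ : Type} (Q : ParamProblem Γ) (R : ParamProblem Δ) : Prop :=
  ∃ (f : List Γ × ℕ → List Δ × ℕ) (g t : ℕ → ℕ) (c : ℕ)
    (M : Turing.TM2ComputableAux (Option Γ) (Option Δ)),
    Computable g ∧ Computable t ∧ (∀ p, p ∈ Q ↔ f p ∈ R) ∧ (∀ p, (f p).2 ≤ g p.2) ∧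
      ComputesInFPTTime M f t c

/-- A list of natural numbers as a word over the alphabet {0, 1, separator}: each number is
written in binary and followed by the separator `none`. -/
def encodeNats (l : List ℕ) : List (Option Bool) :=
  l.flatMap fun n => (Computability.encodeNat n).map some ++ [none]

/-! ### The class W[1] -/

namespace CNF

/-- A literal: a variable, and `true` for a positive or `false` for a negated occurrence. -/
abbrev Literal : Type := ℕ × Bool

/-- A formula in conjunctive normal form, as a list of clauses. -/
abbrev Formula : Type := List (List Literal)

/-- The variables that occur in a formula. -/
def vars (φ : Formula) : Finset ℕ := (φ.flatten.map Prod.fst).toFinset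

/-- `φ` is true under the assignment whose set of true variables is `S`. -/
def Sat (φ : Formula) (S : Finset ℕ) : Prop :=
  ∀ C ∈ φ, ∃ l ∈ C, (l.1 ∈ S ↔ l.2 = true)

/-- Each clause is written as its number of literals followed by its literals. -/
def encode (φ : Formula) : List (Option Bool) :=
  encodeNats (φ.flatMap fun C =>
    C.length :: C.flatMap fun l => [l.1, if l.2 then 1 else 0])

end CNF

/-- Weighted 2-CNF-Satisfiability with the weight as parameter: given a CNF formula with at most
two literals per clause and `k`, is there a satisfying assignment with exactly `k` true
variables? -/
def Weighted2CNFSat : ParamProblem (Option Bool) :=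
  {p | ∃ φ : CNF.Formula, (∀ C ∈ φ, C.length ≤ 2) ∧ p.1 = CNF.encode φ ∧
    ∃ S : Finset ℕ, S ⊆ CNF.vars φ ∧ S.card = p.2 ∧ CNF.Sat φ S}

/-- The class W[1]: the problems with a parameterized reduction to
Weighted 2-CNF-Satisfiability. -/
def InW1 {Γ : Type} (Q : ParamProblem Γ) : Prop := FPTReduces Q Weighted2CNFSat

/-- `R` is W[1]-hard: every problem in W[1], over any finite alphabet, has a parameterized
reduction to `R`. -/
def W1Hard {Δ : Type} (R : ParamProblem Δ) : Prop :=
  ∀ (Γ : Type) [Finite Γ] (Q : ParamProblem Γ), InW1 Q → FPTReduces Q R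

/-! ### Maximum Matching Edge Interdiction -/

/-- A matching of `G`: a set of edges of `G`, no two of which share an endpoint. -/
def IsEdgeMatching {V : Type} (G : SimpleGraph V) (M : Finset (Sym2 V)) : Prop :=
  (M : Set (Sym2 V)) ⊆ G.edgeSet ∧ ∀ e ∈ M, ∀ e' ∈ M, e ≠ e' → ∀ v, ¬ (v ∈ e ∧ v ∈ e')

open Classical in
/-- `ν(G)`: the weight of a maximum weight matching of `G`. -/
noncomputable def maxMatchingWeight {V : Type} [Fintype V] (G : SimpleGraph V)
    (w : Sym2 V → ℕ) : ℕ :=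
  (Finset.univ.filter fun M : Finset (Sym2 V) => IsEdgeMatching G M).sup fun M => ∑ e ∈ M, w e

/-- An instance of Maximum Matching Edge Interdiction. Only the values of the weight `w` and of
the cost `c` on the edges of `G` matter. -/
structure MMEIInstance where
  n : ℕ
  G : SimpleGraph (Fin n)
  w : Sym2 (Fin n) → ℕ
  c : Sym2 (Fin n) → ℕ
  b : ℕ
  m : ℕ
  c_pos : ∀ e ∈ G.edgeSet, 1 ≤ c e
  b_pos : 1 ≤ b
  m_pos : 1 ≤ m

namespace MMEIInstance

/-- There is an edge set `I` of cost at most `b` with `ν(G - I) ≤ m`. -/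
def IsYes (P : MMEIInstance) : Prop :=
  ∃ I : Finset (Sym2 (Fin P.n)), (I : Set (Sym2 (Fin P.n))) ⊆ P.G.edgeSet ∧
    ∑ e ∈ I, P.c e ≤ P.b ∧ maxMatchingWeight (P.G.deleteEdges I) P.w ≤ P.m

/-- All edge weights and all interdiction costs are 1. -/
def IsUnit (P : MMEIInstance) : Prop := ∀ e ∈ P.G.edgeSet, P.w e = 1 ∧ P.c e = 1

/-- The word `x` describes the graph, the weights, the costs and the budget of `P`: the number of
vertices in unary, then the budget, then a list of the edges (each edge once, in any order and
orientation), each edge with its weight and cost. The bound `m` is the parameter and is therefore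
not part of `x`. -/
def Encodes (P : MMEIInstance) (x : List (Option Bool)) : Prop :=
  ∃ es : List (Fin P.n × Fin P.n),
    (es.map fun p => s(p.1, p.2)).Nodup ∧
    (∀ e, e ∈ (es.map fun p => s(p.1, p.2)) ↔ e ∈ P.G.edgeSet) ∧
    x = List.replicate P.n (some true) ++ none :: encodeNats (P.b ::
      es.flatMap fun p => [(p.1 : ℕ), (p.2 : ℕ), P.w s(p.1, p.2), P.c s(p.1, p.2)])

end MMEIInstance

/-- Maximum Matching Edge Interdiction, parameterized by the matching bound `m`. -/
def MMEI : ParamProblem (Option Bool) :=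
  {p | ∃ P : MMEIInstance, P.Encodes p.1 ∧ P.m = p.2 ∧ P.IsYes}

/-- The restriction of the problem to unit edge weights and unit interdiction costs, parameterized
by the matching bound `m`. -/
def UnitMMEI : ParamProblem (Option Bool) :=
  {p | ∃ P : MMEIInstance, P.IsUnit ∧ P.Encodes p.1 ∧ P.m = p.2 ∧ P.IsYes}

/-! The reduction leads from Weighted 2-CNF-Satisfiability through independent sets to interdiction.
Its instances have unit weights and costs, and the same instances serve for both claims.

Independent sets. Whether `k` chosen variables satisfy a 2-CNF formula cannot be tested on pairs of
chosen variables, because a positive literal is false when its variable is not chosen. It can be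
tested on pairs of gaps. Put each variable at the position of its first occurrence in the input word
of length `L`, counted from one, with sentinels `0` and `L + 1`; then `k` true variables cut the
line into `k + 1` gaps `(p, q)`. A positive literal is false iff its variable lies strictly inside a
gap, and a negative one iff its variable is the left end of a gap. So every false literal is
witnessed by one gap, and a false clause by at most two. The vertices are triples `(i, p, q)` of a
slot number and the two ends. They conflict if they have the same slot, if one of them is invalid,
if consecutive slots do not fit, or if they make a clause false. A dummy slot `0` anchors the chain
at position `0` and ensures at least two slots, so that conditions on a single triple can be
expressed by pairs. With `K = k + 2`, the formula has a satisfying assignment of weight `k` iff some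
`K` vertices are free of conflicts (`Layout.exists_gaps_iff`, `Layout.exists_conf_iff`,
`CNF.mem_weighted2CNFSat_iff_conf`). If the word encodes no formula with clauses of one or two
literals, all pairs conflict.

Interdiction. Pendant vertices raise the degree of each of the `N` vertices of the conflict graph to
the same number `d = N + (2K + 1)^2`. The budget is `|E| - K d` and the matching bound is `K`.
Keeping exactly the edges at `K` independent vertices leaves `K d` edges, all covered by `K`
vertices. Conversely, let at least `K d` edges remain without a matching of size `K + 1`. At most
`K` vertices keep degree at least `2K + 2`, since such vertices can be matched greedily. The ends of
a maximum matching cover all edges and number at most `2K`; as `d > 2K(2K + 1)`, there must be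
exactly `K` vertices of large degree. An edge away from them would extend a matching of them, so
they cover everything, and `K d` edges are reached only if no two of them are adjacent
(`SimpleGraph.exists_deleteEdges_iff`).

Running time. A machine for a given reduction to Weighted 2-CNF-Satisfiability has to be continued
by one for `CNF.reduction`. The latter is described by expressions built from finite sums
(`Counter.Expr`) and by programs that write words (`Counter.Writer`). Structural induction bounds
their values and costs by polynomials (`Expr.feasible`, `Writer.feasible`). They are compiled to
programs with unary registers, these to stack machines (`Counter.steps_run`), and the result is
appended to the given machine (`exists_machine`, `exists_computesInFPTTime`). Parsing is left to a
finite automaton whose states are recorded on the tape while the input is read, so that expressions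
only look up positions. -/

section

open Turing

/-! ### A language of counter programs -/

namespace Counter

/-- The state of a counter program: registers, a read-only tape with a head between `left` and
`right`, and the output written so far, the last symbol first. -/
structure State (A B : Type) where
  reg : ℕ → ℕ
  left : List A
  right : List A
  out : List B

/-- Counter programs with tape alphabet `A` and output alphabet `B`. -/
inductive Prog (A B : Type) : Type
  | skip : Prog A B
  | inc : ℕ → Prog A B
  | dec : ℕ → Prog A B
  | emit : B → Prog A B
  | right : Prog A B
  | rewind : Prog A B
  | seq : Prog A B → Prog A B → Prog A B
  | loop : ℕ → Prog A B → Prog A B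
  | ifz : ℕ → Prog A B → Prog A B → Prog A B
  | ifsym : (A → Bool) → Prog A B → Prog A B → Prog A B

variable {A B : Type}

namespace State

/-- Replace the content of a register. -/
def set (s : State A B) (x n : ℕ) : State A B := { s with reg := Function.update s.reg x n }

/-- Decrement a register. -/
def decr (s : State A B) (x : ℕ) : State A B := s.set x (s.reg x - 1)

@[simp] theorem set_left (s : State A B) (x n : ℕ) : (s.set x n).left = s.left := rfl
@[simp] theorem set_right (s : State A B) (x n : ℕ) : (s.set x n).right = s.right := rfl
@[simp] theorem set_out (s : State A B) (x n : ℕ) : (s.set x n).out = s.out := rfl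
@[simp] theorem set_reg (s : State A B) (x n y : ℕ) :
    (s.set x n).reg y = if y = x then n else s.reg y := by
  simp [set, Function.update_apply]

/-- Move the head one symbol to the right, if there is one. -/
def moveRight (s : State A B) : State A B :=
  match s.right with
  | [] => s
  | a :: r => { s with left := a :: s.left, right := r }

theorem ext' {s t : State A B} (h1 : ∀ x, s.reg x = t.reg x) (h2 : s.left = t.left)
    (h3 : s.right = t.right) (h4 : s.out = t.out) : s = t := by
  cases s; cases t; simp_all; exact funext h1

end State

/-- The number of steps of a loop with body `f` and body cost `c` that runs `n` times. -/
def iterCost (f : State A B → State A B) (c : State A B → ℕ) : ℕ → State A B → ℕ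
  | 0, _ => 1
  | n + 1, s => 1 + c s + iterCost f c n (f s)

namespace Prog

/-- The effect of a program. A loop runs as often as the value of its register says. -/
def run : Prog A B → State A B → State A B
  | skip, s => s
  | inc x, s => s.set x (s.reg x + 1)
  | dec x, s => s.decr x
  | emit b, s => { s with out := b :: s.out }
  | right, s => s.moveRight
  | rewind, s => { s with left := [], right := s.left.reverse ++ s.right }
  | seq P Q, s => run Q (run P s)
  | loop x P, s => (fun s => run P (s.decr x))^[s.reg x] s
  | ifz x P Q, s => if s.reg x = 0 then run P s else run Q s
  | ifsym f P Q, s => if s.right.head?.elim false f then run P s else run Q s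

/-- The number of machine steps that a program takes. -/
def cost : Prog A B → State A B → ℕ
  | skip, _ => 1
  | inc _, _ => 1
  | dec _, _ => 1
  | emit _, _ => 1
  | right, _ => 1
  | rewind, s => s.left.length + 1
  | seq P Q, s => cost P s + cost Q (run P s)
  | loop x P, s => iterCost (fun s => run P (s.decr x)) (fun s => cost P (s.decr x)) (s.reg x) s
  | ifz x P Q, s => 1 + if s.reg x = 0 then cost P s else cost Q s
  | ifsym f P Q, s => 1 + if s.right.head?.elim false f then cost P s else cost Q s

/-- The program does not change the register `x`. -/
def Keeps (x : ℕ) : Prog A B → Prop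
  | skip => True
  | inc y => x ≠ y
  | dec y => x ≠ y
  | emit _ => True
  | right => True
  | rewind => True
  | seq P Q => Keeps x P ∧ Keeps x Q
  | loop y P => x ≠ y ∧ Keeps x P
  | ifz _ P Q => Keeps x P ∧ Keeps x Q
  | ifsym _ P Q => Keeps x P ∧ Keeps x Q

/-- No loop changes its register in its body. -/
def WF : Prog A B → Prop
  | seq P Q => WF P ∧ WF Q
  | loop x P => Keeps x P ∧ WF P
  | ifz _ P Q => WF P ∧ WF Q
  | ifsym _ P Q => WF P ∧ WF Q
  | _ => True

/-- A number above all registers of the program. -/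
def size : Prog A B → ℕ
  | inc x => x + 1
  | dec x => x + 1
  | seq P Q => max (size P) (size Q)
  | loop x P => max (x + 1) (size P)
  | ifz x P Q => max (x + 1) (max (size P) (size Q))
  | ifsym _ P Q => max (size P) (size Q)
  | _ => 0

theorem run_reg_of_keeps {x : ℕ} : ∀ (P : Prog A B) (s : State A B), P.Keeps x →
    (P.run s).reg x = s.reg x
  | skip, s, _ => rfl
  | inc y, s, h => by simp [run, show x ≠ y from h]
  | dec y, s, h => by simp [run, State.decr, show x ≠ y from h]
  | emit _, s, _ => rfl
  | right, s, _ => by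
      simp only [run, State.moveRight]; split <;> rfl
  | rewind, s, _ => rfl
  | seq P Q, s, h => by
      rw [run, run_reg_of_keeps Q _ h.2, run_reg_of_keeps P _ h.1]
  | loop y P, s, h => by
      have key : ∀ n (s : State A B),
          ((fun s => run P (s.decr y))^[n] s).reg x = s.reg x := by
        intro n
        induction n with
        | zero => intro s; rfl
        | succ n ih =>
          intro s
          rw [Function.iterate_succ_apply, ih, run_reg_of_keeps P _ h.2]
          simp [State.decr, h.1]
      exact key _ _
  | ifz y P Q, s, h => by
      rw [run]; split
      · exact run_reg_of_keeps P _ h.1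
      · exact run_reg_of_keeps Q _ h.2
  | ifsym f P Q, s, h => by
      rw [run]; split
      · exact run_reg_of_keeps P _ h.1
      · exact run_reg_of_keeps Q _ h.2

/-- A step emits at most one symbol. This bounds the time for moving the output to its final stack,
and the length of the output itself, by the cost of the program. -/
theorem out_length_le : ∀ (P : Prog A B) (s : State A B),
    (P.run s).out.length ≤ s.out.length + P.cost s
  | skip, s => by simp [run]
  | inc y, s => by simp [run]
  | dec y, s => by simp [run, State.decr]
  | emit _, s => by simp [run, cost]
  | right, s => by
      simp only [run, State.moveRight]; split <;> simp
  | rewind, s => by simp [run]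
  | seq P Q, s => by
      have h1 := out_length_le P s
      have h2 := out_length_le Q (P.run s)
      simp only [run, cost]; omega
  | loop y P, s => by
      have key : ∀ n (s : State A B), ((fun s => run P (s.decr y))^[n] s).out.length ≤
          s.out.length + iterCost (fun s => run P (s.decr y)) (fun s => cost P (s.decr y)) n s := by
        intro n
        induction n with
        | zero => intro s; simp
        | succ n ih =>
          intro s
          have h1 := out_length_le P (s.decr y)
          have h2 := ih (run P (s.decr y))
          rw [Function.iterate_succ_apply, iterCost]
          simp only [State.decr, State.set_out] at h1 h2 ⊢
          omega
      exact key _ _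
  | ifz y P Q, s => by
      have h1 := out_length_le P s
      have h2 := out_length_le Q s
      simp only [run, cost]; split <;> omega
  | ifsym f P Q, s => by
      have h1 := out_length_le P s
      have h2 := out_length_le Q s
      simp only [run, cost]; split <;> omega

end Prog

/-! ### Compilation to stack machines -/

/-- The stacks that a counter program with registers below `R + 1` uses. -/
inductive Stk (R : ℕ) : Type
  | reg : Fin (R + 1) → Stk R
  | left : Stk R
  | right : Stk R
  | rev : Stk R
  | out : Stk R
  deriving DecidableEq

instance (R : ℕ) : Finite (Stk R) := by
  let f : Stk R → Fin (R + 1) ⊕ Fin 4 := fun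
    | .reg i => .inl i
    | .left => .inr 0
    | .right => .inr 1
    | .rev => .inr 2
    | .out => .inr 3
  apply Finite.of_injective f
  intro a b h
  cases a <;> cases b <;> simp_all [f]

section Compile

variable {K₀ : Type} [DecidableEq K₀] {Γ₀ : K₀ → Type} {σ₀ Q Λ : Type} {R : ℕ}

/-- The stack alphabets of a machine with the stacks `K₀` of a host machine and those of a
counter program. -/
@[reducible] def Alph (Γ₀ : K₀ → Type) (A B : Type) (R : ℕ) : K₀ ⊕ Stk R → Type
  | .inl k => Γ₀ k
  | .inr (.reg _) => Unit
  | .inr .left => A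
  | .inr .right => A
  | .inr .rev => B
  | .inr .out => B

/-- The finite memory: that of the host machine, a flag, the last symbols popped, and the state of
a finite automaton. -/
structure Mem (σ₀ A B Q : Type) : Type where
  host : σ₀
  flag : Bool
  letter : Option A
  sym : Option B
  aut : Q

instance [Finite σ₀] [Finite A] [Finite B] [Finite Q] : Finite (Mem σ₀ A B Q) := by
  let f : Mem σ₀ A B Q → σ₀ × Bool × Option A × Option B × Q :=
    fun v => (v.host, v.flag, v.letter, v.sym, v.aut)
  apply Finite.of_injective f
  rintro ⟨_, _, _, _, _⟩ ⟨_, _, _, _, _⟩ h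
  simpa [f] using h

/-- The stack contents that represent a state, with the host stacks `H` and the output stack
`o`. -/
def stk (H : ∀ k, List (Γ₀ k)) (R : ℕ) (o : List B) (s : State A B) :
    ∀ k, List (Alph Γ₀ A B R k)
  | .inl k => H k
  | .inr (.reg i) => List.replicate (s.reg i) ()
  | .inr .left => s.left
  | .inr .right => s.right
  | .inr .rev => s.out
  | .inr .out => o

/-- The program points of a program: the head of each part of it. -/
inductive Lab : Prog A B → Type
  | head (P : Prog A B) : Lab P
  | fst {P Q : Prog A B} : Lab P → Lab (.seq P Q)
  | snd {P Q : Prog A B} : Lab Q → Lab (.seq P Q)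
  | body {x : ℕ} {P : Prog A B} : Lab P → Lab (.loop x P)
  | pos {x : ℕ} {P Q : Prog A B} : Lab P → Lab (.ifz x P Q)
  | neg {x : ℕ} {P Q : Prog A B} : Lab Q → Lab (.ifz x P Q)
  | yes {f : A → Bool} {P Q : Prog A B} : Lab P → Lab (.ifsym f P Q)
  | no {f : A → Bool} {P Q : Prog A B} : Lab Q → Lab (.ifsym f P Q)

theorem Lab.finite (P : Prog A B) : Finite (Lab P) := by
  induction P with
  | seq P Q hP hQ =>
    refine Finite.of_surjective (fun o : Option (Lab P ⊕ Lab Q) =>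
      (o.elim (.head _) (Sum.elim .fst .snd) : Lab (.seq P Q))) ?_
    rintro l
    cases l
    exacts [⟨none, rfl⟩, ⟨some (.inl _), rfl⟩, ⟨some (.inr _), rfl⟩]
  | loop x P hP =>
    refine Finite.of_surjective (fun o : Option (Lab P) =>
      (o.elim (.head _) .body : Lab (.loop x P))) ?_
    rintro l
    cases l
    exacts [⟨none, rfl⟩, ⟨some _, rfl⟩]
  | ifz x P Q hP hQ =>
    refine Finite.of_surjective (fun o : Option (Lab P ⊕ Lab Q) =>
      (o.elim (.head _) (Sum.elim .pos .neg) : Lab (.ifz x P Q))) ?_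
    rintro l
    cases l
    exacts [⟨none, rfl⟩, ⟨some (.inl _), rfl⟩, ⟨some (.inr _), rfl⟩]
  | ifsym f P Q hP hQ =>
    refine Finite.of_surjective (fun o : Option (Lab P ⊕ Lab Q) =>
      (o.elim (.head _) (Sum.elim .yes .no) : Lab (.ifsym f P Q))) ?_
    rintro l
    cases l
    exacts [⟨none, rfl⟩, ⟨some (.inl _), rfl⟩, ⟨some (.inr _), rfl⟩]
  | _ =>
    refine Finite.of_surjective (fun _ : Unit => .head _) ?_
    rintro l
    cases l
    exact ⟨(), rfl⟩

instance (P : Prog A B) : Finite (Lab P) := Lab.finite P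

/-- The point at which a program starts. -/
def entry : (P : Prog A B) → Lab P
  | .seq P _ => .fst (entry P)
  | P => .head P

/-- The stack of a register. -/
abbrev regStk (K₀ : Type) (R x : ℕ) : K₀ ⊕ Stk R := .inr (.reg (Fin.ofNat (R + 1) x))

variable [Inhabited A]

/-- The machine statement at each point of a program whose points are embedded by `ι` into the
labels of a machine, and which continues at `e`. -/
def code (Γ₀ : K₀ → Type) (σ₀ Q : Type) (R : ℕ) : (P : Prog A B) → (Lab P → Λ) → Λ → Lab P →
    TM2.Stmt (Alph Γ₀ A B R) Λ (Mem σ₀ A B Q)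
  | .skip, _, e, _ => .goto fun _ => e
  | .inc x, _, e, _ => .push (regStk K₀ R x) (fun _ => ()) (.goto fun _ => e)
  | .dec x, _, e, _ => .pop (regStk K₀ R x) (fun v _ => v) (.goto fun _ => e)
  | .emit b, _, e, _ => .push (.inr .rev) (fun _ => b) (.goto fun _ => e)
  | .right, _, e, _ =>
      .pop (.inr .right) (fun v o => { v with letter := o })
        (.branch (fun v => v.letter.isSome)
          (.push (.inr .left) (fun v => v.letter.getD default) (.goto fun _ => e))
          (.goto fun _ => e))
  | .rewind, ι, e, _ =>
      .pop (.inr .left) (fun v o => { v with letter := o })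
        (.branch (fun v => v.letter.isSome)
          (.push (.inr .right) (fun v => v.letter.getD default) (.goto fun _ => ι (.head _)))
          (.goto fun _ => e))
  -- This point is never reached: a composition is entered at the entry of its first part, which is
  -- why it causes no step of its own.
  | .seq _ _, _, e, .head _ => .goto fun _ => e
  | .seq P S, ι, _, .fst l => code Γ₀ σ₀ Q R P (ι ∘ .fst) (ι (.snd (entry S))) l
  | .seq _ S, ι, e, .snd l => code Γ₀ σ₀ Q R S (ι ∘ .snd) e l
  | .loop x P, ι, e, .head _ =>
      .pop (regStk K₀ R x) (fun v o => { v with flag := o.isSome })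
        (.branch Mem.flag (.goto fun _ => ι (.body (entry P))) (.goto fun _ => e))
  | .loop _ P, ι, _, .body l => code Γ₀ σ₀ Q R P (ι ∘ .body) (ι (.head _)) l
  | .ifz x P S, ι, _, .head _ =>
      .peek (regStk K₀ R x) (fun v o => { v with flag := o.isSome })
        (.branch Mem.flag (.goto fun _ => ι (.neg (entry S))) (.goto fun _ => ι (.pos (entry P))))
  | .ifz _ P _, ι, e, .pos l => code Γ₀ σ₀ Q R P (ι ∘ .pos) e l
  | .ifz _ _ S, ι, e, .neg l => code Γ₀ σ₀ Q R S (ι ∘ .neg) e l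
  | .ifsym f P S, ι, _, .head _ =>
      .peek (.inr .right) (fun v o => { v with letter := o })
        (.branch (fun v => v.letter.elim false f) (.goto fun _ => ι (.yes (entry P)))
          (.goto fun _ => ι (.no (entry S))))
  | .ifsym _ P _, ι, e, .yes l => code Γ₀ σ₀ Q R P (ι ∘ .yes) e l
  | .ifsym _ _ S, ι, e, .no l => code Γ₀ σ₀ Q R S (ι ∘ .no) e l

end Compile

end Counter

/-- The machine goes from the configuration `c` to `c'` in exactly `n` steps. -/
def Turing.TM2.Steps {K : Type} [DecidableEq K] {Γ : K → Type} {Λ σ : Type}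
    (m : Λ → TM2.Stmt Γ Λ σ) (n : ℕ) (c c' : TM2.Cfg Γ Λ σ) : Prop :=
  (flip bind (TM2.step m))^[n] (some c) = some c'

namespace Turing.TM2.Steps

variable {K : Type} [DecidableEq K] {Γ : K → Type} {Λ σ : Type} {m : Λ → TM2.Stmt Γ Λ σ}

theorem trans {n n' : ℕ} {c c' c'' : TM2.Cfg Γ Λ σ} (h : Steps m n c c')
    (h' : Steps m n' c' c'') : Steps m (n + n') c c'' := by
  unfold Steps at *
  rw [Nat.add_comm, Function.iterate_add_apply, h, h']

theorem single {l : Λ} {v : σ} {S : ∀ k, List (Γ k)} {c' : TM2.Cfg Γ Λ σ}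
    (h : TM2.stepAux (m l) v S = c') : Steps m 1 ⟨some l, v, S⟩ c' := by
  subst h; rfl

theorem head {n : ℕ} {l : Λ} {v : σ} {S : ∀ k, List (Γ k)} {c' c'' : TM2.Cfg Γ Λ σ}
    (h : TM2.stepAux (m l) v S = c') (h' : Steps m n c' c'') :
    Steps m (1 + n) ⟨some l, v, S⟩ c'' :=
  (single h).trans h'

end Turing.TM2.Steps

end

/-! ### Correctness and exact step counts of the compiled code -/

section

open Turing

namespace Counter

section Compile

variable {A B : Type} {K₀ : Type} [DecidableEq K₀] {Γ₀ : K₀ → Type} {σ₀ Q Λ : Type} {R : ℕ}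
  {H : ∀ k, List (Γ₀ k)} {o : List B}

/-- The index of a register stack is taken modulo `R + 1`. Below that bound it is unchanged, so
exactly one stack is affected. -/
theorem stk_set (s : State A B) {x : ℕ} (hx : x < R + 1) (n : ℕ) :
    stk H R o (s.set x n) =
      Function.update (stk H R o s) (regStk K₀ R x) (List.replicate n ()) := by
  funext k
  rcases k with k | (i | _ | _ | _ | _)
  · simp [stk]
  · by_cases h : i = Fin.ofNat (R + 1) x
    · subst h
      simp [stk, Nat.mod_eq_of_lt hx]
    · have : (i : ℕ) ≠ x := by
        rintro rfl; apply h; ext; simp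
      rw [Function.update_of_ne (by simpa using h)]
      simp [stk, this]
  all_goals simp [stk, State.set]

theorem stk_left (s : State A B) (l : List A) :
    stk H R o { s with left := l } =
      Function.update (stk H R o s) (.inr .left) l := by
  funext k
  rcases k with k | (i | _ | _ | _ | _) <;> simp [stk]

theorem stk_right (s : State A B) (l : List A) :
    stk H R o { s with right := l } =
      Function.update (stk H R o s) (.inr .right) l := by
  funext k
  rcases k with k | (i | _ | _ | _ | _) <;> simp [stk]

theorem stk_out (s : State A B) (l : List B) :
    stk H R o { s with out := l } =
      Function.update (stk H R o s) (.inr .rev) l := by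
  funext k
  rcases k with k | (i | _ | _ | _ | _) <;> simp [stk]

omit [DecidableEq K₀] in
@[simp] theorem stk_reg (s : State A B) {x : ℕ} (hx : x < R + 1) :
    stk H R o s (regStk K₀ R x) = List.replicate (s.reg x) () := by
  simp [stk, Nat.mod_eq_of_lt hx]

variable [Inhabited A]

open TM2 in
-- Rewinding is the only primitive instruction that takes more than one step: its point is its own
-- successor until the left stack is empty, and one last step notices this.
theorem steps_rewind {m : Λ → TM2.Stmt (Alph Γ₀ A B R) Λ (Mem σ₀ A B Q)} {ι : Lab (.rewind : Prog A B) → Λ} {e : Λ}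
    (hm : m (ι (.head _)) = code Γ₀ σ₀ Q R .rewind ι e (.head _)) : ∀ (l : List A) (s : State A B)
    (v : Mem σ₀ A B Q), s.left = l → ∃ v' : Mem σ₀ A B Q, v'.host = v.host ∧
      Steps m (l.length + 1) ⟨some (ι (.head _)), v, stk H R o s⟩
        ⟨some e, v', stk H R o (Prog.rewind.run s)⟩ := by
  intro l
  induction l with
  | nil =>
    intro s v h
    refine ⟨{ v with letter := none }, rfl, Steps.single ?_⟩
    rw [hm]
    have h1 : stk H R o s (.inr .left) = [] := h
    have h2 : Prog.rewind.run s = { s with left := [] } := by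
      simp [Prog.run, h]
    simp [code, TM2.stepAux, h1, h2, stk_left]
  | cons a l ih =>
    intro s v h
    obtain ⟨v', hv', hs⟩ := ih { s with left := l, right := a :: s.right }
      { v with letter := some a } rfl
    refine ⟨v', hv', ?_⟩
    have h3 : Prog.rewind.run { s with left := l, right := a :: s.right } =
        Prog.rewind.run s := by simp [Prog.run, h]
    rw [h3] at hs
    rw [List.length_cons, add_comm]
    refine Steps.head ?_ hs
    rw [hm]
    have h1 : stk H R o s (.inr .left) = a :: l := h
    have h2 : stk H R o { s with left := l, right := a :: s.right } = Function.update
      (Function.update (stk H R o s) (.inr .left) l) (.inr .right) (a :: s.right) := by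
      rw [← stk_left, ← stk_right]
    have h4 : stk H R o s (.inr .right) = s.right := rfl
    simp [code, TM2.stepAux, h1, h2, h4]

open TM2 in
-- Structural induction, with the cost defined so that it is the exact number of steps.
-- Well-formedness makes the two views of a loop agree: the machine tests the register in each
-- round, whereas the semantics fixes the number of rounds at the start. Only the host memory is
-- tracked, since flags and letters are overwritten before they are used.
theorem steps_run {m : Λ → TM2.Stmt (Alph Γ₀ A B R) Λ (Mem σ₀ A B Q)} : ∀ (P : Prog A B)
    (ι : Lab P → Λ) (e : Λ), (∀ l, m (ι l) = code Γ₀ σ₀ Q R P ι e l) → P.WF → P.size ≤ R →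
    ∀ (s : State A B) (v : Mem σ₀ A B Q), ∃ v' : Mem σ₀ A B Q, v'.host = v.host ∧
      Steps m (P.cost s) ⟨some (ι (entry P)), v, stk H R o s⟩ ⟨some e, v', stk H R o (P.run s)⟩
  | .skip, ι, e, hm, _, _, s, v => ⟨v, rfl, Steps.single (by rw [hm]; rfl)⟩
  | .inc x, ι, e, hm, _, hR, s, v => by
      have hx : x < R + 1 := by simp only [Prog.size] at hR; omega
      refine ⟨v, rfl, Steps.single ?_⟩
      rw [hm]
      simp [code, TM2.stepAux, Prog.run, stk_set s hx, stk_reg s hx, List.replicate_succ]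
  | .dec x, ι, e, hm, _, hR, s, v => by
      have hx : x < R + 1 := by simp only [Prog.size] at hR; omega
      refine ⟨v, rfl, Steps.single ?_⟩
      rw [hm]
      simp [code, TM2.stepAux, Prog.run, State.decr, stk_set s hx, stk_reg s hx]
  | .emit b, ι, e, hm, _, _, s, v => by
      refine ⟨v, rfl, Steps.single ?_⟩
      rw [hm]
      have h1 : stk H R o s (.inr .rev) = s.out := rfl
      simp [code, TM2.stepAux, Prog.run, stk_out, h1]
  | .right, ι, e, hm, _, _, s, v => by
      refine ⟨{ v with letter := s.right.head? }, rfl, Steps.single ?_⟩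
      rw [hm]
      have h1 : stk H R o s (.inr .right) = s.right := rfl
      have h4 : stk H R o s (.inr .left) = s.left := rfl
      cases h : s.right with
      | nil =>
        have h2 : Function.update (stk H R o s) (.inr .right) [] = stk H R o s := by
          rw [Function.update_eq_iff]
          exact ⟨by rw [h1, h], fun _ _ => rfl⟩
        simp [code, TM2.stepAux, Prog.run, State.moveRight, h1, h, h2]
      | cons a r =>
        have h2 : stk H R o { s with left := a :: s.left, right := r } = Function.update
            (Function.update (stk H R o s) (.inr .right) r) (.inr .left) (a :: s.left) := by
          rw [← stk_right, ← stk_left]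
        simp [code, TM2.stepAux, Prog.run, State.moveRight, h1, h, h2, h4]
  | .rewind, ι, e, hm, _, _, s, v => steps_rewind (hm (.head _)) s.left s v rfl
  | .seq P S, ι, e, hm, hw, hR, s, v => by
      simp only [Prog.size, max_le_iff] at hR
      obtain ⟨v1, h1, h2⟩ := steps_run P (ι ∘ .fst) (ι (.snd (entry S)))
        (fun l => hm (.fst l)) hw.1 hR.1 s v
      obtain ⟨v2, h3, h4⟩ := steps_run S (ι ∘ .snd) e
        (fun l => hm (.snd l)) hw.2 hR.2 (P.run s) v1
      exact ⟨v2, h3.trans h1, h2.trans h4⟩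
  | .loop x P, ι, e, hm, hw, hR, s, v => by
      simp only [Prog.size, max_le_iff] at hR
      have hx : x < R + 1 := by omega
      have key : ∀ n (s : State A B) (v : Mem σ₀ A B Q), s.reg x = n →
          ∃ v' : Mem σ₀ A B Q, v'.host = v.host ∧
          Steps m (iterCost (fun s => P.run (s.decr x)) (fun s => P.cost (s.decr x)) n s)
            ⟨some (ι (.head _)), v, stk H R o s⟩
            ⟨some e, v', stk H R o ((fun s => P.run (s.decr x))^[n] s)⟩ := by
        intro n
        induction n with
        | zero =>
          intro s v h
          refine ⟨{ v with flag := false }, rfl, Steps.single ?_⟩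
          rw [hm]
          have h2 : Function.update (stk H R o s) (regStk K₀ R x) [] = stk H R o s := by
            rw [Function.update_eq_iff]
            exact ⟨by rw [stk_reg s hx, h]; rfl, fun _ _ => rfl⟩
          simp [code, TM2.stepAux, stk_reg s hx, h, h2]
        | succ n ih =>
          intro s v h
          obtain ⟨v1, h1, h2⟩ := steps_run P (ι ∘ .body) (ι (.head _)) (fun l => hm (.body l)) hw.2
            hR.2 (s.decr x) { v with flag := true }
          -- The body keeps `x`, so the register holds `n` after this round and the induction
          -- hypothesis covers the others.
          obtain ⟨v2, h3, h4⟩ := ih (P.run (s.decr x)) v1 (by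
            rw [Prog.run_reg_of_keeps P _ hw.1]; simp [State.decr, h])
          refine ⟨v2, h3.trans h1, ?_⟩
          rw [Function.iterate_succ_apply, iterCost, add_assoc]
          refine Steps.head ?_ (h2.trans h4)
          rw [hm]
          have h5 : stk H R o (s.decr x) = Function.update (stk H R o s) (regStk K₀ R x)
              (List.replicate n ()) := by rw [State.decr, stk_set s hx, h]; rfl
          simp [code, TM2.stepAux, stk_reg s hx, h, h5, List.replicate_succ]
      exact key _ s v rfl
  | .ifz x P S, ι, e, hm, hw, hR, s, v => by
      simp only [Prog.size, max_le_iff] at hR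
      have hx : x < R + 1 := by omega
      simp only [Prog.run, Prog.cost]
      by_cases h : s.reg x = 0
      · obtain ⟨v1, h1, h2⟩ := steps_run P (ι ∘ .pos) e
          (fun l => hm (.pos l)) hw.1 hR.2.1 s { v with flag := false }
        refine ⟨v1, h1, ?_⟩
        rw [if_pos h, if_pos h]
        refine Steps.head ?_ h2
        change TM2.stepAux (m (ι (.head _))) _ _ = _
        rw [hm]
        simp [code, TM2.stepAux, stk_reg s hx, h]
      · obtain ⟨v1, h1, h2⟩ := steps_run S (ι ∘ .neg) e
          (fun l => hm (.neg l)) hw.2 hR.2.2 s { v with flag := true }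
        refine ⟨v1, h1, ?_⟩
        rw [if_neg h, if_neg h]
        refine Steps.head ?_ h2
        change TM2.stepAux (m (ι (.head _))) _ _ = _
        rw [hm]
        simp [code, TM2.stepAux, stk_reg s hx, List.head?_replicate, h]
  | .ifsym f P S, ι, e, hm, hw, hR, s, v => by
      simp only [Prog.size, max_le_iff] at hR
      simp only [Prog.run, Prog.cost]
      have h0 : stk H R o s (.inr .right) = s.right := rfl
      by_cases h : s.right.head?.elim false f = true
      · obtain ⟨v1, h1, h2⟩ := steps_run P (ι ∘ .yes) e
          (fun l => hm (.yes l)) hw.1 hR.1 s { v with letter := s.right.head? }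
        refine ⟨v1, h1, ?_⟩
        rw [if_pos h, if_pos h]
        refine Steps.head ?_ h2
        change TM2.stepAux (m (ι (.head _))) _ _ = _
        rw [hm]
        simp only [code, TM2.stepAux, h0, h, cond_true, Function.comp]
      · obtain ⟨v1, h1, h2⟩ := steps_run S (ι ∘ .no) e
          (fun l => hm (.no l)) hw.2 hR.2 s { v with letter := s.right.head? }
        refine ⟨v1, h1, ?_⟩
        rw [if_neg h, if_neg h]
        refine Steps.head ?_ h2
        change TM2.stepAux (m (ι (.head _))) _ _ = _
        rw [hm]
        simp only [code, TM2.stepAux, h0, Function.comp]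
        rw [Bool.not_eq_true] at h
        rw [h]; rfl

end Compile

end Counter

end

/-! ### Simulation of a given machine inside a larger one -/

section

open Turing

namespace Counter

section Host

variable {A B : Type} {K₀ : Type} [DecidableEq K₀] {Γ₀ : K₀ → Type} {σ₀ Q Λ₀ Λ : Type} {R : ℕ}

/-- The statement of the host machine as a statement of the combined machine, which goes to `e`
where the host machine halts. -/
def hostStmt (A B Q : Type) (R : ℕ) (ι : Λ₀ → Λ) (e : Λ) :
    TM2.Stmt Γ₀ Λ₀ σ₀ → TM2.Stmt (Alph Γ₀ A B R) Λ (Mem σ₀ A B Q)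
  | .push k f q => .push (.inl k) (fun v => f v.host) (hostStmt A B Q R ι e q)
  | .peek k f q => .peek (.inl k) (fun v o => { v with host := f v.host o })
      (hostStmt A B Q R ι e q)
  | .pop k f q => .pop (.inl k) (fun v o => { v with host := f v.host o })
      (hostStmt A B Q R ι e q)
  | .load f q => .load (fun v => { v with host := f v.host }) (hostStmt A B Q R ι e q)
  | .branch f q q' => .branch (fun v => f v.host) (hostStmt A B Q R ι e q)
      (hostStmt A B Q R ι e q')
  | .goto f => .goto fun v => ι (f v.host)
  | .halt => .goto fun _ => e

/-- The configuration of the combined machine that belongs to one of the host machine. -/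
def hostCfg (ι : Λ₀ → Λ) (e : Λ) (R : ℕ) (o : List B) (s : State A B) (v : Mem σ₀ A B Q)
    (c : TM2.Cfg Γ₀ Λ₀ σ₀) : TM2.Cfg (Alph Γ₀ A B R) Λ (Mem σ₀ A B Q) :=
  ⟨some (c.l.elim e ι), { v with host := c.var }, stk c.stk R o s⟩

theorem stk_host {H : ∀ k, List (Γ₀ k)} {o : List B} (s : State A B) (k : K₀) (l : List (Γ₀ k)) :
    stk (Function.update H k l) R o s = Function.update (stk H R o s) (.inl k) l := by
  funext k'
  rcases k' with k' | (i | _ | _ | _ | _)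
  · by_cases h : k' = k
    · subst h; simp [stk]
    · simp [stk, h]
  all_goals simp [stk]

theorem stepAux_hostStmt (ι : Λ₀ → Λ) (e : Λ) {o : List B} (s : State A B) (w : Mem σ₀ A B Q)
    (q : TM2.Stmt Γ₀ Λ₀ σ₀) : ∀ (v : σ₀) (S : ∀ k, List (Γ₀ k)),
    TM2.stepAux (hostStmt A B Q R ι e q) { w with host := v } (stk S R o s) =
      hostCfg ι e R o s w (TM2.stepAux q v S) := by
  induction q with
  | push k f q ih =>
    intro v S
    rw [TM2.stepAux, ← ih, stk_host]; rfl
  | peek k f q ih => intro v S; rw [TM2.stepAux, ← ih]; rfl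
  | pop k f q ih =>
    intro v S
    rw [TM2.stepAux, ← ih, stk_host]; rfl
  | load f q ih => intro v S; rw [TM2.stepAux, ← ih]; rfl
  | branch f q q' ih ih' =>
    intro v S
    rw [TM2.stepAux, hostStmt, TM2.stepAux]
    change (bif f v then _ else _) = _
    cases f v
    · exact ih' v S
    · exact ih v S
  | goto f => intro v S; rfl
  | halt => intro v S; rfl

open TM2 in
-- The simulation is step by step: the translated statements touch neither the stacks of the program
-- nor the other fields of the memory, so `s` and `w` stay fixed. Halting becomes a jump to `e`.
theorem steps_host {m₀ : Λ₀ → TM2.Stmt Γ₀ Λ₀ σ₀}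
    {m : Λ → TM2.Stmt (Alph Γ₀ A B R) Λ (Mem σ₀ A B Q)} {ι : Λ₀ → Λ} {e : Λ}
    (hm : ∀ l, m (ι l) = hostStmt A B Q R ι e (m₀ l)) {o : List B} (s : State A B)
    (w : Mem σ₀ A B Q) : ∀ (n : ℕ) (c c' : TM2.Cfg Γ₀ Λ₀ σ₀), Steps m₀ n c c' →
    Steps m n (hostCfg ι e R o s w c) (hostCfg ι e R o s w c') := by
  intro n
  induction n with
  | zero => intro c c' h; cases h; rfl
  | succ n ih =>
    intro c c' h
    obtain ⟨l, v, S⟩ := c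
    cases l with
    | none =>
      unfold Steps at h
      rw [Function.iterate_succ_apply] at h
      -- A halted configuration has no successor, so it cannot be the start of `n + 1` steps.
      have h1 : ∀ n, (flip bind (TM2.step m₀))^[n] none = none := fun n => by
        induction n with
        | zero => rfl
        | succ n ih => rw [Function.iterate_succ_apply]; exact ih
      rw [show flip bind (TM2.step m₀) (some ⟨none, v, S⟩) = none from rfl, h1] at h
      cases h
    | some l =>
      have h1 : Steps m₀ n (TM2.stepAux (m₀ l) v S) c' := by
        unfold Steps at h ⊢
        rw [Function.iterate_succ_apply] at h
        exact h
      rw [Nat.add_comm]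
      refine Steps.head ?_ (ih _ _ h1)
      change TM2.stepAux (m (ι l)) _ _ = _
      rw [hm]
      exact stepAux_hostStmt ι e s w (m₀ l) v S

/-- The number of symbols that a statement pushes at most. -/
def pushes : TM2.Stmt Γ₀ Λ₀ σ₀ → ℕ
  | .push _ _ q => pushes q + 1
  | .peek _ _ q => pushes q
  | .pop _ _ q => pushes q
  | .load _ q => pushes q
  | .branch _ q q' => max (pushes q) (pushes q')
  | .goto _ => 0
  | .halt => 0

theorem length_stepAux_le (k : K₀) (q : TM2.Stmt Γ₀ Λ₀ σ₀) : ∀ (v : σ₀) (S : ∀ k, List (Γ₀ k)),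
    ((TM2.stepAux q v S).stk k).length ≤ (S k).length + pushes q := by
  have upd : ∀ (S : ∀ k, List (Γ₀ k)) (k' : K₀) (l : List (Γ₀ k')) (c : ℕ),
      l.length ≤ (S k').length + c → (Function.update S k' l k).length ≤ (S k).length + c := by
    intro S k' l c h
    by_cases hk : k = k'
    · subst hk; simpa using h
    · simp [hk]
  induction q with
  | push k' f q ih =>
    intro v S
    have h1 := ih v (Function.update S k' (f v :: S k'))
    have h2 := upd S k' (f v :: S k') 1 (by simp)
    simp only [TM2.stepAux, pushes]; omega
  | peek k' f q ih => intro v S; exact ih _ S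
  | pop k' f q ih =>
    intro v S
    have h1 := ih (f v (S k').head?) (Function.update S k' (S k').tail)
    have h2 := upd S k' (S k').tail 0 (by simp)
    simp only [TM2.stepAux, pushes]; omega
  | load f q ih => intro v S; exact ih _ S
  | branch f q q' ih ih' =>
    intro v S
    have h1 := ih v S
    have h2 := ih' v S
    simp only [TM2.stepAux, pushes]
    cases f v <;> simp only [cond_true, cond_false] <;> omega
  | goto f => intro v S; simp [TM2.stepAux, pushes]
  | halt => intro v S; simp [TM2.stepAux, pushes]

open TM2 in
-- A machine pushes a bounded number of symbols per step, so its output is at most linear in its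
-- running time. This bounds the input of the program that follows.
theorem length_steps_le {m₀ : Λ₀ → TM2.Stmt Γ₀ Λ₀ σ₀} {C : ℕ} (hC : ∀ l, pushes (m₀ l) ≤ C)
    (k : K₀) : ∀ (n : ℕ) (c c' : TM2.Cfg Γ₀ Λ₀ σ₀), Steps m₀ n c c' →
    (c'.stk k).length ≤ (c.stk k).length + C * n := by
  intro n
  induction n with
  | zero => intro c c' h; cases h; simp
  | succ n ih =>
    intro c c' h
    unfold Steps at h
    rw [Function.iterate_succ_apply'] at h
    cases h1 : (flip bind (TM2.step m₀))^[n] (some c) with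
    | none => rw [h1] at h; cases h
    | some d =>
      rw [h1] at h
      have h2 := ih c d h1
      obtain ⟨_ | l, v, S⟩ := d
      · cases h
      · obtain rfl : TM2.stepAux (m₀ l) v S = c' := Option.some.inj h
        have h3 := length_stepAux_le k (m₀ l) v S
        have h4 := hC l
        simp only at h2
        rw [mul_add_one]; omega

end Host

end Counter

end

/-! ### The combined machine: host, reading, program, output, cleaning -/

section

open Turing

namespace Counter

/-- The parts of the combined machine other than the host machine and the program: reading the
output of the host, moving the output to the output stack, and cleaning up. -/
inductive Phase : Type
  | read : Phase
  | flush : Phase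
  | clean : Phase

instance : Finite Phase :=
  Finite.of_surjective (fun i : Fin 3 => match i with
    | 0 => Phase.read
    | 1 => Phase.flush
    | 2 => Phase.clean) (by
      intro p
      cases p
      exacts [⟨0, rfl⟩, ⟨1, rfl⟩, ⟨2, rfl⟩])

section Machine

variable {I B Q : Type}

/-- The word in which each symbol is annotated with the state of a finite automaton before it. -/
def annotate (δ : Q → I → Q) : Q → List I → List (Q × I)
  | _, [] => []
  | q, y :: x => (q, y) :: annotate δ (δ q y) x

theorem length_annotate (δ : Q → I → Q) : ∀ (x : List I) (q : Q),
    (annotate δ q x).length = x.length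
  | [], _ => rfl
  | y :: x, q => by simp [annotate, length_annotate δ x]

/-- The state in which the program starts on the input `(x, k)`. -/
def start (B : Type) (δ : Q → I → Q) (q₀ : Q) (p : List I × ℕ) : State (Q × I) B where
  reg i := if i = 0 then p.2 else if i = 1 then p.1.length else 0
  left := (annotate δ q₀ p.1).reverse
  right := []
  out := []

variable [Inhabited B] [Inhabited Q] [Inhabited I]

/-- The statements of the parts other than the host and the program. -/
def phaseStmt {K₀ Λ σ₀ : Type} {Γ₀ : K₀ → Type} (R : ℕ) (δ : Q → I → Q) (init : Mem σ₀ (Q × I) B Q)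
    (ι : Phase → Λ) (e : Λ) {k₁ : K₀} (eq : Γ₀ k₁ ≃ Option I) :
    Phase → TM2.Stmt (Alph Γ₀ (Q × I) B R) Λ (Mem σ₀ (Q × I) B Q)
  | .read =>
      .pop (.inl k₁) (fun v o =>
          { v with flag := o.isSome, letter := o.bind fun g => (eq g).map fun y => (v.aut, y) })
        (.branch Mem.flag
          (.branch (fun v => v.letter.isSome)
            (.push (.inr .left) (fun v => v.letter.getD default)
              (.push (regStk K₀ R 1) (fun _ => ())
                (.load (fun v => { v with aut := v.letter.elim v.aut fun a => δ a.1 a.2 })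
                  (.goto fun _ => ι .read))))
            -- A symbol was popped but carries no letter: it is one of the marks for the parameter.
            (.push (regStk K₀ R 0) (fun _ => ()) (.goto fun _ => ι .read)))
          (.goto fun _ => e))
  | .flush =>
      .pop (.inr .rev) (fun v o => { v with sym := o })
        (.branch (fun v => v.sym.isSome)
          (.push (.inr .out) (fun v => v.sym.getD default) (.goto fun _ => ι .flush))
          (.goto fun _ => ι .clean))
  | .clean =>
      .pop (.inr .right) (fun v o => { v with letter := o })
        (.branch (fun v => v.letter.isSome) (.goto fun _ => ι .clean)
          -- Halting configurations are required to have the initial memory and all stacks empty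
          -- except that of the output.
          (.load (fun _ => init) .halt))

section Phases

variable {K₀ Λ σ₀ : Type} [DecidableEq K₀] {Γ₀ : K₀ → Type} {R : ℕ} {δ : Q → I → Q}
  {init : Mem σ₀ (Q × I) B Q} {ι : Phase → Λ} {e : Λ} {k₁ : K₀} {eq : Γ₀ k₁ ≃ Option I}
  {m : Λ → TM2.Stmt (Alph Γ₀ (Q × I) B R) Λ (Mem σ₀ (Q × I) B Q)}

open TM2

omit [Inhabited B] [Inhabited Q] [Inhabited I] in
theorem stk_cons_out {H : ∀ k, List (Γ₀ k)} {o : List B} {s : State (Q × I) B} {b : B}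
    {r : List B} :
    stk H R (b :: o) { s with out := r } = Function.update
      (Function.update (stk H R o s) (.inr .rev) r) (.inr .out) (b :: o) := by
  funext k
  rcases k with k | (i | _ | _ | _ | _) <;> simp [stk]

omit [Inhabited B] [Inhabited Q] [Inhabited I] in
theorem stk_clear {o : List B} {s : State (Q × I) B} (h : ∀ i, s.reg i = 0) (hl : s.left = [])
    (hr : s.right = []) (ho : s.out = []) : stk (fun k => ([] : List (Γ₀ k))) R o s =
      Function.update (β := fun k => List (Alph Γ₀ (Q × I) B R k)) (fun _ => []) (.inr .out) o := by
  funext k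
  rcases k with k | (i | _ | _ | _ | _) <;> simp [stk, h, hl, hr, ho]

theorem steps_flush (hm : ∀ p, m (ι p) = phaseStmt R δ init ι e eq p) {H : ∀ k, List (Γ₀ k)} :
    ∀ (r o : List B) (s : State (Q × I) B) (v : Mem σ₀ (Q × I) B Q), s.out = r →
    ∃ v', Steps m (r.length + 1) ⟨some (ι .flush), v, stk H R o s⟩
      ⟨some (ι .clean), v', stk H R (r.reverse ++ o) { s with out := [] }⟩ := by
  intro r
  induction r with
  | nil =>
    intro o s v h
    refine ⟨{ v with sym := none }, Steps.single ?_⟩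
    rw [hm]
    have h1 : stk H R o s (.inr .rev) = [] := h
    simp [phaseStmt, TM2.stepAux, h1, stk_out]
  | cons b r ih =>
    intro o s v h
    obtain ⟨v', hv'⟩ := ih (b :: o) { s with out := r } { v with sym := some b } rfl
    refine ⟨v', ?_⟩
    rw [List.length_cons, Nat.add_comm]
    have h2 : (b :: r).reverse ++ o = r.reverse ++ b :: o := by simp
    rw [h2]
    refine Steps.head ?_ hv'
    rw [hm]
    have h1 : stk H R o s (.inr .rev) = b :: r := h
    have h3 : stk H R o s (.inr .out) = o := rfl
    simp [phaseStmt, TM2.stepAux, h1, h3, stk_cons_out]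

theorem steps_clean (hm : ∀ p, m (ι p) = phaseStmt R δ init ι e eq p) {H : ∀ k, List (Γ₀ k)}
    {o : List B} : ∀ (r : List (Q × I)) (s : State (Q × I) B) (v : Mem σ₀ (Q × I) B Q),
    s.right = r → Steps m (r.length + 1) ⟨some (ι .clean), v, stk H R o s⟩
      ⟨none, init, stk H R o { s with right := [] }⟩ := by
  intro r
  induction r with
  | nil =>
    intro s v h
    refine Steps.single ?_
    rw [hm]
    have h1 : stk H R o s (.inr .right) = [] := h
    simp [phaseStmt, TM2.stepAux, h1, stk_right]
  | cons a r ih =>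
    intro s v h
    have h2 := ih { s with right := r } { v with letter := some a } rfl
    rw [List.length_cons, Nat.add_comm]
    refine Steps.head ?_ h2
    rw [hm]
    have h1 : stk H R o s (.inr .right) = a :: r := h
    simp [phaseStmt, TM2.stepAux, h1, stk_right]

/-- The host stacks that hold the word `w` on the output stack of the host. -/
def hostOut (k₁ : K₀) (w : List (Γ₀ k₁)) : ∀ k, List (Γ₀ k) :=
  Function.update (fun _ => []) k₁ w

/-- The letters go to the left stack in the order in which they are popped, so the head ends up to
the right of the word. The automaton moves along in the finite memory and labels each letter with
the state before it. -/
theorem steps_read_word (hm : ∀ p, m (ι p) = phaseStmt R δ init ι e eq p) (hR : 1 ≤ R)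
    {o : List B} : ∀ (x : List I) (s : State (Q × I) B) (v : Mem σ₀ (Q × I) B Q),
    ∃ v', Steps m (x.length + 1)
      ⟨some (ι .read), v, stk (hostOut k₁ ((x.map some).map eq.symm)) R o s⟩
      ⟨some e, v', stk (fun _ => []) R o { s with
        reg := Function.update s.reg 1 (s.reg 1 + x.length)
        left := (annotate δ v.aut x).reverse ++ s.left }⟩ := by
  intro x
  induction x with
  | nil =>
    intro s v
    refine ⟨{ v with flag := false, letter := none }, Steps.single ?_⟩
    rw [hm]
    have h1 : stk (hostOut k₁ (([] : List (Option I)).map eq.symm)) R o s (.inl k₁) = [] := by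
      simp [stk, hostOut]
    have h2 : hostOut k₁ (([] : List (Option I)).map eq.symm) = fun _ => [] := by
      simp [hostOut]
    have h3 : Function.update (stk (fun k => ([] : List (Γ₀ k))) R o s) (.inl k₁) [] =
      stk (fun k => ([] : List (Γ₀ k))) R o s := by
      rw [Function.update_eq_iff]
      exact ⟨rfl, fun _ _ => rfl⟩
    simp only [List.map_nil] at h1 h2 ⊢
    simp [phaseStmt, TM2.stepAux, h1, annotate]
    rw [h2]; exact h3
  | cons y x ih =>
    intro s v
    obtain ⟨v', hv'⟩ := ih { s with
      reg := Function.update s.reg 1 (s.reg 1 + 1)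
      left := (v.aut, y) :: s.left }
      { v with flag := true, letter := some (v.aut, y), aut := δ v.aut y }
    refine ⟨v', ?_⟩
    rw [List.length_cons, Nat.add_comm]
    have h2 : stk (fun k => ([] : List (Γ₀ k))) R o { s with
        reg := Function.update s.reg 1 (s.reg 1 + (1 + x.length))
        left := (annotate δ v.aut (y :: x)).reverse ++ s.left } =
      stk (fun k => ([] : List (Γ₀ k))) R o { s with
        reg := Function.update (Function.update s.reg 1 (s.reg 1 + 1)) 1
          (Function.update s.reg 1 (s.reg 1 + 1) 1 + x.length)
        left := (annotate δ (δ v.aut y) x).reverse ++ (v.aut, y) :: s.left } := by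
      simp [annotate, add_assoc]
    rw [show x.length + 1 = 1 + x.length by omega, h2]
    rw [show 1 + x.length = x.length + 1 by omega]
    refine Steps.head ?_ hv'
    rw [hm]
    have h1 : stk (hostOut k₁ (((y :: x).map some).map eq.symm)) R o s (.inl k₁) =
        eq.symm (some y) :: (x.map some).map eq.symm := by
      simp [stk, hostOut]
    have h3 : stk (hostOut k₁ ((x.map some).map eq.symm)) R o { s with
        reg := Function.update s.reg 1 (s.reg 1 + 1), left := (v.aut, y) :: s.left } =
      Function.update (Function.update (Function.update
        (stk (hostOut k₁ (((y :: x).map some).map eq.symm)) R o s) (.inl k₁)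
          ((x.map some).map eq.symm)) (.inr .left) ((v.aut, y) :: s.left))
          (regStk K₀ R 1) (() :: List.replicate (s.reg 1) ()) := by
      rw [← stk_host]
      have := stk_set (H := hostOut k₁ ((x.map some).map eq.symm)) (o := o)
        { s with left := (v.aut, y) :: s.left } (show 1 < R + 1 by omega) (s.reg 1 + 1)
      simp only [State.set] at this
      rw [this, ← List.replicate_succ]
      congr 1
      have := stk_left (R := R) (H := hostOut k₁ ((x.map some).map eq.symm)) (o := o) s
        ((v.aut, y) :: s.left)
      rw [this]
      congr 1
      simp [hostOut]
    have h4 : stk (hostOut k₁ (((y :: x).map some).map eq.symm)) R o s (.inr .left) = s.left := rfl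
    have h5 := stk_reg (H := hostOut k₁ (((y :: x).map some).map eq.symm)) (o := o) s
      (show 1 < R + 1 by omega)
    rw [h3]
    generalize stk (hostOut k₁ (((y :: x).map some).map eq.symm)) R o s = S at h1 h4 h5 ⊢
    simp [phaseStmt, TM2.stepAux, h1, h4, h5]

theorem steps_read (hm : ∀ p, m (ι p) = phaseStmt R δ init ι e eq p) (hR : 1 ≤ R)
    {o : List B} (x : List I) : ∀ (k : ℕ) (s : State (Q × I) B) (v : Mem σ₀ (Q × I) B Q),
    ∃ v', Steps m (k + (x.length + 1))
      ⟨some (ι .read), v, stk (hostOut k₁ ((encodePair (x, k)).map eq.symm)) R o s⟩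
      ⟨some e, v', stk (fun _ => []) R o { s with
        reg := Function.update (Function.update s.reg 0 (s.reg 0 + k)) 1 (s.reg 1 + x.length)
        left := (annotate δ v.aut x).reverse ++ s.left }⟩ := by
  intro k
  induction k with
  | zero =>
    intro s v
    have := steps_read_word (o := o) hm hR x s v
    simpa [encodePair] using this
  | succ k ih =>
    intro s v
    obtain ⟨v', hv'⟩ := ih (s.set 0 (s.reg 0 + 1)) { v with flag := true, letter := none }
    refine ⟨v', ?_⟩
    have h2 : stk (fun k => ([] : List (Γ₀ k))) R o { s with
        reg := Function.update (Function.update s.reg 0 (s.reg 0 + (k + 1))) 1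
          (s.reg 1 + x.length)
        left := (annotate δ v.aut x).reverse ++ s.left } =
      stk (fun k => ([] : List (Γ₀ k))) R o { s.set 0 (s.reg 0 + 1) with
        reg := Function.update (Function.update (s.set 0 (s.reg 0 + 1)).reg 0
          ((s.set 0 (s.reg 0 + 1)).reg 0 + k)) 1 ((s.set 0 (s.reg 0 + 1)).reg 1 + x.length)
        left := (annotate δ v.aut x).reverse ++ s.left } := by
      simp only [State.set_reg, if_true, one_ne_zero, if_false]
      simp [State.set, add_assoc, add_comm 1]
    rw [h2, show k + 1 + (x.length + 1) = 1 + (k + (x.length + 1)) by omega]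
    refine Steps.head ?_ hv'
    rw [hm]
    have h1 : stk (hostOut k₁ ((encodePair (x, k + 1)).map eq.symm)) R o s (.inl k₁) =
        eq.symm none :: (encodePair (x, k)).map eq.symm := by
      simp [stk, hostOut, encodePair, List.replicate_succ]
    have h3 : stk (hostOut k₁ ((encodePair (x, k)).map eq.symm)) R o (s.set 0 (s.reg 0 + 1)) =
      Function.update (Function.update
        (stk (hostOut k₁ ((encodePair (x, k + 1)).map eq.symm)) R o s) (.inl k₁)
          ((encodePair (x, k)).map eq.symm))
          (regStk K₀ R 0) (() :: List.replicate (s.reg 0) ()) := by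
      rw [← stk_host, stk_set s (by omega), ← List.replicate_succ]
      congr 2
      simp [hostOut]
    have h5 := stk_reg (H := hostOut k₁ ((encodePair (x, k + 1)).map eq.symm)) (o := o) s
      (show 0 < R + 1 by omega)
    simp only [phaseStmt, TM2.stepAux, h1, h3]
    simp [h5]

end Phases

/-- The machine that runs `tm`, reads its output `(x, k)`, runs the program `P` on it and leaves
the output of `P` on its output stack. -/
noncomputable def machine [Finite I] [Finite B] [Finite Q] (tm : FinTM2)
    (eq : tm.Γ tm.k₁ ≃ Option I) (δ : Q → I → Q) (q₀ : Q) (P : Prog (Q × I) B) : FinTM2 :=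
  letI := tm.kFin
  letI := tm.ΛFin
  letI := tm.σFin
  letI : Fintype (tm.K ⊕ Stk (P.size + 1)) := Fintype.ofFinite _
  letI : Fintype (tm.Λ ⊕ Lab P ⊕ Phase) := Fintype.ofFinite _
  letI : Fintype (Mem tm.σ (Q × I) B Q) := Fintype.ofFinite _
  letI : Fintype (Alph tm.Γ (Q × I) B (P.size + 1) (.inl tm.k₀)) := tm.Γk₀Fin
  { K := tm.K ⊕ Stk (P.size + 1)
    k₀ := .inl tm.k₀
    k₁ := .inr .out
    Γ := Alph tm.Γ (Q × I) B (P.size + 1)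
    Λ := tm.Λ ⊕ Lab P ⊕ Phase
    main := .inl tm.main
    σ := Mem tm.σ (Q × I) B Q
    initialState := ⟨tm.initialState, false, none, none, q₀⟩
    m := fun
      | .inl l => hostStmt (Q × I) B Q (P.size + 1) .inl (.inr (.inr .read)) (tm.m l)
      | .inr (.inl l) =>
          code tm.Γ tm.σ Q (P.size + 1) P (.inr ∘ .inl) (.inr (.inr .flush)) l
      | .inr (.inr p) => phaseStmt (P.size + 1) δ ⟨tm.initialState, false, none, none, q₀⟩
          (.inr ∘ .inr) (.inr (.inl (entry P))) eq p }

open TM2 in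
-- The phases are run one after the other, and their step counts add up. The program has to leave
-- its registers and the left part of the tape empty; the right part is cleaned up afterwards. The
-- constant `C` bounds the pushes per step of the given machine.
theorem exists_machine {Γ : Type} [Finite I] [Finite B] [Finite Q]
    (M : TM2ComputableAux (Option Γ) (Option I)) (δ : Q → I → Q) (q₀ : Q) (P : Prog (Q × I) B)
    (hP : P.WF) : ∃ (M' : TM2ComputableAux (Option Γ) B) (C : ℕ),
    ∀ (w : List (Option Γ)) (p : List I × ℕ) (T : ℕ),
      Nonempty (TM2OutputsInTime M.tm (w.map M.inputAlphabet.symm)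
        (some ((encodePair p).map M.outputAlphabet.symm)) T) →
      (encodePair p).length ≤ w.length + C * T ∧
      ((∀ i, (P.run (start B δ q₀ p)).reg i = 0) → (P.run (start B δ q₀ p)).left = [] →
        Nonempty (TM2OutputsInTime M'.tm (w.map M'.inputAlphabet.symm)
          (some ((P.run (start B δ q₀ p)).out.reverse.map M'.outputAlphabet.symm))
          (T + ((encodePair p).length + 1) + P.cost (start B δ q₀ p) +
            ((P.run (start B δ q₀ p)).out.length + 1) +
            ((P.run (start B δ q₀ p)).right.length + 1)))) := by
  let _ := M.tm.ΛFin
  refine ⟨⟨machine M.tm M.outputAlphabet δ q₀ P, M.inputAlphabet, Equiv.refl _⟩,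
    Finset.univ.sup fun l => pushes (M.tm.m l), ?_⟩
  rintro w p T ⟨⟨⟨n, hn⟩, hnT⟩⟩
  have hn' : Steps M.tm.m n (initList M.tm (w.map M.inputAlphabet.symm))
    (haltList M.tm ((encodePair p).map M.outputAlphabet.symm)) := hn
  have hk : ∀ l, pushes (M.tm.m l) ≤ Finset.univ.sup fun l => pushes (M.tm.m l) :=
    fun l => Finset.le_sup (f := fun l => pushes (M.tm.m l)) (Finset.mem_univ l)
  have hinit : ∀ (tm : FinTM2) (l : List (tm.Γ tm.k₀)),
      (initList tm l).stk = Function.update (fun _ => []) tm.k₀ l := by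
    intro tm l
    funext k
    by_cases h : k = tm.k₀
    · subst h; simp [initList]
    · simp [initList, h]
  have hhalt : ∀ (tm : FinTM2) (l : List (tm.Γ tm.k₁)),
      (haltList tm l).stk = Function.update (fun _ => []) tm.k₁ l := by
    intro tm l
    funext k
    by_cases h : k = tm.k₁
    · subst h; simp [haltList]
    · simp [haltList, h]
  constructor
  · have h1 := length_steps_le hk M.tm.k₁ n _ _ hn'
    have h2 : ((haltList M.tm ((encodePair p).map M.outputAlphabet.symm)).stk M.tm.k₁).length =
        (encodePair p).length := by
      rw [hhalt]; simp
    have h3 : ((initList M.tm (w.map M.inputAlphabet.symm)).stk M.tm.k₁).length ≤ w.length := by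
      rw [hinit]
      -- The output stack may be the input stack, and then it already holds the input at the start.
      by_cases h : M.tm.k₁ = M.tm.k₀
      · generalize hl : w.map M.inputAlphabet.symm = l
        have h4 : l.length = w.length := by rw [← hl]; simp
        rw [← h4]
        generalize M.tm.k₁ = k at h
        subst h; simp
      · rw [Function.update_of_ne h]; simp
    rw [h2] at h1
    have h4 := Nat.mul_le_mul_left (Finset.univ.sup fun l => pushes (M.tm.m l)) hnT
    simp only at h4
    omega
  · intro hreg hleft
    set init : Mem M.tm.σ (Q × I) B Q := ⟨M.tm.initialState, false, none, none, q₀⟩ with hinit'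
    set s₀ : State (Q × I) B := ⟨fun _ => 0, [], [], []⟩ with hs₀
    set m := (machine M.tm M.outputAlphabet δ q₀ P).m with hm
    have hstk0 : ∀ (H : ∀ k, List (M.tm.Γ k)), stk H (P.size + 1) ([] : List B) s₀ =
        fun k => match k with
          | .inl k => H k
          | .inr _ => [] := by
      intro H
      funext k
      rcases k with k | (i | _ | _ | _ | _) <;> simp [stk, hs₀]
    have st1 := steps_host (A := Q × I) (B := B) (Q := Q) (R := P.size + 1) (m := m) (ι := .inl)
      (e := .inr (.inr .read)) (fun l => rfl) (o := []) s₀ init n _ _ hn'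
    obtain ⟨v2, st2⟩ := steps_read (m := m) (ι := .inr ∘ .inr) (e := .inr (.inl (entry P)))
      (eq := M.outputAlphabet) (δ := δ) (init := init) (R := P.size + 1) (fun l => rfl) (by omega)
      (o := []) p.1 p.2 s₀ init
    obtain ⟨v3, -, st3⟩ := steps_run (m := m) (H := fun _ => []) (o := []) P (.inr ∘ .inl)
      (.inr (.inr .flush)) (fun l => rfl) hP (by omega) (start B δ q₀ p) v2
    obtain ⟨v4, st4⟩ := steps_flush (m := m) (ι := .inr ∘ .inr) (e := .inr (.inl (entry P)))
      (eq := M.outputAlphabet) (δ := δ) (init := init) (R := P.size + 1) (H := fun _ => [])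
      (fun l => rfl) _ [] (P.run (start B δ q₀ p)) v3 rfl
    have st5 := steps_clean (m := m) (ι := .inr ∘ .inr) (e := .inr (.inl (entry P)))
      (eq := M.outputAlphabet) (δ := δ) (init := init) (R := P.size + 1) (H := fun _ => [])
      (o := (P.run (start B δ q₀ p)).out.reverse ++ [])
      (fun l => rfl) _ { P.run (start B δ q₀ p) with out := [] } v4 rfl
    have e2 : (⟨Function.update (Function.update s₀.reg 0 (s₀.reg 0 + p.2)) 1
        (s₀.reg 1 + p.1.length), (annotate δ init.aut p.1).reverse ++ s₀.left, s₀.right,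
        s₀.out⟩ : State (Q × I) B) = start B δ q₀ p := by
      apply State.ext'
      · intro x
        simp only [hs₀, start, Function.update_apply, zero_add]
        split_ifs <;> simp_all
      · simp [hs₀, start, hinit']
      · rfl
      · rfl
    rw [e2] at st2
    have e1 : hostCfg (A := Q × I) (B := B) (Q := Q) .inl (.inr (.inr .read)) (P.size + 1) [] s₀
        init (haltList M.tm ((encodePair p).map M.outputAlphabet.symm)) =
        (⟨some ((Sum.inr ∘ Sum.inr : Phase → M.tm.Λ ⊕ Lab P ⊕ Phase) .read), init,
          stk (hostOut M.tm.k₁ ((encodePair p).map M.outputAlphabet.symm)) (P.size + 1) [] s₀⟩ :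
          TM2.Cfg (Alph M.tm.Γ (Q × I) B (P.size + 1)) (M.tm.Λ ⊕ Lab P ⊕ Phase)
            (Mem M.tm.σ (Q × I) B Q)) := by
      unfold hostCfg
      rw [hhalt]; rfl
    replace st1 := Eq.mp (congrArg (Steps m n _) e1) st1
    have key := (((st1.trans st2).trans st3).trans st4).trans st5
    have e0 : hostCfg (A := Q × I) (B := B) (Q := Q) .inl (.inr (.inr .read)) (P.size + 1) [] s₀
        init (initList M.tm (w.map M.inputAlphabet.symm)) =
        initList (machine M.tm M.outputAlphabet δ q₀ P) (w.map M.inputAlphabet.symm) := by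
      have h1 := hinit (machine M.tm M.outputAlphabet δ q₀ P) (w.map M.inputAlphabet.symm)
      have h2 := hinit M.tm (w.map M.inputAlphabet.symm)
      have h3 : stk (initList M.tm (w.map M.inputAlphabet.symm)).stk (P.size + 1) [] s₀ =
          (initList (machine M.tm M.outputAlphabet δ q₀ P) (w.map M.inputAlphabet.symm)).stk := by
        rw [h1, h2, stk_host]
        change _ = Function.update _ (Sum.inl M.tm.k₀) _
        congr 1
        rw [hstk0]
        funext k
        rcases k with k | k <;> rfl
      unfold hostCfg
      rw [h3]; rfl
    have e3 : (⟨none, init, stk (fun _ => []) (P.size + 1)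
        ((P.run (start B δ q₀ p)).out.reverse ++ []) { P.run (start B δ q₀ p) with
          out := [], right := [] }⟩ : TM2.Cfg (Alph M.tm.Γ (Q × I) B (P.size + 1))
            (M.tm.Λ ⊕ Lab P ⊕ Phase) (Mem M.tm.σ (Q × I) B Q)) =
        haltList (machine M.tm M.outputAlphabet δ q₀ P) (P.run (start B δ q₀ p)).out.reverse := by
      have h1 := hhalt (machine M.tm M.outputAlphabet δ q₀ P)
        (P.run (start B δ q₀ p)).out.reverse
      have h3 : stk (fun _ => []) (P.size + 1)
        ((P.run (start B δ q₀ p)).out.reverse ++ []) { P.run (start B δ q₀ p) with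
          out := [], right := [] } = (haltList (machine M.tm M.outputAlphabet δ q₀ P)
            (P.run (start B δ q₀ p)).out.reverse).stk := by
        rw [h1, List.append_nil]
        exact stk_clear (by simpa using hreg) hleft rfl rfl
      rw [h3]; rfl
    refine ⟨⟨⟨n + (p.2 + (p.1.length + 1)) + P.cost (start B δ q₀ p) +
      ((P.run (start B δ q₀ p)).out.length + 1) +
      ((P.run (start B δ q₀ p)).right.length + 1), ?_⟩, ?_⟩⟩
    · have key' := key
      replace key' := Eq.mp (congrArg (fun c => Steps m _ c _) e0) key'
      replace key' := Eq.mp (congrArg (fun c => Steps m _ _ c) e3) key'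
      have h5 : List.map (Equiv.refl B).symm (P.run (start B δ q₀ p)).out.reverse =
        (P.run (start B δ q₀ p)).out.reverse := by simp
      exact Eq.trans key' (congrArg (fun l => some (haltList
        (machine M.tm M.outputAlphabet δ q₀ P) l)) h5.symm)
    · have h6 : (encodePair p).length = p.2 + p.1.length := by simp [encodePair]
      simp only at hnT
      change n + (p.2 + (p.1.length + 1)) + P.cost (start B δ q₀ p) + _ + _ ≤ _
      rw [h6]; omega

end Machine

end Counter

end

/-! ### A calculus of effects and costs, and expressions -/

section

open Turing

namespace Counter

variable {A B : Type}

/-- The program goes from `s` to `s'` in at most `c` steps. -/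
def Does (P : Prog A B) (s s' : State A B) (c : ℕ) : Prop :=
  P.run s = s' ∧ P.cost s ≤ c

namespace Does

theorem mono {P : Prog A B} {s s' : State A B} {c c' : ℕ} (h : Does P s s' c) (hc : c ≤ c') :
    Does P s s' c' := ⟨h.1, h.2.trans hc⟩

theorem of_eq {P : Prog A B} {s s' s'' : State A B} {c : ℕ} (h : Does P s s' c) (hs : s' = s'') :
    Does P s s'' c := hs ▸ h

theorem skip (s : State A B) : Does .skip s s 1 := ⟨rfl, le_rfl⟩

theorem inc (s : State A B) (x : ℕ) : Does (.inc x) s (s.set x (s.reg x + 1)) 1 := ⟨rfl, le_rfl⟩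

theorem dec (s : State A B) (x : ℕ) : Does (.dec x) s (s.set x (s.reg x - 1)) 1 := ⟨rfl, le_rfl⟩

theorem seq {P Q : Prog A B} {s s' s'' : State A B} {c c' : ℕ} (h : Does P s s' c)
    (h' : Does Q s' s'' c') : Does (.seq P Q) s s'' (c + c') := by
  obtain ⟨rfl, h2⟩ := h
  exact ⟨h'.1, Nat.add_le_add h2 h'.2⟩

theorem ifz_pos {P Q : Prog A B} {s s' : State A B} {x c : ℕ} (hx : s.reg x = 0)
    (h : Does P s s' c) : Does (.ifz x P Q) s s' (1 + c) := by
  refine ⟨by rw [Prog.run, if_pos hx, h.1], ?_⟩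
  rw [Prog.cost, if_pos hx]
  exact Nat.add_le_add_left h.2 1

theorem ifz_neg {P Q : Prog A B} {s s' : State A B} {x c : ℕ} (hx : s.reg x ≠ 0)
    (h : Does Q s s' c) : Does (.ifz x P Q) s s' (1 + c) := by
  refine ⟨by rw [Prog.run, if_neg hx, h.1], ?_⟩
  rw [Prog.cost, if_neg hx]
  exact Nat.add_le_add_left h.2 1

theorem loop_zero {P : Prog A B} {s : State A B} {x : ℕ} (hx : s.reg x = 0) :
    Does (.loop x P) s s 1 := by
  simp [Does, Prog.run, Prog.cost, hx, iterCost]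

theorem loop_succ {P : Prog A B} {s s' s'' : State A B} {x n c c' : ℕ} (hx : s.reg x = n + 1)
    (h : Does P (s.decr x) s' c) (hx' : s'.reg x = n) (h' : Does (.loop x P) s' s'' c') :
    Does (.loop x P) s s'' (1 + c + c') := by
  obtain ⟨h1, h2⟩ := h
  obtain ⟨h3, h4⟩ := h'
  simp only [Prog.run, Prog.cost, hx'] at h3 h4
  simp only [Does, Prog.run, Prog.cost, hx, iterCost, Function.iterate_succ_apply]
  rw [h1]
  exact ⟨h3, by omega⟩

/-- A loop whose body takes at most `c` steps and which passes through the states `F i`. -/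
theorem loop_aux {P : Prog A B} {x c : ℕ} : ∀ (n : ℕ) (F : ℕ → State A B),
    (∀ i ≤ n, (F i).reg x = n - i) → (∀ i < n, Does P ((F i).decr x) (F (i + 1)) c) →
    Does (.loop x P) (F 0) (F n) (n * (1 + c) + 1) := by
  intro n
  induction n with
  | zero => intro F h _; exact (loop_zero (by simpa using h 0 le_rfl)).mono (by omega)
  | succ n ih =>
    intro F h h'
    have h1 := ih (fun i => F (i + 1)) (fun i hi => by rw [h _ (by omega)]; omega)
      (fun i hi => h' (i + 1) (by omega))
    exact (loop_succ (n := n) (by rw [h 0 (by omega)]; omega) (h' 0 (by omega))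
      (by rw [h _ (by omega)]; omega) h1).mono (by rw [add_one_mul]; omega)

theorem loop {P : Prog A B} {x c n : ℕ} {s s' : State A B} (F : ℕ → State A B)
    (h0 : F 0 = s) (hn : F n = s') (h : ∀ i ≤ n, (F i).reg x = n - i)
    (h' : ∀ i < n, Does P ((F i).decr x) (F (i + 1)) c) :
    Does (.loop x P) s s' (n * (1 + c) + 1) := by
  subst h0 hn
  exact loop_aux n F h h'

theorem clear (s : State A B) (x : ℕ) :
    Does (.loop x .skip) s (s.set x 0) (2 * s.reg x + 1) := by
  refine (loop (c := 1) (n := s.reg x) (fun i => s.set x (s.reg x - i)) ?_ (by simp)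
    (fun i _ => by simp) (fun i hi => (skip _).of_eq ?_)).mono (by omega)
  · apply State.ext' <;> simp +contextual
  · apply State.ext' <;> simp [State.decr]
    intro y
    split_ifs <;> omega

/-- The program that adds the register `x` to the register `y` and clears `x`. -/
theorem move (s : State A B) {x y : ℕ} (hxy : x ≠ y) :
    Does (.loop x (.inc y)) s ((s.set x 0).set y (s.reg y + s.reg x)) (2 * s.reg x + 1) := by
  refine (loop (c := 1) (n := s.reg x)
    (fun i => (s.set x (s.reg x - i)).set y (s.reg y + i)) ?_ (by simp)
    (fun i _ => by simp [hxy]) (fun i hi => (inc _ _).of_eq ?_)).mono (by omega)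
  · apply State.ext' <;> simp
    intro z; split_ifs <;> simp_all
  · apply State.ext' <;> simp [State.decr, hxy.symm]
    intro z
    split_ifs <;> omega

end Does

/-! ### Expressions -/

/-- Expressions over named variables, with values in `ℕ`. `tape f e` tells whether the letter of
the tape at position `e` exists and satisfies `f`, `sum v e f` is the sum of `f` over all values
of the variable `v` below `e`, and `letE v e f` is `f` with `e` for `v`. -/
inductive Expr (A : Type) : Type
  | var : ℕ → Expr A
  | const : ℕ → Expr A
  | add : Expr A → Expr A → Expr A
  | mul : Expr A → Expr A → Expr A
  | sub : Expr A → Expr A → Expr A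
  | ifz : Expr A → Expr A → Expr A → Expr A
  | tape : (A → Bool) → Expr A → Expr A
  | sum : ℕ → Expr A → Expr A → Expr A
  | letE : ℕ → Expr A → Expr A → Expr A

namespace Expr

/-- The value of an expression for a tape and an assignment. -/
def eval (T : List A) : Expr A → (ℕ → ℕ) → ℕ
  | var v, ρ => ρ v
  | const n, _ => n
  | add a b, ρ => eval T a ρ + eval T b ρ
  | mul a b, ρ => eval T a ρ * eval T b ρ
  | sub a b, ρ => eval T a ρ - eval T b ρ
  | ifz c a b, ρ => if eval T c ρ = 0 then eval T a ρ else eval T b ρ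
  | tape f e, ρ => if (T[eval T e ρ]?).elim false f then 1 else 0
  | sum v e f, ρ => ∑ i ∈ Finset.range (eval T e ρ), eval T f (Function.update ρ v i)
  | letE v e f, ρ => eval T f (Function.update ρ v (eval T e ρ))

/-- A number above all variables of an expression. -/
def bound : Expr A → ℕ
  | var v => v + 1
  | const _ => 0
  | add a b => max a.bound b.bound
  | mul a b => max a.bound b.bound
  | sub a b => max a.bound b.bound
  | ifz c a b => max c.bound (max a.bound b.bound)
  | tape _ e => e.bound
  | sum v e f => max (v + 1) (max e.bound f.bound)
  | letE v e f => max (v + 1) (max e.bound f.bound)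

/-- Registers above the variables hold intermediate results; the value of an expression must not
depend on them. -/
theorem eval_congr {T : List A} : ∀ (e : Expr A) {ρ ρ' : ℕ → ℕ},
    (∀ v < e.bound, ρ v = ρ' v) → e.eval T ρ = e.eval T ρ' := by
  intro e
  induction e with
  | var v => intro ρ ρ' h; exact h v (by simp [bound])
  | const n => intro ρ ρ' _; rfl
  | add a b iha ihb | mul a b iha ihb | sub a b iha ihb =>
    intro ρ ρ' h
    simp only [bound, lt_max_iff] at h
    simp only [eval, iha fun v hv => h v (.inl hv), ihb fun v hv => h v (.inr hv)]
  | ifz c a b ihc iha ihb =>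
    intro ρ ρ' h
    simp only [bound, lt_max_iff] at h
    simp only [eval, ihc fun v hv => h v (.inl hv), iha fun v hv => h v (.inr (.inl hv)),
      ihb fun v hv => h v (.inr (.inr hv))]
  | tape f e ih => intro ρ ρ' h; simp only [eval, ih h]
  | sum v e f ihe ihf =>
    intro ρ ρ' h
    simp only [bound, lt_max_iff] at h
    rw [eval, eval, ihe fun v hv => h v (.inr (.inl hv))]
    refine Finset.sum_congr rfl fun i _ => ihf fun w hw => ?_
    simp only [Function.update_apply, h w (.inr (.inr hw))]
  | letE v e f ihe ihf =>
    intro ρ ρ' h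
    simp only [bound, lt_max_iff] at h
    rw [eval, eval, ihe fun v hv => h v (.inr (.inl hv))]
    refine ihf fun w hw => ?_
    simp only [Function.update_apply, h w (.inr (.inr hw))]

/-- The program that adds the value of an expression to the register `r`, with scratch registers
from `t` on. -/
def comp : Expr A → ℕ → ℕ → Prog A B
  -- Reading a register destroys it, so its content is moved to `t` and `r` at once and then brought
  -- back from `t`.
  | var v, r, t => .seq (.loop v (.seq (.inc t) (.inc r))) (.loop t (.inc v))
  | const n, r, _ => n.rec .skip fun _ P => .seq (.inc r) P
  | add a b, r, t => .seq (comp a r t) (comp b r t)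
  | mul a b, r, t => .seq (comp a t (t + 1)) (.loop t (comp b r (t + 1)))
  | sub a b, r, t => .seq (comp a t (t + 1)) (.seq (comp b (t + 1) (t + 2))
      (.seq (.loop (t + 1) (.dec t)) (.loop t (.inc r))))
  | ifz c a b, r, t => .seq (comp c t (t + 1))
      -- Scratch registers must be empty again; in the first branch `t` already is.
      (.ifz t (comp a r t) (.seq (.loop t .skip) (comp b r t)))
  | tape f e, r, t => .seq (comp e t (t + 1)) (.seq (.loop t .right)
      (.ifsym f (.seq (.inc r) .rewind) .rewind))
  -- The register `t + 1` keeps the old value of `v`, which the bound variable shadows, and `t`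
  -- counts the rounds. The body may use scratch registers from `t + 2` on.
  | sum v e f, r, t => .seq (comp e t (t + 1)) (.seq (.loop v (.inc (t + 1)))
      (.seq (.loop t (.seq (comp f r (t + 2)) (.inc v)))
        (.seq (.loop v .skip) (.loop (t + 1) (.inc v)))))
  | letE v e f, r, t => .seq (comp e t (t + 1)) (.seq (.loop v (.inc (t + 1)))
      (.seq (.loop t (.inc v)) (.seq (comp f r (t + 2))
        (.seq (.loop v .skip) (.loop (t + 1) (.inc v))))))

/-- A register between the variables and the scratch space, other than the target, is safe. The
counters of enclosing loops are of this kind, which makes these loops well-formed. -/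
theorem keeps_comp {x : ℕ} : ∀ (e : Expr A) (r t : ℕ), e.bound ≤ x → x ≠ r → x < t →
    (e.comp r t : Prog A B).Keeps x := by
  intro e
  induction e with
  | var v =>
    intro r t h1 h2 h3
    simp only [bound] at h1
    simp only [comp, Prog.Keeps]; omega
  | const n =>
    intro r t h1 h2 h3
    simp only [comp]
    induction n with
    | zero => trivial
    | succ n ih => exact ⟨h2, ih h1⟩
  | add a b iha ihb =>
    intro r t h1 h2 h3
    simp only [bound, max_le_iff] at h1
    exact ⟨iha _ _ h1.1 h2 h3, ihb _ _ h1.2 h2 h3⟩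
  | mul a b iha ihb =>
    intro r t h1 h2 h3
    simp only [bound, max_le_iff] at h1
    exact ⟨iha _ _ h1.1 (by omega) (by omega), by omega, ihb _ _ h1.2 h2 (by omega)⟩
  | sub a b iha ihb =>
    intro r t h1 h2 h3
    simp only [bound, max_le_iff] at h1
    refine ⟨iha _ _ h1.1 (by omega) (by omega), ihb _ _ h1.2 (by omega) (by omega), ?_⟩
    simp only [Prog.Keeps]; omega
  | ifz c a b ihc iha ihb =>
    intro r t h1 h2 h3
    simp only [bound, max_le_iff] at h1
    refine ⟨ihc _ _ h1.1 (by omega) (by omega), iha _ _ h1.2.1 h2 h3, ⟨by omega, trivial⟩,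
      ihb _ _ h1.2.2 h2 h3⟩
  | tape f e ih =>
    intro r t h1 h2 h3
    refine ⟨ih _ _ h1 (by omega) (by omega), ⟨by omega, trivial⟩, ⟨h2, trivial⟩, trivial⟩
  | sum v e f ihe ihf =>
    intro r t h1 h2 h3
    simp only [bound, max_le_iff] at h1
    refine ⟨ihe _ _ h1.2.1 (by omega) (by omega), ?_, ⟨by omega, ihf _ _ h1.2.2 h2 (by omega), ?_⟩,
      ?_⟩ <;> simp only [Prog.Keeps, and_true] <;> omega
  | letE v e f ihe ihf =>
    intro r t h1 h2 h3
    simp only [bound, max_le_iff] at h1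
    refine ⟨ihe _ _ h1.2.1 (by omega) (by omega), ?_, ?_, ihf _ _ h1.2.2 h2 (by omega),
      ?_⟩ <;> simp only [Prog.Keeps, and_true] <;> omega

theorem wf_comp : ∀ (e : Expr A) (r t : ℕ), e.bound ≤ r → r < t → (e.comp r t : Prog A B).WF := by
  intro e
  induction e with
  | var v =>
    intro r t h1 h2
    simp only [bound] at h1
    simp only [comp, Prog.WF, Prog.Keeps, and_true]; omega
  | const n =>
    intro r t h1 h2
    simp only [comp]
    induction n with
    | zero => trivial
    | succ n ih => exact ⟨trivial, ih h1⟩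
  | add a b iha ihb =>
    intro r t h1 h2
    simp only [bound, max_le_iff] at h1
    exact ⟨iha _ _ h1.1 h2, ihb _ _ h1.2 h2⟩
  | mul a b iha ihb =>
    intro r t h1 h2
    simp only [bound, max_le_iff] at h1
    exact ⟨iha _ _ (by omega) (by omega), keeps_comp _ _ _ (by omega) (by omega) (by omega),
      ihb _ _ h1.2 (by omega)⟩
  | sub a b iha ihb =>
    intro r t h1 h2
    simp only [bound, max_le_iff] at h1
    refine ⟨iha _ _ (by omega) (by omega), ihb _ _ (by omega) (by omega), ?_⟩
    simp only [Prog.WF, Prog.Keeps, and_true]; omega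
  | ifz c a b ihc iha ihb =>
    intro r t h1 h2
    simp only [bound, max_le_iff] at h1
    refine ⟨ihc _ _ (by omega) (by omega), iha _ _ h1.2.1 h2, ⟨trivial, trivial⟩,
      ihb _ _ h1.2.2 h2⟩
  | tape f e ih =>
    intro r t h1 h2
    simp only [bound] at h1
    exact ⟨ih _ _ (by omega) (by omega), ⟨trivial, trivial⟩, ⟨trivial, trivial⟩, trivial⟩
  | sum v e f ihe ihf =>
    intro r t h1 h2
    simp only [bound, max_le_iff] at h1
    refine ⟨ihe _ _ (by omega) (by omega), ?_, ⟨⟨keeps_comp _ _ _ (by omega) (by omega) (by omega),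
      ?_⟩, ihf _ _ (by omega) (by omega), ?_⟩, ?_⟩ <;> simp only [Prog.WF, Prog.Keeps, and_true, true_and] <;> omega
  | letE v e f ihe ihf =>
    intro r t h1 h2
    simp only [bound, max_le_iff] at h1
    refine ⟨ihe _ _ (by omega) (by omega), ?_, ?_, ihf _ _ (by omega) (by omega), ?_⟩ <;>
      simp only [Prog.WF, Prog.Keeps, and_true, true_and] <;> omega

end Expr

end Counter

end

/-! ### Expressions are evaluated in polynomial time -/

section

open Turing Polynomial

theorem Polynomial.eval_le_eval_of_le (p : ℕ[X]) {a b : ℕ} (h : a ≤ b) : p.eval a ≤ p.eval b := by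
  induction p using Polynomial.induction_on' with
  | add p q hp hq => simp only [eval_add]; omega
  | monomial n c =>
    simp only [eval_monomial]
    exact Nat.mul_le_mul_left _ (Nat.pow_le_pow_left h n)

namespace Counter

variable {A B : Type}

namespace Does

theorem right (s : State A B) : Does .right s s.moveRight 1 := ⟨rfl, le_rfl⟩

theorem rewind (s : State A B) : Does .rewind s
    { s with left := [], right := s.left.reverse ++ s.right } (s.left.length + 1) := ⟨rfl, le_rfl⟩

theorem emit (s : State A B) (b : B) : Does (.emit b) s { s with out := b :: s.out } 1 :=
  ⟨rfl, le_rfl⟩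

/-- Moving the head to the right as often as a register says. -/
theorem moves (s : State A B) (x : ℕ) (hl : s.left = []) :
    Does (.loop x .right) s
      { s.set x 0 with
        left := (s.right.take (s.reg x)).reverse, right := s.right.drop (s.reg x) }
      (2 * s.reg x + 1) := by
  refine (loop (c := 1) (n := s.reg x) (fun i => { s.set x (s.reg x - i) with
    left := (s.right.take i).reverse, right := s.right.drop i }) ?_ (by simp)
    (fun i _ => by simp [State.set]) (fun i hi => (right _).of_eq ?_)).mono (by omega)
  · apply State.ext' <;> simp [State.set, hl]
  · by_cases h : i < s.right.length
    · have h1 : s.right.drop i = s.right[i] :: s.right.drop (i + 1) := by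
        rw [List.drop_eq_getElem_cons h]
      have h3 : s.right.take (i + 1) = s.right.take i ++ [s.right[i]] := by
        rw [List.take_append_getElem h]
      simp only [State.decr, State.set, State.moveRight, h3]
      generalize s.right.drop i = d at h1 ⊢
      subst h1
      refine State.ext' (fun y => ?_) (by rw [List.reverse_append]; rfl) rfl rfl
      simp only [Function.update_apply]
      split_ifs <;> omega
    · have h1 : s.right.drop i = [] := List.drop_of_length_le (by omega)
      have h2 : s.right.take i = s.right := List.take_of_length_le (by omega)
      have h3 : s.right.take (i + 1) = s.right := List.take_of_length_le (by omega)
      have h4 : s.right.drop (i + 1) = [] := List.drop_of_length_le (by omega)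
      apply State.ext' <;> simp [State.decr, State.set, State.moveRight, h1, h2, h3, h4]
      intro y
      simp only [Function.update_apply]
      split_ifs <;> omega

end Does

namespace Expr

/-- The program that adds `n` to a register. -/
theorem does_const (r t : ℕ) : ∀ (n : ℕ) (s : State A B),
    Does ((const n : Expr A).comp r t) s (s.set r (s.reg r + n)) (n + 1) := by
  intro n
  induction n with
  | zero =>
    intro s
    refine ((Does.skip s).of_eq ?_)
    apply State.ext' <;> simp +contextual
  | succ n ih =>
    intro s
    refine (((Does.inc s r).seq (ih _)).of_eq ?_).mono (by omega)
    apply State.ext' <;> simp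
    intro y
    split_ifs <;> omega

/-- The program for `e` is correct and takes polynomial time, and the values of `e` are
polynomially bounded. -/
def Feasible (B : Type) (e : Expr A) : Prop :=
  ∃ p : ℕ[X], ∀ (M r t : ℕ) (s : State A B), e.bound ≤ r → r < t →
    (∀ j ≥ t, s.reg j = 0) → s.left = [] → s.right.length ≤ M → (∀ v < e.bound, s.reg v ≤ M) →
    e.eval s.right s.reg ≤ p.eval M ∧
      Does (e.comp r t) s (s.set r (s.reg r + e.eval s.right s.reg)) (p.eval M)

theorem feasible_var (v : ℕ) :
    Feasible B (A := A) (var v) := by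
  refine ⟨C 5 * X + 4, fun M r t s h1 h2 h3 h4 h5 h6 => ?_⟩
  simp only [bound] at h1 h6
  have hv := h6 v (by omega)
  simp only [eval_add, eval_mul, eval_C, eval_X, Polynomial.eval_ofNat]
  refine ⟨by simp only [eval]; omega, ?_⟩
  have hl : Does (.loop v (.seq (.inc t) (.inc r))) s
      (((s.set v 0).set t (s.reg v)).set r (s.reg r + s.reg v)) (s.reg v * (1 + 2) + 1) := by
    refine Does.loop (n := s.reg v) (c := 2) (fun i => ((s.set v (s.reg v - i)).set t i).set r
      (s.reg r + i)) ?_ (by simp) (fun i _ => ?_) (fun i hi => ?_)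
    · refine State.ext' (fun x => ?_) rfl rfl rfl
      have := h3 t le_rfl
      simp only [State.set_reg]
      split_ifs <;> first | omega | (subst_vars; omega)
    · simp only [State.set_reg]; split_ifs <;> omega
    · refine ((Does.inc _ _).seq (Does.inc _ _)).of_eq ?_
      refine State.ext' (fun x => ?_) rfl rfl rfl
      simp only [State.decr, State.set_reg]
      split_ifs <;> omega
  refine ((hl.seq (Does.move _ (show t ≠ v by omega))).of_eq ?_).mono ?_
  · refine State.ext' (fun x => ?_) rfl rfl rfl
    have := h3 t le_rfl
    simp only [State.set_reg, eval]
    split_ifs <;> first | omega | (subst_vars; omega)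
  · simp only [State.set_reg]
    split_ifs <;> omega

theorem feasible_const (n : ℕ) :
    Feasible B (A := A) (const n) := by
  refine ⟨C (n + 1), fun M r t s h1 h2 h3 h4 h5 h6 => ?_⟩
  simp only [eval_C]
  exact ⟨by simp [eval], does_const r t n s⟩

theorem feasible_add {a b : Expr A} (iha : Feasible B a) (ihb : Feasible B b) :
    Feasible B (A := A) (add a b) := by
  obtain ⟨p, hp⟩ := iha
  obtain ⟨q, hq⟩ := ihb
  refine ⟨p + q, fun M r t s h1 h2 h3 h4 h5 h6 => ?_⟩
  simp only [bound, max_le_iff, lt_max_iff] at h1 h6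
  obtain ⟨a1, a2⟩ := hp M r t s h1.1 h2 h3 h4 h5 fun v hv => h6 v (.inl hv)
  obtain ⟨b1, b2⟩ := hq M r t (s.set r (s.reg r + a.eval s.right s.reg)) h1.2 h2
    (fun j hj => by rw [State.set_reg, if_neg (by omega)]; exact h3 j hj) h4 h5
    (fun v hv => by rw [State.set_reg, if_neg (by omega)]; exact h6 v (.inr hv))
  have hb : b.eval s.right (s.set r (s.reg r + a.eval s.right s.reg)).reg =
      b.eval s.right s.reg :=
    eval_congr b fun v hv => by rw [State.set_reg, if_neg (by omega)]
  rw [State.set_right, hb] at b1 b2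
  rw [eval_add]
  refine ⟨by simp only [eval]; omega, (a2.seq b2).of_eq ?_⟩
  refine State.ext' (fun x => ?_) rfl rfl rfl
  simp only [State.set_reg, eval]
  split_ifs <;> omega

/-- The second factor is added as often as the first one says, and computed anew each time. Its
value does not change, as neither `t` nor `r` is among its variables. -/
theorem feasible_mul {a b : Expr A} (iha : Feasible B a) (ihb : Feasible B b) :
    Feasible B (A := A) (mul a b) := by
  obtain ⟨p, hp⟩ := iha
  obtain ⟨q, hq⟩ := ihb
  refine ⟨p + (p * (1 + q) + 1), fun M r t s h1 h2 h3 h4 h5 h6 => ?_⟩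
  simp only [bound, max_le_iff, lt_max_iff] at h1 h6
  obtain ⟨a1, a2⟩ := hp M t (t + 1) s (by omega) (by omega) (fun j hj => h3 j (by omega)) h4 h5
    fun v hv => h6 v (.inl hv)
  have hb := hq M r (t + 1) s h1.2 (by omega) (fun j hj => h3 j (by omega)) h4 h5
    fun v hv => h6 v (.inr hv)
  simp only [eval_add, eval_mul, eval_one]
  have hmul := Nat.mul_le_mul a1 hb.1
  refine ⟨by simp only [eval]; nlinarith, ?_⟩
  rw [h3 t le_rfl, zero_add] at a2
  have hl : Does (.loop t (b.comp r (t + 1))) (s.set t (a.eval s.right s.reg))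
      (s.set r (s.reg r + a.eval s.right s.reg * b.eval s.right s.reg))
      (a.eval s.right s.reg * (1 + q.eval M) + 1) := by
    refine Does.loop (n := a.eval s.right s.reg) (fun i =>
      (s.set t (a.eval s.right s.reg - i)).set r (s.reg r + i * b.eval s.right s.reg)) ?_ ?_
      (fun i _ => ?_) (fun i hi => ?_)
    · refine State.ext' (fun x => ?_) rfl rfl rfl
      simp only [State.set_reg]
      split_ifs <;> first | omega | (subst_vars; omega)
    · refine State.ext' (fun x => ?_) rfl rfl rfl
      have := h3 t le_rfl
      simp only [State.set_reg]
      split_ifs <;> first | omega | (subst_vars; omega)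
    · simp only [State.set_reg]; split_ifs <;> omega
    · have hreg : ∀ v, v ≠ t → v ≠ r → (((s.set t (a.eval s.right s.reg - i)).set r
          (s.reg r + i * b.eval s.right s.reg)).decr t).reg v = s.reg v := by
        intro v hv hv'
        simp [State.decr, hv, hv']
      obtain ⟨-, b2⟩ := hq M r (t + 1) (((s.set t (a.eval s.right s.reg - i)).set r
          (s.reg r + i * b.eval s.right s.reg)).decr t) h1.2 (by omega)
        (fun j hj => by rw [hreg j (by omega) (by omega)]; exact h3 j (by omega)) h4 h5
        (fun v hv => by rw [hreg v (by omega) (by omega)]; exact h6 v (.inr hv))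
      refine b2.of_eq ?_
      have h7 : b.eval s.right (((s.set t (a.eval s.right s.reg - i)).set r
          (s.reg r + i * b.eval s.right s.reg)).decr t).reg = b.eval s.right s.reg :=
        eval_congr b fun v hv => hreg v (by omega) (by omega)
      simp only [State.decr, State.set_right] at h7 ⊢
      rw [h7]
      refine State.ext' (fun x => ?_) rfl rfl rfl
      simp only [State.set_reg]
      split_ifs <;> first | omega | (subst_vars; rw [add_one_mul]; omega)
  refine (a2.seq hl).mono ?_
  have := Nat.mul_le_mul_right (1 + q.eval M) a1
  omega

theorem feasible_sub {a b : Expr A} (iha : Feasible B a) (ihb : Feasible B b) :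
    Feasible B (A := A) (sub a b) := by
  obtain ⟨p, hp⟩ := iha
  obtain ⟨q, hq⟩ := ihb
  refine ⟨p + q + (C 2 * q + 1 + (C 2 * p + 1)), fun M r t s h1 h2 h3 h4 h5 h6 => ?_⟩
  simp only [bound, max_le_iff, lt_max_iff] at h1 h6
  obtain ⟨a1, a2⟩ := hp M t (t + 1) s (by omega) (by omega) (fun j hj => h3 j (by omega)) h4 h5
    fun v hv => h6 v (.inl hv)
  rw [h3 t le_rfl, zero_add] at a2
  set va := a.eval s.right s.reg with hva
  obtain ⟨b1, b2⟩ := hq M (t + 1) (t + 2) (s.set t va) (by omega) (by omega)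
    (fun j hj => by rw [State.set_reg, if_neg (by omega)]; exact h3 j (by omega)) h4 h5
    (fun v hv => by rw [State.set_reg, if_neg (by omega)]; exact h6 v (.inr hv))
  have hb : b.eval s.right (s.set t va).reg = b.eval s.right s.reg :=
    eval_congr b fun v hv => by rw [State.set_reg, if_neg (by omega)]
  rw [State.set_right, hb] at b1 b2
  set vb := b.eval s.right s.reg with hvb
  have hl : Does (.loop (t + 1) (.dec t)) ((s.set t va).set (t + 1)
      ((s.set t va).reg (t + 1) + vb)) (s.set t (va - vb)) (vb * (1 + 1) + 1) := by
    refine Does.loop (n := vb) (fun i => (s.set t (va - i)).set (t + 1) (vb - i)) ?_ ?_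
      (fun i _ => by simp) (fun i hi => (Does.dec _ _).of_eq ?_)
    · refine State.ext' (fun x => ?_) rfl rfl rfl
      have := h3 (t + 1) (by omega)
      simp only [State.set_reg]
      split_ifs <;> omega
    · refine State.ext' (fun x => ?_) rfl rfl rfl
      have := h3 (t + 1) (by omega)
      simp only [State.set_reg]
      split_ifs <;> first | omega | (subst_vars; omega)
    · refine State.ext' (fun x => ?_) rfl rfl rfl
      simp only [State.decr, State.set_reg]
      split_ifs <;> omega
  simp only [eval_add, eval_mul, eval_one, eval_C]
  refine ⟨by simp only [eval]; omega, ((a2.seq (b2.seq (hl.seq (Does.move _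
    (show t ≠ r by omega))))).of_eq ?_).mono ?_⟩
  · refine State.ext' (fun x => ?_) rfl rfl rfl
    have := h3 t le_rfl
    simp only [State.set_reg, eval]
    split_ifs <;> first | omega | (subst_vars; omega)
  · simp only [State.set_reg, if_true]
    omega

theorem feasible_ifz {c a b : Expr A} (ihc : Feasible B c) (iha : Feasible B a) (ihb : Feasible B b) :
    Feasible B (A := A) (ifz c a b) := by
  obtain ⟨p, hp⟩ := ihc
  obtain ⟨q, hq⟩ := iha
  obtain ⟨w, hw⟩ := ihb
  refine ⟨p + (1 + (q + (C 2 * p + 1 + w))), fun M r t s h1 h2 h3 h4 h5 h6 => ?_⟩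
  simp only [bound, max_le_iff, lt_max_iff] at h1 h6
  obtain ⟨c1, c2⟩ := hp M t (t + 1) s (by omega) (by omega) (fun j hj => h3 j (by omega)) h4 h5
    fun v hv => h6 v (.inl hv)
  rw [h3 t le_rfl, zero_add] at c2
  obtain ⟨a1, a2⟩ := hq M r t s h1.2.1 h2 h3 h4 h5 fun v hv => h6 v (.inr (.inl hv))
  obtain ⟨b1, b2⟩ := hw M r t s h1.2.2 h2 h3 h4 h5 fun v hv => h6 v (.inr (.inr hv))
  have hs : (s.set t 0) = s := by
    refine State.ext' (fun x => ?_) rfl rfl rfl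
    simp only [State.set_reg]
    split_ifs <;> first | omega | (subst_vars; omega) | (subst_vars; simp_all)
  simp only [eval_add, eval_mul, eval_one, eval_C]
  by_cases hc : c.eval s.right s.reg = 0
  · have he : (ifz c a b).eval s.right s.reg = a.eval s.right s.reg := by rw [eval, if_pos hc]
    rw [he]
    refine ⟨by omega, (c2.seq (Does.ifz_pos (by simpa using hc) ?_ (c := q.eval M))).mono
      (by omega)⟩
    rw [hc, hs]; exact a2
  · have he : (ifz c a b).eval s.right s.reg = b.eval s.right s.reg := by rw [eval, if_neg hc]
    rw [he]
    refine ⟨by omega, (c2.seq (Does.ifz_neg (by simpa using hc)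
      (((Does.clear _ _).of_eq ?_).seq b2))).mono ?_⟩
    · refine State.ext' (fun x => ?_) rfl rfl rfl
      have h3t := h3 t le_rfl
      simp only [State.set_reg]
      split_ifs with hx
      · rw [hx, h3t]
      · rfl
    · simp only [State.set_reg, if_true]; omega

/-- A head that moves past the end stays there and sees no letter, in agreement with the value `0`
for positions outside the word. Rewinding restores the assumption that the head is at the left end.
-/
theorem feasible_tape (f : A → Bool) {e : Expr A} (ih : Feasible B e) :
    Feasible B (A := A) (tape f e) := by
  obtain ⟨p, hp⟩ := ih
  refine ⟨p + (C 2 * p + 1 + (1 + (1 + (X + 1)))), fun M r t s h1 h2 h3 h4 h5 h6 => ?_⟩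
  obtain ⟨a1, a2⟩ := hp M t (t + 1) s (by simp only [bound] at h1; omega) (by omega)
    (fun j hj => h3 j (by omega)) h4 h5 h6
  rw [h3 t le_rfl, zero_add] at a2
  set n := e.eval s.right s.reg with hn
  have hm := Does.moves (s.set t n) t h4
  simp only [State.set_right, State.set_reg, if_true] at hm
  set s1 : State A B := { (s.set t n).set t 0 with
      left := (s.right.take n).reverse, right := s.right.drop n } with hs1
  have hlen : (s.right.take n).reverse.length ≤ M := by simp; omega
  have hsym : s1.right.head? = s.right[n]? := by simp [hs1]
  simp only [eval_add, eval_mul, eval_one, eval_C, eval_X]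
  have hs1r : ∀ x, s1.reg x = s.reg x := by
    intro x
    simp only [hs1, State.set_reg]
    have := h3 t le_rfl
    split_ifs <;> simp_all
  by_cases hf : (s.right[n]?).elim false f = true
  · have he : (tape f e).eval s.right s.reg = 1 := by rw [eval, ← hn, if_pos hf]
    rw [he]
    refine ⟨by omega, ((a2.seq (hm.seq (s'' := (s.set r (s.reg r + 1)))
      (c' := 1 + (1 + (M + 1))) ?_)).mono ?_)⟩
    swap
    · omega
    have h8 : Does (.seq (.inc r) .rewind) s1 (s.set r (s.reg r + 1)) (1 + (M + 1)) := by
      refine ((Does.inc s1 r).seq ((Does.rewind _).mono ?_)).of_eq ?_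
      · simp only [State.set_left]
        exact Nat.add_le_add_right hlen 1
      · apply State.ext' <;> simp [hs1r]
        · simp [h4]
        · simp [hs1]
        · simp [hs1]
    refine ⟨?_, ?_⟩
    · rw [Prog.run, hsym, if_pos hf]; exact h8.1
    · rw [Prog.cost, hsym, if_pos hf]; exact Nat.add_le_add_left h8.2 1
  · have he : (tape f e).eval s.right s.reg = 0 := by rw [eval, ← hn, if_neg hf]
    rw [he]
    refine ⟨by omega, ((a2.seq (hm.seq (s'' := (s.set r (s.reg r + 0)))
      (c' := 1 + (M + 1)) ?_)).mono ?_)⟩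
    swap
    · omega
    have h8 : Does .rewind s1 (s.set r (s.reg r + 0)) (M + 1) := by
      refine ((Does.rewind _).mono ?_).of_eq ?_
      · exact Nat.add_le_add_right hlen 1
      · apply State.ext' <;> simp [hs1r]
        · simp [h4]
        · simp [hs1]
        · simp [hs1]
    refine ⟨?_, ?_⟩
    · rw [Prog.run, hsym, if_neg hf]; exact h8.1
    · rw [Prog.cost, hsym, if_neg hf]; exact Nat.add_le_add_left h8.2 1

/-- Inside the body the bound variable can be as large as the value of `e`, so the bound for the
body is taken at `M + p(M)` instead of `M`; hence the composition of polynomials. The number of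
rounds is at most `p(M)`. -/
theorem feasible_sum (v : ℕ) {e f : Expr A} (ihe : Feasible B e) (ihf : Feasible B f) :
    Feasible B (A := A) (sum v e f) := by
  obtain ⟨p, hp⟩ := ihe
  obtain ⟨q, hq⟩ := ihf
  refine ⟨p + (C 2 * X + 1 + (p * (1 + (q.comp (X + p) + 1)) + 1 + (C 2 * p + 1 + (C 2 * X + 1)))),
    fun M r t s h1 h2 h3 h4 h5 h6 => ?_⟩
  simp only [bound, max_le_iff, lt_max_iff] at h1 h6
  obtain ⟨a1, a2⟩ := hp M t (t + 1) s (by omega) (by omega) (fun j hj => h3 j (by omega)) h4 h5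
    fun v hv => h6 v (.inr (.inl hv))
  rw [h3 t le_rfl, zero_add] at a2
  set n := e.eval s.right s.reg with hn
  have hv := h6 v (by omega)
  simp only [eval_add, eval_mul, eval_one, eval_C, eval_X, eval_comp]
  set D := q.eval (M + p.eval M) with hD
  have h3t := h3 t le_rfl
  have h3t' := h3 (t + 1) (by omega)
  -- the states of the main loop
  set F : ℕ → State A B := fun i => (((s.set (t + 1) (s.reg v)).set v i).set t (n - i)).set r
    (s.reg r + ∑ j ∈ Finset.range i, f.eval s.right (Function.update s.reg v j)) with hF
  have hFreg : ∀ i x, (F i).reg x = if x = r then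
      (s.reg r + ∑ j ∈ Finset.range i, f.eval s.right (Function.update s.reg v j))
      else if x = t then n - i else if x = v then i else if x = t + 1 then s.reg v else
      s.reg x := by
    intro i x; simp only [hF, State.set_reg]
  have hbody : ∀ i < n, f.eval s.right (Function.update s.reg v i) ≤ D ∧
      Does (.seq (f.comp r (t + 2)) (.inc v)) ((F i).decr t) (F (i + 1)) (D + 1) := by
    intro i hi
    have hreg : ∀ x, x < f.bound → ((F i).decr t).reg x = Function.update s.reg v i x := by
      intro x hx
      simp only [State.decr, State.set_reg, hFreg, Function.update_apply]
      split_ifs <;> omega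
    obtain ⟨b1, b2⟩ := hq (M + p.eval M) r (t + 2) ((F i).decr t) h1.2.2 (by omega)
      (fun j hj => by
        simp only [State.decr, State.set_reg, hFreg]
        rw [if_neg (by omega), if_neg (by omega), if_neg (by omega), if_neg (by omega),
          if_neg (by omega)]
        exact h3 j (by omega)) h4 (by simp only [State.decr, hF, State.set_right]; omega)
      (fun x hx => by
        rw [hreg x hx, Function.update_apply]
        split_ifs
        · omega
        · exact (h6 x (.inr (.inr hx))).trans (by omega))
    have h9 : f.eval ((F i).decr t).right ((F i).decr t).reg =
      f.eval s.right (Function.update s.reg v i) := eval_congr f hreg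
    rw [h9] at b1 b2
    refine ⟨b1, (b2.seq (Does.inc _ _)).of_eq ?_⟩
    apply State.ext'
    · intro x
      simp only [State.decr, State.set_reg, hFreg, Finset.sum_range_succ]
      split_ifs <;> omega
    · rfl
    · rfl
    · rfl
  have hsum : (sum v e f).eval s.right s.reg =
    ∑ j ∈ Finset.range n, f.eval s.right (Function.update s.reg v j) := rfl
  have hle : (sum v e f).eval s.right s.reg ≤ p.eval M * D := by
    rw [hsum]
    refine (Finset.sum_le_card_nsmul _ _ D fun i hi => (hbody i (by simpa using hi)).1).trans ?_
    simpa using Nat.mul_le_mul_right D a1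
  refine ⟨by nlinarith, ?_⟩
  have hsave : Does (.loop v (.inc (t + 1))) (s.set t n) (F 0) (2 * M + 1) := by
    refine ((Does.move _ (show v ≠ t + 1 by omega)).of_eq ?_).mono ?_
    · apply State.ext'
      · intro x
        simp only [State.set_reg, hFreg, Finset.sum_range_zero]
        split_ifs <;> first | omega | (subst_vars; omega)
      · rfl
      · rfl
      · rfl
    · simp only [State.set_reg]
      split_ifs <;> omega
  have hloop := Does.loop (x := t) F rfl rfl (fun i _ => by
    rw [hFreg, if_neg (by omega), if_pos rfl]) (fun i hi => (hbody i hi).2)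
  refine ((a2.seq (hsave.seq (hloop.seq (((Does.clear _ _).mono
    (c' := 2 * p.eval M + 1) ?_).seq ((Does.move _ (show t + 1 ≠ v by omega)).mono
    (c' := 2 * M + 1) ?_))))).of_eq ?_).mono ?_
  · rw [hFreg]; split_ifs <;> omega
  · simp only [State.set_reg, hFreg]
    split_ifs <;> omega
  · rw [hsum]
    apply State.ext'
    · intro x
      simp only [State.set_reg, hFreg]
      split_ifs <;> first | omega | (subst_vars; omega)
    · rfl
    · rfl
    · rfl
  · have := Nat.mul_le_mul_right (1 + (D + 1)) a1
    omega

theorem feasible_letE (v : ℕ) {e f : Expr A} (ihe : Feasible B e) (ihf : Feasible B f) :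
    Feasible B (A := A) (letE v e f) := by
  obtain ⟨p, hp⟩ := ihe
  obtain ⟨q, hq⟩ := ihf
  refine ⟨p + (C 2 * X + 1 + (C 2 * p + 1 + (q.comp (X + p) + (C 2 * p + 1 + (C 2 * X + 1))))),
    fun M r t s h1 h2 h3 h4 h5 h6 => ?_⟩
  simp only [bound, max_le_iff, lt_max_iff] at h1 h6
  obtain ⟨a1, a2⟩ := hp M t (t + 1) s (by omega) (by omega) (fun j hj => h3 j (by omega)) h4 h5
    fun v hv => h6 v (.inr (.inl hv))
  rw [h3 t le_rfl, zero_add] at a2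
  set n := e.eval s.right s.reg with hn
  have hv := h6 v (by omega)
  simp only [eval_add, eval_mul, eval_one, eval_C, eval_X, eval_comp]
  have h3t := h3 t le_rfl
  have h3t' := h3 (t + 1) (by omega)
  set s1 : State A B := (s.set (t + 1) (s.reg v)).set v n with hs1
  have hreg : ∀ x, x < f.bound → s1.reg x = Function.update s.reg v n x := by
    intro x hx
    simp only [hs1, State.set_reg, Function.update_apply]
    split_ifs <;> omega
  obtain ⟨b1, b2⟩ := hq (M + p.eval M) r (t + 2) s1 h1.2.2 (by omega)
      (fun j hj => by
        simp only [hs1, State.set_reg]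
        rw [if_neg (by omega), if_neg (by omega)]
        exact h3 j (by omega)) h4 (by simp only [hs1, State.set_right]; omega)
      (fun x hx => by
        rw [hreg x hx, Function.update_apply]
        split_ifs
        · omega
        · exact (h6 x (.inr (.inr hx))).trans (by omega))
  have h9 : f.eval s1.right s1.reg = (letE v e f).eval s.right s.reg := eval_congr f hreg
  rw [h9] at b1 b2
  refine ⟨by omega, ?_⟩
  have hsave := Does.move (s.set t n) (show v ≠ t + 1 by omega)
  have hload := (Does.move (((s.set t n).set v 0).set (t + 1)
    ((s.set t n).reg (t + 1) + (s.set t n).reg v)) (show t ≠ v by omega)).of_eq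
    (s'' := s1) (by
      apply State.ext'
      · intro x
        simp only [hs1, State.set_reg]
        split_ifs <;> first | omega | (subst_vars; omega)
      · rfl
      · rfl
      · rfl)
  refine (((a2.seq ((hsave.mono (c' := 2 * M + 1) ?_).seq
    ((hload.mono (c' := 2 * p.eval M + 1) ?_).seq (b2.seq
      (((Does.clear _ _).mono (c' := 2 * p.eval M + 1) ?_).seq
        ((Does.move _ (show t + 1 ≠ v by omega)).mono (c' := 2 * M + 1) ?_)))))).of_eq ?_))
  · simp only [State.set_reg]; split_ifs <;> omega
  · simp only [State.set_reg]; split_ifs <;> omega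
  · simp only [hs1, State.set_reg]; split_ifs <;> omega
  · simp only [hs1, State.set_reg]; split_ifs <;> omega
  · apply State.ext'
    · intro x
      simp only [hs1, State.set_reg]
      split_ifs <;> first | omega | (subst_vars; omega)
    · rfl
    · rfl
    · rfl

theorem feasible : ∀ e : Expr A, Feasible B e
  | var v => feasible_var v
  | const n => feasible_const n
  | add a b => feasible_add (feasible a) (feasible b)
  | mul a b => feasible_mul (feasible a) (feasible b)
  | sub a b => feasible_sub (feasible a) (feasible b)
  | ifz c a b => feasible_ifz (feasible c) (feasible a) (feasible b)
  | tape f e => feasible_tape f (feasible e)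
  | sum v e f => feasible_sum v (feasible e) (feasible f)
  | letE v e f => feasible_letE v (feasible e) (feasible f)

end Expr

end Counter

end

/-! ### Binary output and programs that write words -/

section

open Turing Polynomial

/-- The least significant bit comes first, so repeated halving produces the digits in the order in
which they are written. -/
theorem Computability.encodeNat_eq (n : ℕ) : encodeNat n =
    if n = 0 then [] else decide (n % 2 = 1) :: encodeNat (n / 2) := by
  rcases n with _ | n
  · rfl
  rw [if_neg (by omega)]
  have key : ∀ m : PosNum, encodePosNum m = if (m : ℕ) / 2 = 0 then [decide ((m : ℕ) % 2 = 1)] else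
      decide ((m : ℕ) % 2 = 1) :: encodeNat ((m : ℕ) / 2) := by
    intro m
    cases m with
    | one => rfl
    | bit0 m =>
      have h := m.to_nat_pos
      have h1 : ((m.bit0 : PosNum) : ℕ) = 2 * (m : ℕ) := by simp [two_mul, PosNum.cast_bit0]
      rw [h1, if_neg (by omega), show 2 * (m : ℕ) / 2 = m by omega]
      simp [encodePosNum, encodeNat, encodeNum]
    | bit1 m =>
      have h := m.to_nat_pos
      have h1 : ((m.bit1 : PosNum) : ℕ) = 2 * (m : ℕ) + 1 := by simp [two_mul, PosNum.cast_bit1]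
      rw [h1, if_neg (by omega), show (2 * (m : ℕ) + 1) / 2 = m by omega]
      simp [encodePosNum, encodeNat, encodeNum, Nat.add_mod]
  obtain ⟨m, hm⟩ : ∃ m : PosNum, ((n + 1 : ℕ) : Num) = Num.pos m := by
    rcases h : ((n + 1 : ℕ) : Num) with _ | m
    · have := congrArg (fun x : Num => (x : ℕ)) h
      simp only [Num.to_of_nat] at this
      exact absurd this (by simp)
    · exact ⟨m, rfl⟩
  have h3 : (m : ℕ) = n + 1 := by
    have := congrArg (fun x : Num => (x : ℕ)) hm
    simpa only [Num.to_of_nat, Num.cast_pos, eq_comm] using this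
  have h1 : encodeNat (n + 1) = encodePosNum m := by
    rw [encodeNat, hm]; rfl
  rw [h1, key, h3]
  split_ifs with h
  · rw [h]; rfl
  · rfl

namespace Counter

variable {A B : Type}

/-- Add a word to the output. -/
def State.write (s : State A B) (l : List B) : State A B := { s with out := l.reverse ++ s.out }

@[simp] theorem State.write_reg (s : State A B) (l : List B) : (s.write l).reg = s.reg := rfl
@[simp] theorem State.write_right (s : State A B) (l : List B) : (s.write l).right = s.right := rfl
@[simp] theorem State.write_out (s : State A B) (l : List B) :
    (s.write l).out = l.reverse ++ s.out := rfl

/-- Programs that write words, with variables whose values do not change otherwise. -/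
inductive Writer (A B : Type) : Type
  | skip : Writer A B
  | emit : B → Writer A B
  | nat : (Bool → B) → Expr A → Writer A B
  | seq : Writer A B → Writer A B → Writer A B
  | rep : ℕ → Expr A → Writer A B → Writer A B
  | ifz : Expr A → Writer A B → Writer A B → Writer A B

namespace Writer

/-- The word that is written. -/
def word (T : List A) : Writer A B → (ℕ → ℕ) → List B
  | skip, _ => []
  | emit b, _ => [b]
  | nat d e, ρ => (Computability.encodeNat (e.eval T ρ)).map d
  | seq P Q, ρ => word T P ρ ++ word T Q ρ
  | rep v e P, ρ => (List.range (e.eval T ρ)).flatMap fun i => word T P (Function.update ρ v i)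
  | ifz e P Q, ρ => if e.eval T ρ = 0 then word T P ρ else word T Q ρ

/-- A number above all variables. -/
def bound : Writer A B → ℕ
  | skip => 0
  | emit _ => 0
  | nat _ e => e.bound
  | seq P Q => max P.bound Q.bound
  | rep v e P => max (v + 1) (max e.bound P.bound)
  | ifz e P Q => max e.bound (max P.bound Q.bound)

theorem word_congr {T : List A} : ∀ (P : Writer A B) {ρ ρ' : ℕ → ℕ},
    (∀ v < P.bound, ρ v = ρ' v) → P.word T ρ = P.word T ρ' := by
  intro P
  induction P with
  | skip | emit b => intro ρ ρ' _; rfl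
  | nat d e => intro ρ ρ' h; simp only [word]; rw [Expr.eval_congr e h]
  | seq P Q ihP ihQ =>
    intro ρ ρ' h
    simp only [bound, lt_max_iff] at h
    simp only [word]
    rw [ihP fun v hv => h v (.inl hv), ihQ fun v hv => h v (.inr hv)]
  | rep v e P ih =>
    intro ρ ρ' h
    simp only [bound, lt_max_iff] at h
    simp only [word]
    rw [Expr.eval_congr e fun v hv => h v (.inr (.inl hv))]
    congr 1
    funext i
    refine ih fun w hw => ?_
    simp only [Function.update_apply]
    split_ifs
    · rfl
    · exact h w (.inr (.inr hw))
  | ifz e P Q ihP ihQ =>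
    intro ρ ρ' h
    simp only [bound, lt_max_iff] at h
    simp only [word]
    rw [Expr.eval_congr e fun v hv => h v (.inl hv), ihP fun v hv => h v (.inr (.inl hv)),
      ihQ fun v hv => h v (.inr (.inr hv))]

/-- Divide the register `t` by two and write the remainder, using the registers `t + 2` and
`t + 3`. -/
def halve (d : Bool → B) (t : ℕ) : Prog A B :=
  .ifz t .skip (.seq
    (.loop t (.ifz (t + 3) (.inc (t + 3)) (.seq (.dec (t + 3)) (.inc (t + 2)))))
    (.seq (.ifz (t + 3) (.emit (d false)) (.seq (.dec (t + 3)) (.emit (d true))))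
      (.loop (t + 2) (.inc t))))

/-- The counter program, which uses the registers from `t` on for intermediate results. -/
def comp : Writer A B → ℕ → Prog A B
  | skip, _ => .skip
  | emit b, _ => .emit b
  -- The value is computed twice: in `t`, where it is halved, and in `t + 1`, where it only counts
  -- rounds.
  | nat d e, t => .seq (e.comp t (t + 2)) (.seq (e.comp (t + 1) (t + 2))
      (.loop (t + 1) (halve d t)))
  | seq P Q, t => .seq (comp P t) (comp Q t)
  | rep v e P, t => .seq (e.comp t (t + 1)) (.seq (.loop v (.inc (t + 1)))
      (.seq (.loop t (.seq (comp P (t + 2)) (.inc v)))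
        (.seq (.loop v .skip) (.loop (t + 1) (.inc v)))))
  | ifz e P Q, t => .seq (e.comp t (t + 1))
      (.ifz t (comp P t) (.seq (.loop t .skip) (comp Q t)))

theorem keeps_comp {x : ℕ} : ∀ (P : Writer A B) (t : ℕ), P.bound ≤ x → x < t →
    (P.comp t).Keeps x := by
  intro P
  induction P with
  | skip | emit b => intro t _ _; trivial
  | nat d e =>
    intro t h1 h2
    simp only [bound] at h1
    refine ⟨Expr.keeps_comp _ _ _ h1 (by omega) (by omega),
      Expr.keeps_comp _ _ _ h1 (by omega) (by omega), ?_⟩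
    simp only [halve, Prog.Keeps, and_true, true_and]; omega
  | seq P Q ihP ihQ =>
    intro t h1 h2
    simp only [bound, max_le_iff] at h1
    exact ⟨ihP _ h1.1 h2, ihQ _ h1.2 h2⟩
  | rep v e P ih =>
    intro t h1 h2
    simp only [bound, max_le_iff] at h1
    refine ⟨Expr.keeps_comp _ _ _ h1.2.1 (by omega) (by omega), ?_,
      ⟨by omega, ih _ h1.2.2 (by omega), ?_⟩, ?_⟩ <;>
      simp only [Prog.Keeps, and_true] <;> omega
  | ifz e P Q ihP ihQ =>
    intro t h1 h2
    simp only [bound, max_le_iff] at h1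
    refine ⟨Expr.keeps_comp _ _ _ h1.1 (by omega) (by omega), ihP _ h1.2.1 h2, ?_,
      ihQ _ h1.2.2 h2⟩
    simp only [Prog.Keeps, and_true]; omega

theorem wf_comp : ∀ (P : Writer A B) (t : ℕ), P.bound ≤ t → (P.comp t).WF := by
  intro P
  induction P with
  | skip | emit b => intro t _; trivial
  | nat d e =>
    intro t h1
    simp only [bound] at h1
    refine ⟨Expr.wf_comp _ _ _ h1 (by omega), Expr.wf_comp _ _ _ (by omega) (by omega), ?_⟩
    simp only [halve, Prog.WF, Prog.Keeps, and_true, true_and]; omega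
  | seq P Q ihP ihQ =>
    intro t h1
    simp only [bound, max_le_iff] at h1
    exact ⟨ihP _ h1.1, ihQ _ h1.2⟩
  | rep v e P ih =>
    intro t h1
    simp only [bound, max_le_iff] at h1
    refine ⟨Expr.wf_comp _ _ _ h1.2.1 (by omega), ?_,
      ⟨⟨keeps_comp _ _ (by omega) (by omega), ?_⟩, ih _ (by omega), ?_⟩, ?_⟩ <;>
      simp only [Prog.WF, Prog.Keeps, and_true, true_and] <;> omega
  | ifz e P Q ihP ihQ =>
    intro t h1
    simp only [bound, max_le_iff] at h1
    exact ⟨Expr.wf_comp _ _ _ h1.1 (by omega), ihP _ h1.2.1, ⟨trivial, trivial⟩,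
      ihQ _ h1.2.2⟩

theorem does_halve (d : Bool → B) {t n : ℕ} {s : State A B} (h0 : s.reg t = n)
    (h2 : s.reg (t + 2) = 0) (h3 : s.reg (t + 3) = 0) :
    Does (halve d t) s ((s.set t (n / 2)).write
      (if n = 0 then [] else [d (decide (n % 2 = 1))])) (6 * n + 6) := by
  by_cases hn : n = 0
  · subst hn
    refine ((Does.ifz_pos h0 (Does.skip s)).of_eq ?_).mono (by omega)
    refine State.ext' (fun x => ?_) rfl rfl (by simp)
    simp only [State.write_reg, State.set_reg]
    split_ifs <;> simp_all
  · have hl : Does (.loop t (.ifz (t + 3) (.inc (t + 3)) (.seq (.dec (t + 3)) (.inc (t + 2))))) s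
        (((s.set t 0).set (t + 2) (n / 2)).set (t + 3) (n % 2)) (n * (1 + 3) + 1) := by
      -- After `i` decrements of `t` the other two registers hold the quotient and the remainder of
      -- `i` by two.
      refine Does.loop (n := n) (fun i => ((s.set t (n - i)).set (t + 2) (i / 2)).set (t + 3)
        (i % 2)) ?_ (by simp) (fun i _ => by simp) (fun i hi => ?_)
      · refine State.ext' (fun x => ?_) rfl rfl rfl
        simp only [State.set_reg]
        split_ifs <;> first | omega | (subst_vars; omega)
      · by_cases hi : i % 2 = 0
        · refine ((Does.ifz_pos ?_ (Does.inc _ _)).of_eq ?_).mono (by omega)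
          · simpa [State.decr] using hi
          · refine State.ext' (fun x => ?_) rfl rfl rfl
            simp only [State.decr, State.set_reg]
            split_ifs <;> omega
        · refine ((Does.ifz_neg ?_ ((Does.dec _ _).seq (Does.inc _ _))).of_eq ?_).mono (by omega)
          · simpa [State.decr] using hi
          · refine State.ext' (fun x => ?_) rfl rfl rfl
            simp only [State.decr, State.set_reg]
            split_ifs <;> omega
    set s1 := ((s.set t 0).set (t + 2) (n / 2)).set (t + 3) (n % 2) with hs1
    have hw : Does (.ifz (t + 3) (.emit (d false)) (.seq (.dec (t + 3)) (.emit (d true)))) s1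
        (((s.set t 0).set (t + 2) (n / 2)).write [d (decide (n % 2 = 1))]) 3 := by
      by_cases hi : n % 2 = 0
      · refine ((Does.ifz_pos ?_ (Does.emit _ _)).of_eq ?_).mono (by omega)
        · simp [hs1, hi]
        · refine State.ext' (fun x => ?_) rfl rfl ?_
          · simp only [hs1, State.set_reg, State.write_reg]
            split_ifs <;> first | omega | (subst_vars; omega)
          · simp [hs1, hi]
      · have hi' : n % 2 = 1 := by omega
        refine ((Does.ifz_neg ?_ ((Does.dec _ _).seq (Does.emit _ _))).of_eq ?_).mono (by omega)
        · simp [hs1, hi']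
        · refine State.ext' (fun x => ?_) rfl rfl ?_
          · simp only [hs1, State.set_reg, State.write_reg]
            split_ifs <;> first | omega | (subst_vars; omega)
          · simp [hs1, hi']
    refine ((Does.ifz_neg (by omega) (hl.seq (hw.seq (Does.move _
      (show t + 2 ≠ t by omega))))).of_eq ?_).mono ?_
    · refine State.ext' (fun x => ?_) rfl rfl ?_
      · simp only [State.set_reg, State.write_reg]
        split_ifs <;> first | omega | (subst_vars; omega)
      · simp [hn]
    · simp; omega

/-- The register `t + 1` is a clock. Since `n ≤ k`, the number has reached zero before the clock
runs out, and a round with zero writes nothing. The bound `n₀` makes the cost of all rounds uniform.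
-/
theorem does_digits (d : Bool → B) {t n₀ : ℕ} : ∀ (k n : ℕ) (s : State A B), n ≤ k → n ≤ n₀ →
    s.reg t = n → s.reg (t + 1) = k → s.reg (t + 2) = 0 → s.reg (t + 3) = 0 →
    Does (.loop (t + 1) (halve d t)) s (((s.set t 0).set (t + 1) 0).write
      ((Computability.encodeNat n).map d)) (k * (1 + (6 * n₀ + 6)) + 1) := by
  intro k
  induction k with
  | zero =>
    intro n s h1 h0 h2 h3 h4 h5
    obtain rfl : n = 0 := by omega
    refine ((Does.loop_zero h3).of_eq ?_).mono (by omega)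
    refine State.ext' (fun x => ?_) rfl rfl (by rw [Computability.encodeNat_eq]; simp)
    simp only [State.set_reg, State.write_reg]
    split_ifs <;> first | omega | (subst_vars; omega)
  | succ k ih =>
    intro n s h1 h0 h2 h3 h4 h5
    have hb := does_halve d (t := t) (n := n) (s := s.decr (t + 1)) (by simp [State.decr, h2])
      (by simp [State.decr, h4]) (by simp [State.decr, h5])
    have hr := ih (n / 2) (((s.decr (t + 1)).set t (n / 2)).write
      (if n = 0 then [] else [d (decide (n % 2 = 1))])) (by omega) (by omega)
      (by simp) (by simp [State.decr, h3]) (by simp [State.decr, h4]) (by simp [State.decr, h5])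
    refine ((Does.loop_succ h3 (hb.mono (c' := 6 * n₀ + 6) (by omega)) (by simp [State.decr, h3])
      hr).of_eq ?_).mono (by rw [add_one_mul]; omega)
    refine State.ext' (fun x => ?_) rfl rfl ?_
    · simp only [State.set_reg, State.write_reg, State.decr]
      split_ifs <;> omega
    · conv_rhs => rw [State.write_out, Computability.encodeNat_eq]
      by_cases hn : n = 0
      · subst hn
        simp [State.decr, Computability.encodeNat_eq 0]
      · simp [hn, State.decr]

/-- The program is correct and takes polynomial time. -/
def Feasible (P : Writer A B) : Prop :=
  ∃ p : ℕ[X], ∀ (M t : ℕ) (s : State A B), P.bound ≤ t → (∀ j ≥ t, s.reg j = 0) →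
    s.left = [] → s.right.length ≤ M → (∀ v < P.bound, s.reg v ≤ M) →
    Does (P.comp t) s (s.write (P.word s.right s.reg)) (p.eval M)

theorem feasible_nat (d : Bool → B) (e : Expr A) : Feasible (nat d e) := by
  obtain ⟨p, hp⟩ := Expr.feasible (B := B) e
  refine ⟨p + (p + (p * (1 + (6 * p + 6)) + 1)), fun M t s h1 h3 h4 h5 h6 => ?_⟩
  simp only [bound] at h1 h6
  obtain ⟨a1, a2⟩ := hp M t (t + 2) s h1 (by omega) (fun j hj => h3 j (by omega)) h4 h5 h6
  rw [h3 t le_rfl, zero_add] at a2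
  set n := e.eval s.right s.reg with hn
  obtain ⟨-, b2⟩ := hp M (t + 1) (t + 2) (s.set t n) (by omega) (by omega)
    (fun j hj => by rw [State.set_reg, if_neg (by omega)]; exact h3 j (by omega)) h4 h5
    (fun v hv => by rw [State.set_reg, if_neg (by omega)]; exact h6 v hv)
  have he : e.eval s.right (s.set t n).reg = n :=
    Expr.eval_congr e fun v hv => by rw [State.set_reg, if_neg (by omega)]
  rw [State.set_right, he, State.set_reg, if_neg (by omega), h3 (t + 1) (by omega), zero_add] at b2
  have hd := does_digits (A := A) d (t := t) (n₀ := n) n n ((s.set t n).set (t + 1) n) le_rfl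
    le_rfl (by simp) (by simp) (by simp; exact h3 _ (by omega)) (by simp; exact h3 _ (by omega))
  refine ((a2.seq (b2.seq hd)).of_eq ?_).mono ?_
  · refine State.ext' (fun x => ?_) rfl rfl rfl
    have h7 := h3 t le_rfl
    have h8 := h3 (t + 1) (by omega)
    simp only [State.set_reg, State.write_reg]
    split_ifs <;> first | omega | (subst_vars; omega)
  · simp only [eval_add, eval_mul, eval_one, Polynomial.eval_ofNat]
    have := Nat.mul_le_mul a1 (show 1 + (6 * n + 6) ≤ 1 + (6 * p.eval M + 6) by omega)
    omega

/-- As for sums of expressions, the bound for the body is taken at `M + p(M)`. The output so far is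
part of the states through which the loop passes. -/
theorem feasible_rep (v : ℕ) (e : Expr A) {P : Writer A B} (ih : Feasible P) :
    Feasible (rep v e P) := by
  obtain ⟨p, hp⟩ := Expr.feasible (B := B) e
  obtain ⟨q, hq⟩ := ih
  refine ⟨p + (C 2 * X + 1 + (p * (1 + (q.comp (X + p) + 1)) + 1 + (C 2 * p + 1 + (C 2 * X + 1)))),
    fun M t s h1 h3 h4 h5 h6 => ?_⟩
  simp only [bound, max_le_iff, lt_max_iff] at h1 h6
  obtain ⟨a1, a2⟩ := hp M t (t + 1) s (by omega) (by omega) (fun j hj => h3 j (by omega)) h4 h5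
    fun v hv => h6 v (.inr (.inl hv))
  rw [h3 t le_rfl, zero_add] at a2
  set n := e.eval s.right s.reg with hn
  have hv := h6 v (by omega)
  simp only [eval_add, eval_mul, eval_one, eval_C, eval_X, eval_comp]
  set D := q.eval (M + p.eval M) with hD
  have h3t := h3 t le_rfl
  have h3t' := h3 (t + 1) (by omega)
  set W : ℕ → List B := fun i =>
    (List.range i).flatMap fun j => P.word s.right (Function.update s.reg v j) with hW
  set F : ℕ → State A B := fun i =>
    (((s.set (t + 1) (s.reg v)).set v i).set t (n - i)).write (W i) with hF
  have hFreg : ∀ i x, (F i).reg x = if x = t then n - i else if x = v then i else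
      if x = t + 1 then s.reg v else s.reg x := by
    intro i x; simp only [hF, State.set_reg, State.write_reg]
  have hbody : ∀ i < n,
      Does (.seq (P.comp (t + 2)) (.inc v)) ((F i).decr t) (F (i + 1)) (D + 1) := by
    intro i hi
    have hreg : ∀ x, x < P.bound → ((F i).decr t).reg x = Function.update s.reg v i x := by
      intro x hx
      simp only [State.decr, State.set_reg, hFreg, Function.update_apply]
      split_ifs <;> omega
    have b2 := hq (M + p.eval M) (t + 2) ((F i).decr t) (by omega)
      (fun j hj => by
        simp only [State.decr, State.set_reg, hFreg]
        rw [if_neg (by omega), if_neg (by omega), if_neg (by omega), if_neg (by omega)]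
        exact h3 j (by omega)) h4
      (by simp only [State.decr, hF, State.set_right, State.write_right]; omega)
      (fun x hx => by
        rw [hreg x hx, Function.update_apply]
        split_ifs
        · omega
        · exact (h6 x (.inr (.inr hx))).trans (by omega))
    have h9 : P.word ((F i).decr t).right ((F i).decr t).reg =
      P.word s.right (Function.update s.reg v i) := word_congr P hreg
    rw [h9] at b2
    refine (b2.seq (Does.inc _ _)).of_eq ?_
    refine State.ext' (fun x => ?_) rfl rfl ?_
    · simp only [State.decr, State.set_reg, State.write_reg, hFreg]
      split_ifs <;> omega
    · simp [hF, hW, State.decr, List.range_succ]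
  have hsave : Does (.loop v (.inc (t + 1))) (s.set t n) (F 0) (2 * M + 1) := by
    refine ((Does.move _ (show v ≠ t + 1 by omega)).of_eq ?_).mono ?_
    · refine State.ext' (fun x => ?_) rfl rfl ?_
      · simp only [State.set_reg, hFreg]
        split_ifs <;> omega
      · simp [hF, hW]
    · simp only [State.set_reg]
      split_ifs <;> omega
  have hloop := Does.loop (x := t) F rfl rfl (fun i _ => by rw [hFreg, if_pos rfl]) hbody
  refine ((a2.seq (hsave.seq (hloop.seq (((Does.clear _ _).mono
    (c' := 2 * p.eval M + 1) ?_).seq ((Does.move _ (show t + 1 ≠ v by omega)).mono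
    (c' := 2 * M + 1) ?_))))).of_eq ?_).mono ?_
  · rw [hFreg]; split_ifs <;> omega
  · simp only [State.set_reg, hFreg]
    split_ifs <;> omega
  · refine State.ext' (fun x => ?_) rfl rfl rfl
    simp only [State.set_reg, State.write_reg, hFreg]
    split_ifs <;> first | omega | (subst_vars; omega)
  · have := Nat.mul_le_mul_right (1 + (D + 1)) a1
    omega

theorem feasible_ifz (e : Expr A) {P Q : Writer A B} (ihP : Feasible P) (ihQ : Feasible Q) :
    Feasible (ifz e P Q) := by
  obtain ⟨p, hp⟩ := Expr.feasible (B := B) e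
  obtain ⟨q, hq⟩ := ihP
  obtain ⟨w, hw⟩ := ihQ
  refine ⟨p + (1 + (q + (C 2 * p + 1 + w))), fun M t s h1 h3 h4 h5 h6 => ?_⟩
  simp only [bound, max_le_iff, lt_max_iff] at h1 h6
  obtain ⟨c1, c2⟩ := hp M t (t + 1) s (by omega) (by omega) (fun j hj => h3 j (by omega)) h4 h5
    fun v hv => h6 v (.inl hv)
  rw [h3 t le_rfl, zero_add] at c2
  have a2 := hq M t s h1.2.1 h3 h4 h5 fun v hv => h6 v (.inr (.inl hv))
  have b2 := hw M t s h1.2.2 h3 h4 h5 fun v hv => h6 v (.inr (.inr hv))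
  have hs : (s.set t 0) = s := by
    refine State.ext' (fun x => ?_) rfl rfl rfl
    have := h3 t le_rfl
    simp only [State.set_reg]
    split_ifs <;> simp_all
  simp only [eval_add, eval_mul, eval_one, eval_C]
  by_cases hc : e.eval s.right s.reg = 0
  · have he : (ifz e P Q).word s.right s.reg = P.word s.right s.reg := by rw [word, if_pos hc]
    rw [he]
    refine (c2.seq (Does.ifz_pos (by simpa using hc) ?_ (c := q.eval M))).mono
      (by omega)
    rw [hc, hs]; exact a2
  · have he : (ifz e P Q).word s.right s.reg = Q.word s.right s.reg := by rw [word, if_neg hc]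
    rw [he]
    refine (c2.seq (Does.ifz_neg (by simpa using hc)
      (((Does.clear _ _).of_eq (s'' := s) ?_).seq b2))).mono ?_
    · refine State.ext' (fun x => ?_) rfl rfl rfl
      have h3t := h3 t le_rfl
      simp only [State.set_reg]
      split_ifs with hx
      · rw [hx, h3t]
      · rfl
    · simp only [State.set_reg, if_true]; omega

theorem feasible : ∀ P : Writer A B, Feasible P
  | skip => ⟨1, fun _ _ s _ _ _ _ _ => by
      rw [eval_one]; exact Does.skip s⟩
  | emit b => ⟨1, fun _ _ s _ _ _ _ _ => by
      rw [eval_one]; exact Does.emit s b⟩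
  | nat d e => feasible_nat d e
  | seq P Q => by
    obtain ⟨p, hp⟩ := feasible P
    obtain ⟨q, hq⟩ := feasible Q
    refine ⟨p + q, fun M t s h1 h3 h4 h5 h6 => ?_⟩
    simp only [bound, max_le_iff, lt_max_iff] at h1 h6
    rw [eval_add]
    refine ((hp M t s h1.1 h3 h4 h5 fun v hv => h6 v (.inl hv)).seq
      (hq M t (s.write _) h1.2 h3 h4 h5 fun v hv => h6 v (.inr hv))).of_eq ?_
    simp [State.write, word]
  | rep v e P => feasible_rep v e (feasible P)
  | ifz e P Q => feasible_ifz e (feasible P) (feasible Q)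

end Writer

end Counter

end

section

/-! ### Sparse subgraphs with small matchings -/

open Finset in
/-- A bound for the matching weight when all edges have weight one. -/
theorem maxMatchingWeight_le_iff {V : Type} [Fintype V] {G : SimpleGraph V}
    {w : Sym2 V → ℕ} (hw : ∀ e ∈ G.edgeSet, w e = 1) {K : ℕ} :
    maxMatchingWeight G w ≤ K ↔ ∀ M, IsEdgeMatching G M → #M ≤ K := by
  classical
  simp only [maxMatchingWeight, Finset.sup_le_iff, Finset.mem_filter, Finset.mem_univ, true_and]
  refine forall₂_congr fun M hM => ?_
  rw [Finset.sum_congr rfl fun e he => hw e (hM.1 he)]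
  simp

namespace SimpleGraph

open Finset

variable {V : Type} [Fintype V] [DecidableEq V]

/-- Vertices of high degree can be matched to distinct vertices outside a given set. -/
theorem exists_injective_neighbor (F : SimpleGraph V) [DecidableRel F.Adj] {H Z : Finset V}
    {D : ℕ} (hH : ∀ v ∈ H, D ≤ F.degree v) (hc : #Z + #H ≤ D) :
    ∃ f : H → V, Function.Injective f ∧ ∀ v : H, F.Adj v (f v) ∧ f v ∉ Z := by
  obtain ⟨f, hf, hf'⟩ := (Finset.all_card_le_biUnion_card_iff_exists_injective
    (fun v : H => F.neighborFinset v \ Z)).1 (fun s => by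
      rcases s.eq_empty_or_nonempty with rfl | ⟨v, hv⟩
      · simp
      -- Hall's condition holds because already one vertex has `#H` neighbors outside `Z`.
      · calc #s ≤ #H := by simpa using Finset.card_le_univ s
          _ ≤ #(F.neighborFinset v \ Z) := by
            have h1 := hH v v.2
            have h2 := Finset.le_card_sdiff Z (F.neighborFinset v)
            rw [card_neighborFinset_eq_degree] at h2
            omega
          _ ≤ _ := Finset.card_le_card (Finset.subset_biUnion_of_mem
            (fun v : H => F.neighborFinset v \ Z) hv))
  refine ⟨f, hf, fun v => ?_⟩
  have := hf' v
  simpa using this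

/-- Matching the vertices of `H` to vertices outside of `Z ⊇ H`. -/
theorem exists_isEdgeMatching (F : SimpleGraph V) [DecidableRel F.Adj] {H Z : Finset V}
    {D : ℕ} (hH : ∀ v ∈ H, D ≤ F.degree v) (hc : #Z + #H ≤ D) (hHZ : H ⊆ Z) :
    ∃ M, IsEdgeMatching F M ∧ #M = #H ∧ ∀ e ∈ M, ∃ v ∈ H, ∃ u ∉ Z, e = s(v, u) := by
  obtain ⟨f, hf, hf'⟩ := F.exists_injective_neighbor hH hc
  have hne : ∀ u v : H, (u : V) ≠ f v := fun u v h => (hf' v).2 (h ▸ hHZ u.2)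
  have hinj : Function.Injective fun v : H => s((v : V), f v) := by
    intro u v huv
    simp only [Sym2.eq_iff] at huv
    rcases huv with h | h
    · exact Subtype.ext h.1
    · exact absurd h.1 (hne _ _)
  refine ⟨Finset.univ.image fun v : H => s((v : V), f v), ⟨?_, ?_⟩, ?_, ?_⟩
  · intro e he
    simp only [Finset.coe_image, Set.mem_image] at he
    obtain ⟨v, -, rfl⟩ := he
    exact (hf' v).1
  · intro e he e' he' hee v ⟨hv, hv'⟩
    simp only [Finset.mem_image, Finset.mem_univ, true_and] at he he'
    obtain ⟨a, rfl⟩ := he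
    obtain ⟨a', rfl⟩ := he'
    simp only [Sym2.mem_iff] at hv hv'
    apply hee
    rcases hv with rfl | rfl <;> rcases hv' with h | h
    · rw [Subtype.ext h]
    · exact absurd h (hne _ _)
    · exact absurd h.symm (hne _ _)
    · rw [hf h]
  · rw [Finset.card_image_of_injective _ hinj]; simp
  · intro e he
    simp only [Finset.mem_image, Finset.mem_univ, true_and] at he
    obtain ⟨a, rfl⟩ := he
    exact ⟨a, a.2, f a, (hf' a).2, rfl⟩

theorem card_le_sum_degree (F : SimpleGraph V) [DecidableRel F.Adj] {E : Finset (Sym2 V)}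
    {W : Finset V} (hE : ↑E ⊆ F.edgeSet) (hW : ∀ e ∈ E, ∃ v ∈ W, v ∈ e) :
    #E ≤ ∑ v ∈ W, F.degree v := by
  calc #E ≤ #(W.biUnion fun v => F.incidenceFinset v) := by
        refine Finset.card_le_card fun e he => ?_
        obtain ⟨v, hv, hve⟩ := hW e he
        simp only [Finset.mem_biUnion, mem_incidenceFinset]
        exact ⟨v, hv, hE he, hve⟩
    _ ≤ ∑ v ∈ W, #(F.incidenceFinset v) := Finset.card_biUnion_le
    _ = _ := by simp [card_incidenceFinset_eq_degree]

/-- Few vertices cover all edges of a graph without large matchings. -/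
theorem exists_cover (F : SimpleGraph V) {K : ℕ} (hK : ∀ M, IsEdgeMatching F M → #M ≤ K) :
    ∃ W : Finset V, #W ≤ 2 * K ∧ ∀ e ∈ F.edgeSet, ∃ v ∈ W, v ∈ e := by
  classical
  obtain ⟨M, hM, hmax⟩ := (Finset.univ.filter fun M => IsEdgeMatching F M).exists_max_image card
    ⟨∅, by simp [IsEdgeMatching]⟩
  simp only [Finset.mem_filter, Finset.mem_univ, true_and] at hM hmax
  refine ⟨M.biUnion fun e => e.toFinset, ?_, fun e he => ?_⟩
  · calc #(M.biUnion fun e => e.toFinset) ≤ ∑ e ∈ M, #e.toFinset := Finset.card_biUnion_le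
      _ ≤ ∑ e ∈ M, 2 := Finset.sum_le_sum fun e _ => by
          rw [Sym2.card_toFinset]; split_ifs <;> simp
      _ ≤ 2 * K := by
          rw [Finset.sum_const, smul_eq_mul, mul_comm]
          exact Nat.mul_le_mul_left 2 (hK M hM)
  · by_contra! h
    simp only [Finset.mem_biUnion, Sym2.mem_toFinset, forall_exists_index, and_imp] at h
    -- An edge of the maximum matching has its own ends covered, so an uncovered edge is a new one
    -- and enlarges the matching.
    have heM : e ∉ M := fun heM => by
      induction e with
      | _ a b => exact h a _ heM (by simp) (by simp)
    have h2 : IsEdgeMatching F (insert e M) := by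
      refine ⟨?_, ?_⟩
      · rw [Finset.coe_insert]
        exact Set.insert_subset he hM.1
      · intro e₁ h₁ e₂ h₂ h₃ v ⟨hv, hv'⟩
        simp only [Finset.mem_insert] at h₁ h₂
        rcases h₁ with rfl | h₁ <;> rcases h₂ with rfl | h₂
        · exact h₃ rfl
        · exact h v _ h₂ hv' hv
        · exact h v _ h₁ hv hv'
        · exact hM.2 _ h₁ _ h₂ h₃ v ⟨hv, hv'⟩
    have := hmax _ h2
    rw [Finset.card_insert_of_notMem heM] at this
    omega

/-- Let all vertices in `C` have the same large degree, and all others degree at most one. Then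
enough edges of `G` to have the degree sum of `K` vertices in `C` can only have matching number
`K` if they are the edges at `K` independent vertices in `C`. -/
theorem exists_deleteEdges_iff (G : SimpleGraph V) [DecidableRel G.Adj] {C : Finset V}
    {K d : ℕ} (hC : ∀ v ∈ C, G.degree v = d) (hC' : ∀ v ∉ C, G.degree v ≤ 1)
    (hd : 2 * K * (2 * K + 1) < d) (hE : K * d ≤ #G.edgeFinset) :
    (∃ I : Finset (Sym2 V), ↑I ⊆ G.edgeSet ∧ #I ≤ #G.edgeFinset - K * d ∧
      ∀ M, IsEdgeMatching (G.deleteEdges I) M → #M ≤ K) ↔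
    ∃ U ⊆ C, #U = K ∧ ∀ u ∈ U, ∀ v ∈ U, ¬ G.Adj u v := by
  constructor
  · rintro ⟨I, hI, hIc, hM⟩
    set F := G.deleteEdges I with hF
    have hFG : F ≤ G := G.deleteEdges_le I
    have hFE : F.edgeFinset = G.edgeFinset \ I := by
      ext e
      simp [hF, edgeSet_deleteEdges]
    have hFc : K * d ≤ #F.edgeFinset := by
      have h1 := Finset.le_card_sdiff I G.edgeFinset
      rw [← hFE] at h1
      omega
    have hdeg : ∀ v, F.degree v ≤ G.degree v := fun v => degree_le_of_le hFG
    -- The threshold `2K + 2` serves both matchings built below: `K + 1` vertices that avoid each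
    -- other, and `K` vertices that avoid each other and the two ends of one more edge.
    set H : Finset V := Finset.univ.filter fun v => 2 * K + 2 ≤ F.degree v with hH
    have hHm : ∀ v, v ∈ H ↔ 2 * K + 2 ≤ F.degree v := by simp [hH]
    have hHC : H ⊆ C := by
      intro v hv
      by_contra h
      have h1 := hC' v h
      have h2 := hdeg v
      have h3 := (hHm v).1 hv
      omega
    have hle : #H ≤ K := by
      by_contra! h
      obtain ⟨H', hH', hc⟩ := Finset.exists_subset_card_eq (show K + 1 ≤ #H from h)
      obtain ⟨M, h1, h2, -⟩ := F.exists_isEdgeMatching (H := H') (Z := H')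
        (fun v hv => (hHm v).1 (hH' hv)) (by omega) subset_rfl
      have := hM M h1
      omega
    have hsumH : ∑ v ∈ H, F.degree v ≤ #H * d := by
      refine (Finset.sum_le_card_nsmul _ _ d fun v hv => ?_)
      exact (hdeg v).trans (hC v (hHC hv)).le
    obtain ⟨W, hW, hWe⟩ := F.exists_cover hM
    -- With fewer than `K` vertices in `H`, the cover meets at most `(K - 1) d + 2K(2K + 1) < K d`
    -- edges.
    have hge : K ≤ #H := by
      by_contra! h
      have h1 : #F.edgeFinset ≤ ∑ v ∈ H ∪ (W \ H), F.degree v := by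
        refine F.card_le_sum_degree (by simp) fun e he => ?_
        obtain ⟨v, hv, hve⟩ := hWe e (by simpa using he)
        refine ⟨v, ?_, hve⟩
        by_cases hvH : v ∈ H <;> simp [hv, hvH]
      rw [Finset.sum_union Finset.disjoint_sdiff] at h1
      have h2 : ∑ v ∈ W \ H, F.degree v ≤ #(W \ H) * (2 * K + 1) := by
        refine (Finset.sum_le_card_nsmul _ _ _ fun v hv => ?_)
        have := mt (hHm v).2 (Finset.mem_sdiff.1 hv).2
        omega
      have h3 : #(W \ H) * (2 * K + 1) ≤ 2 * K * (2 * K + 1) :=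
        Nat.mul_le_mul_right _ ((Finset.card_le_card Finset.sdiff_subset).trans hW)
      have h4 : (#H + 1) * d ≤ K * d := Nat.mul_le_mul_right _ h
      rw [add_one_mul] at h4
      omega
    have hK : #H = K := le_antisymm hle hge
    have htouch : ∀ e ∈ F.edgeSet, ∃ v ∈ H, v ∈ e := by
      intro e he
      by_contra! h
      induction e with
      | _ x y =>
        -- A matching of `H` that avoids `x` and `y` can be extended by the edge between them, to
        -- size `K + 1`.
        obtain ⟨M, h1, h2, h3⟩ := F.exists_isEdgeMatching (H := H) (Z := insert x (insert y H))
          (fun v hv => (hHm v).1 hv) (by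
            have := Finset.card_insert_le x (insert y H)
            have := Finset.card_insert_le y H
            omega) ((Finset.subset_insert _ _).trans (Finset.subset_insert _ _))
        have hxH : x ∉ H := fun hx => h x hx (by simp)
        have hyH : y ∉ H := fun hy => h y hy (by simp)
        have hdisj : ∀ e ∈ M, ∀ v, v ∈ s(x, y) → v ∉ e := by
          intro e he v hv hve
          obtain ⟨a, ha, u, hu, rfl⟩ := h3 e he
          simp only [Finset.mem_insert, not_or] at hu
          simp only [Sym2.mem_iff] at hv hve
          rcases hv with h | h <;> rcases hve with h' | h'
          · exact hxH (h.symm.trans h' ▸ ha)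
          · exact hu.1 (h'.symm.trans h)
          · exact hyH (h.symm.trans h' ▸ ha)
          · exact hu.2.1 (h'.symm.trans h)
        have hnm : s(x, y) ∉ M := fun hm => hdisj _ hm x (by simp) (by simp)
        have h4 : IsEdgeMatching F (insert s(x, y) M) := by
          refine ⟨?_, ?_⟩
          · rw [Finset.coe_insert]
            exact Set.insert_subset he h1.1
          · intro e₁ h₁ e₂ h₂ h₃ v ⟨hv, hv'⟩
            simp only [Finset.mem_insert] at h₁ h₂
            rcases h₁ with rfl | h₁ <;> rcases h₂ with rfl | h₂
            · exact h₃ rfl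
            · exact hdisj _ h₂ v hv hv'
            · exact hdisj _ h₁ v hv' hv
            · exact h1.2 _ h₁ _ h₂ h₃ v ⟨hv, hv'⟩
        have := hM _ h4
        rw [Finset.card_insert_of_notMem hnm] at this
        omega
    refine ⟨H, hHC, hK, fun u hu v hv huv => ?_⟩
    -- an edge inside `H` would be counted twice
    have h1 : #F.edgeFinset ≤ #((G.incidenceFinset u \ {s(u, v)}) ∪
        (H.erase u).biUnion fun v => G.incidenceFinset v) := by
      refine Finset.card_le_card fun e he => ?_
      have heF : e ∈ F.edgeSet := by simpa using he
      have heG : e ∈ G.edgeSet := edgeSet_mono hFG heF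
      obtain ⟨x, hx, hxe⟩ := htouch e heF
      simp only [Finset.mem_union, Finset.mem_sdiff, mem_incidenceFinset, Finset.mem_singleton,
        Finset.mem_biUnion, Finset.mem_erase]
      by_cases hxu : x = u
      · by_cases hev : e = s(u, v)
        · exact .inr ⟨v, ⟨huv.ne', hv⟩, heG, by simp [hev]⟩
        · exact .inl ⟨⟨heG, hxu ▸ hxe⟩, hev⟩
      · exact .inr ⟨x, ⟨hxu, hx⟩, heG, hxe⟩
    have h2 : #(G.incidenceFinset u \ {s(u, v)}) + 1 = d := by
      have h3 : s(u, v) ∈ G.incidenceFinset u := by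
        simpa [mem_incidenceFinset, incidenceSet] using huv
      rw [Finset.card_sdiff_of_subset (by simpa using h3), Finset.card_singleton,
        card_incidenceFinset_eq_degree, hC u (hHC hu)]
      omega
    have h3 : #((H.erase u).biUnion fun v => G.incidenceFinset v) ≤ (K - 1) * d := by
      refine Finset.card_biUnion_le.trans ?_
      rw [← hK, ← Finset.card_erase_of_mem hu]
      refine (Finset.sum_le_card_nsmul _ _ d fun v hv => ?_)
      rw [card_incidenceFinset_eq_degree, hC v (hHC (Finset.mem_of_mem_erase hv))]
    have h4 := Finset.card_union_le (G.incidenceFinset u \ {s(u, v)})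
      ((H.erase u).biUnion fun v => G.incidenceFinset v)
    have h5 : 1 ≤ K := by
      rw [← hK]; exact Finset.card_pos.2 ⟨u, hu⟩
    obtain ⟨k, rfl⟩ : ∃ k, K = k + 1 := ⟨K - 1, by omega⟩
    rw [add_one_mul] at hFc
    simp only [Nat.add_sub_cancel] at h3
    omega
  · rintro ⟨U, hUC, hU, hind⟩
    -- Independence makes the stars edge-disjoint, so the kept edges number exactly `K d` and the
    -- budget is met with equality.
    have hdis : #(U.biUnion fun v => G.incidenceFinset v) = K * d := by
      rw [Finset.card_biUnion]
      · rw [Finset.sum_congr rfl fun v hv => by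
          rw [card_incidenceFinset_eq_degree, hC v (hUC hv)], Finset.sum_const, hU, smul_eq_mul]
      · intro u hu v hv huv
        rw [Function.onFun, Finset.disjoint_left]
        intro e he he'
        rw [mem_incidenceFinset] at he he'
        have h1 : e = s(u, v) := ((Sym2.mem_and_mem_iff huv).1 ⟨he.2, he'.2⟩)
        have h2 := he.1
        rw [h1] at h2
        exact hind u hu v hv h2
    have hsub : (U.biUnion fun v => G.incidenceFinset v) ⊆ G.edgeFinset := by
      intro e he
      simp only [Finset.mem_biUnion, mem_incidenceFinset] at he
      obtain ⟨v, -, hv⟩ := he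
      simpa using hv.1
    refine ⟨G.edgeFinset \ U.biUnion fun v => G.incidenceFinset v, ?_, ?_, ?_⟩
    · intro e he
      simp only [Finset.coe_sdiff, Set.mem_sdiff, coe_edgeFinset] at he
      exact he.1
    · rw [Finset.card_sdiff_of_subset hsub, hdis]
    · intro M hM
      have htouch : ∀ e ∈ M, ∃ v ∈ U, v ∈ e := by
        intro e he
        have h1 := hM.1 he
        rw [edgeSet_deleteEdges] at h1
        have h2 := h1.2
        simp only [Finset.mem_coe, Finset.mem_sdiff, mem_edgeFinset, h1.1, true_and,
          not_not, Finset.mem_biUnion, mem_incidenceFinset] at h2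
        obtain ⟨v, hv, hv'⟩ := h2
        exact ⟨v, hv, hv'.2⟩
      rcases M.eq_empty_or_nonempty with rfl | ⟨e₀, he₀⟩
      · simp
      obtain ⟨v₀, -⟩ := htouch e₀ he₀
      have : Nonempty V := ⟨v₀⟩
      choose! f hf hf' using htouch
      -- Each matching edge has an end in `U`, and these ends are distinct.
      rw [← hU]
      refine Finset.card_le_card_of_injOn f hf fun e he e' he' hee => ?_
      by_contra hne
      exact hM.2 e he e' he' hne (f e) ⟨hf' e he, hee ▸ hf' e' he'⟩

end SimpleGraph

end

/-! ### Unique decoding of number lists, and the graph of a conflict relation -/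

section

/-- The first separator marks the end of the first block. This is the source of all unique decoding
below. -/
theorem map_some_append_none_inj {α : Type} : ∀ {l l' : List α} {r r' : List (Option α)},
    l.map some ++ none :: r = l'.map some ++ none :: r' → l = l' ∧ r = r'
  | [], [], _, _, h => by simpa using h
  | [], _ :: _, _, _, h => by simp at h
  | _ :: _, [], _, _, h => by simp at h
  | a :: l, b :: l', _, _, h => by
    simp only [List.map_cons, List.cons_append, List.cons.injEq, Option.some.injEq] at h
    obtain ⟨rfl, h⟩ := h
    obtain ⟨rfl, h'⟩ := map_some_append_none_inj h
    exact ⟨rfl, h'⟩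

theorem encodeNats_cons (n : ℕ) (l : List ℕ) : encodeNats (n :: l) =
    (Computability.encodeNat n).map some ++ none :: encodeNats l := by
  simp [encodeNats]

theorem encodeNats_injective : Function.Injective encodeNats
  | [], [], _ => rfl
  | [], n :: l, h => by rw [encodeNats_cons] at h; simp [encodeNats] at h
  | n :: l, [], h => by rw [encodeNats_cons] at h; simp [encodeNats] at h
  | n :: l, n' :: l', h => by
    rw [encodeNats_cons, encodeNats_cons] at h
    obtain ⟨h1, h2⟩ := map_some_append_none_inj h
    rw [encodeNats_injective h2]
    congr 1
    rw [← Computability.decode_encodeNat n, h1, Computability.decode_encodeNat]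

theorem length_flatMap_range {α : Type} (f : ℕ → List α) (n : ℕ) :
    ((List.range n).flatMap f).length = ∑ i ∈ Finset.range n, (f i).length := by
  induction n with
  | zero => rfl
  | succ n ih => simp [List.range_succ, Finset.sum_range_succ, ih]

/-! ### The graph of a conflict relation -/

namespace ConflictGraph

section

variable (conf : ℕ → ℕ → Prop) [DecidableRel conf] (N d : ℕ)

/-- The `v`-th neighbor of the vertex `u < N`: each `v < N` in conflict with `u` is its own
place, and all other places are taken by pendant vertices. -/
def nbr (u v : ℕ) : ℕ := if v < N ∧ u ≠ v ∧ conf u v then v else N + u * d + v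

/-- The edges, each listed at its smaller end. -/
def edges : List (ℕ × ℕ) :=
  (List.range N).flatMap fun u => (List.range d).flatMap fun v =>
    if v < u ∧ conf u v then [] else [(u, nbr conf N d u v)]

/-- The description of the graph as an instance with unit weights and costs. -/
def word (K : ℕ) : List (Option Bool) :=
  List.replicate (N + N * d) (some true) ++ none :: encodeNats
    (((edges conf N d).length - K * d) :: (edges conf N d).flatMap fun p => [p.1, p.2, 1, 1])

end

variable {conf : ℕ → ℕ → Prop} [DecidableRel conf] {N d : ℕ}

theorem mem_edges {a b : ℕ} : (a, b) ∈ edges conf N d ↔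
    a < N ∧ ∃ v < d, ¬ (v < a ∧ conf a v) ∧ b = nbr conf N d a v := by
  simp only [edges, List.mem_flatMap, List.mem_range]
  constructor
  · rintro ⟨u, hu, v, hv, h⟩
    split_ifs at h with hc
    · simp at h
    · simp only [List.mem_singleton, Prod.mk.injEq] at h
      obtain ⟨rfl, rfl⟩ := h
      exact ⟨hu, v, hv, hc, rfl⟩
  · rintro ⟨hu, v, hv, hc, rfl⟩
    exact ⟨a, hu, v, hv, by rw [if_neg hc]; simp⟩

/-- A conflict is skipped at its larger end, and the numbers of pendant vertices start at `N`. The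
order rules out loops and double listing. -/
theorem lt_of_mem_edges {a b : ℕ} (h : (a, b) ∈ edges conf N d) : a < b := by
  obtain ⟨h1, v, h2, h3, rfl⟩ := mem_edges.1 h
  unfold nbr
  split_ifs with hc
  · have : ¬ v < a := fun h => h3 ⟨h, hc.2.2⟩
    omega
  · omega

theorem snd_lt_of_mem_edges {a b : ℕ} (h : (a, b) ∈ edges conf N d) :
    b < N + N * d := by
  obtain ⟨h1, v, h2, h3, rfl⟩ := mem_edges.1 h
  have h4 : (a + 1) * d ≤ N * d := Nat.mul_le_mul_right d h1
  rw [add_one_mul] at h4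
  unfold nbr
  split_ifs with hc <;> omega

theorem nbr_inj {u v v' : ℕ} (h : nbr conf N d u v = nbr conf N d u v') : v = v' := by
  unfold nbr at h
  split_ifs at h <;> omega

theorem nodup_edges : (edges conf N d).Nodup := by
  unfold edges
  rw [List.nodup_flatMap]
  refine ⟨fun u _ => ?_, ?_⟩
  · rw [List.nodup_flatMap]
    refine ⟨fun v _ => by split_ifs <;> simp, ?_⟩
    refine List.nodup_range.imp fun {v v'} hv => ?_
    rw [Function.onFun, List.disjoint_left]
    intro p hp hp'
    split_ifs at hp hp' <;> simp at hp hp'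
    exact hv (nbr_inj (congrArg Prod.snd (hp.symm.trans hp')))
  · refine List.nodup_range.imp fun {u u'} hu => ?_
    rw [Function.onFun, List.disjoint_left]
    intro p hp hp'
    simp only [List.mem_flatMap, List.mem_range] at hp hp'
    obtain ⟨v, -, hp⟩ := hp
    obtain ⟨v', -, hp'⟩ := hp'
    split_ifs at hp hp' <;> simp at hp hp'
    exact hu (congrArg Prod.fst (hp.symm.trans hp'))

theorem length_edges : (edges conf N d).length =
    ∑ u ∈ Finset.range N, ∑ v ∈ Finset.range d, if v < u ∧ conf u v then 0 else 1 := by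
  unfold edges
  rw [length_flatMap_range]
  refine Finset.sum_congr rfl fun u _ => ?_
  rw [length_flatMap_range]
  refine Finset.sum_congr rfl fun v _ => ?_
  split_ifs <;> rfl

/-- The places from `N` on always lead to pendant vertices, so they are never skipped. This lower
bound is what keeps the budget positive. -/
theorem le_length_edges : N * (d - N) ≤ (edges conf N d).length := by
  rw [length_edges]
  have h : ∀ u ∈ Finset.range N, d - N ≤
      ∑ v ∈ Finset.range d, if v < u ∧ conf u v then 0 else 1 := by
    intro u hu
    rw [Finset.mem_range] at hu
    calc d - N = ∑ v ∈ Finset.Ico N d, 1 := by simp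
      _ = ∑ v ∈ Finset.Ico N d, if v < u ∧ conf u v then 0 else 1 := by
        refine Finset.sum_congr rfl fun v hv => ?_
        rw [Finset.mem_Ico] at hv
        rw [if_neg (fun h => by omega)]
      _ ≤ _ := Finset.sum_le_sum_of_subset fun v hv => by
        rw [Finset.mem_Ico] at hv
        rw [Finset.mem_range]; omega
  simpa using Finset.card_nsmul_le_sum _ _ _ h

/-- By symmetry of the relation, an edge that is skipped at `u` is listed at its other end. Hence
the neighbors of a vertex below `N` fill its `d` places, one each; `N ≤ d` provides a place for
every possible conflict. -/
theorem adj_iff (hsymm : ∀ u v, conf u v → conf v u) (hN : N ≤ d) {u b : ℕ} (hu : u < N) :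
    (u, b) ∈ edges conf N d ∨ (b, u) ∈ edges conf N d ↔ ∃ v < d, b = nbr conf N d u v := by
  rw [mem_edges, mem_edges]
  constructor
  · rintro (⟨-, v, hv, -, rfl⟩ | ⟨hb, v, hv, h, he⟩)
    · exact ⟨v, hv, rfl⟩
    · unfold nbr at he
      split_ifs at he with hc
      · subst he
        refine ⟨b, by omega, ?_⟩
        rw [nbr, if_pos ⟨hb, hc.2.1.symm, hsymm _ _ hc.2.2⟩]
      · omega
  · rintro ⟨v, hv, rfl⟩
    by_cases hc : v < u ∧ conf u v
    · have h1 : nbr conf N d u v = v := by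
        rw [nbr, if_pos ⟨by omega, by omega, hc.2⟩]
      right
      rw [h1]
      refine ⟨by omega, u, by omega, fun h => by omega, ?_⟩
      rw [nbr, if_pos ⟨hu, by omega, hsymm _ _ hc.2⟩]
    · exact .inl ⟨hu, v, hv, hc, rfl⟩

open Finset in
/-- Few edges can be removed to leave a small matching number if and only if there are many
vertices without conflicts. -/
theorem exists_deleteEdges_iff (hsymm : ∀ u v, conf u v → conf v u) (hN : N ≤ d) {K n : ℕ}
    (hn : n = N + N * d) (hd : 2 * K * (2 * K + 1) < d) (hK : K * d ≤ (edges conf N d).length)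
    {G : SimpleGraph (Fin n)} {es : List (Fin n × Fin n)}
    (hes : (es.map fun p => s(p.1, p.2)).Nodup)
    (hG : ∀ e, e ∈ (es.map fun p => s(p.1, p.2)) ↔ e ∈ G.edgeSet)
    (hed : es.map (fun p => ((p.1 : ℕ), (p.2 : ℕ))) = edges conf N d) :
    (∃ I : Finset (Sym2 (Fin n)), ↑I ⊆ G.edgeSet ∧ #I ≤ (edges conf N d).length - K * d ∧
      ∀ M, IsEdgeMatching (G.deleteEdges I) M → #M ≤ K) ↔
    ∃ U ⊆ range N, #U = K ∧ ∀ u ∈ U, ∀ v ∈ U, u ≠ v → ¬ conf u v := by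
  classical
  have hadj : ∀ a b : Fin n, G.Adj a b ↔
      ((a : ℕ), (b : ℕ)) ∈ edges conf N d ∨ ((b : ℕ), (a : ℕ)) ∈ edges conf N d := by
    intro a b
    rw [← SimpleGraph.mem_edgeSet, ← hG, ← hed]
    simp only [List.mem_map, Prod.mk.injEq, Sym2.eq_iff, Fin.val_inj]
    constructor
    · rintro ⟨p, hp, h | h⟩
      · exact .inl ⟨p, hp, h⟩
      · exact .inr ⟨p, hp, h⟩
    · rintro (⟨p, hp, h⟩ | ⟨p, hp, h⟩)
      · exact ⟨p, hp, .inl h⟩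
      · exact ⟨p, hp, .inr h⟩
  have hcard : #G.edgeFinset = (edges conf N d).length := by
    have : G.edgeFinset = (es.map fun p => s(p.1, p.2)).toFinset := by
      ext e
      rw [SimpleGraph.mem_edgeFinset, List.mem_toFinset, hG]
    rw [this, List.toFinset_card_of_nodup hes, ← hed]
    simp
  set C : Finset (Fin n) := univ.filter fun v => (v : ℕ) < N with hC
  have hlt : ∀ {u v : ℕ}, u < N → v < d → nbr conf N d u v < n := by
    intro u v hu hv
    have h4 : (u + 1) * d ≤ N * d := Nat.mul_le_mul_right d hu
    rw [add_one_mul] at h4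
    unfold nbr
    split_ifs <;> omega
  have hdeg : ∀ v ∈ C, G.degree v = d := by
    intro u hu
    have hu' : (u : ℕ) < N := by simpa [hC] using hu
    rw [← SimpleGraph.card_neighborFinset_eq_degree, ← Finset.card_map Fin.valEmbedding]
    have : (G.neighborFinset u).map Fin.valEmbedding =
        (range d).image (nbr conf N d u) := by
      ext b
      simp only [mem_map, SimpleGraph.mem_neighborFinset, Fin.valEmbedding_apply, mem_image,
        mem_range]
      constructor
      · rintro ⟨b, hb, rfl⟩
        rw [hadj, adj_iff hsymm hN hu'] at hb
        obtain ⟨v, hv, h⟩ := hb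
        exact ⟨v, hv, h.symm⟩
      · rintro ⟨v, hv, rfl⟩
        refine ⟨⟨_, hlt hu' hv⟩, ?_, rfl⟩
        rw [hadj, adj_iff hsymm hN hu']
        exact ⟨v, hv, rfl⟩
    rw [this, Finset.card_image_of_injective _ fun v v' => nbr_inj, Finset.card_range]
  have hdeg' : ∀ v ∉ C, G.degree v ≤ 1 := by
    intro a ha
    have ha' : N ≤ (a : ℕ) := by simpa [hC] using ha
    rw [← SimpleGraph.card_neighborFinset_eq_degree, Finset.card_le_one]
    -- The number `N + u * d + v` with `v < d` determines `u`, so a pendant vertex has at most one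
    -- neighbor.
    have key : ∀ b ∈ G.neighborFinset a, (b : ℕ) = (a - N) / d := by
      intro b hb
      rw [SimpleGraph.mem_neighborFinset, hadj, mem_edges, mem_edges] at hb
      rcases hb with hb | ⟨hb, v, hv, -, he⟩
      · omega
      · unfold nbr at he
        split_ifs at he with hc
        · omega
        · rw [he, show N + b * d + v - N = v + d * b by rw [mul_comm d]; omega,
            Nat.add_mul_div_left _ _ (by omega), Nat.div_eq_of_lt hv, zero_add]
    intro b hb b' hb'
    exact Fin.ext ((key b hb).trans (key b' hb').symm)
  have hcore : ∀ u v : Fin n, (u : ℕ) < N → (v : ℕ) < N →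
      (G.Adj u v ↔ (u : ℕ) ≠ v ∧ conf u v) := by
    intro u v hu hv
    rw [hadj, adj_iff hsymm hN hu]
    constructor
    · rintro ⟨w, hw, h⟩
      unfold nbr at h
      split_ifs at h with hc
      · rw [h]; exact hc.2
      · omega
    · intro h
      exact ⟨v, by omega, by rw [nbr, if_pos ⟨hv, h⟩]⟩
  rw [← hcard, G.exists_deleteEdges_iff hdeg hdeg' hd (by omega)]
  constructor
  · rintro ⟨U, hU, hUK, hind⟩
    refine ⟨U.map Fin.valEmbedding, ?_, by simpa using hUK, ?_⟩
    · intro u hu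
      simp only [mem_map, Fin.valEmbedding_apply] at hu
      obtain ⟨u, hu, rfl⟩ := hu
      simpa [hC] using hU hu
    · intro u hu v hv huv hc
      simp only [mem_map, Fin.valEmbedding_apply] at hu hv
      obtain ⟨u, hu, rfl⟩ := hu
      obtain ⟨v, hv, rfl⟩ := hv
      exact hind u hu v hv ((hcore u v (by simpa [hC] using hU hu)
        (by simpa [hC] using hU hv)).2 ⟨huv, hc⟩)
  · rintro ⟨U, hU, hUK, hind⟩
    have hUn : ∀ u ∈ U, u < n := fun u hu => by
      have := mem_range.1 (hU hu); omega
    refine ⟨U.attachFin hUn, ?_, by simpa using hUK, ?_⟩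
    · intro u hu
      rw [mem_attachFin] at hu
      simpa [hC] using hU hu
    · intro u hu v hv huv
      rw [mem_attachFin] at hu hv
      obtain ⟨h1, h2⟩ := (hcore u v (mem_range.1 (hU hu)) (mem_range.1 (hU hv))).1 huv
      exact hind _ hu _ hv h1 h2

theorem flatMap_block_inj {l l' : List (ℕ × ℕ × ℕ × ℕ)}
    (h : (l.flatMap fun p => [p.1, p.2.1, p.2.2.1, p.2.2.2]) =
      l'.flatMap fun p => [p.1, p.2.1, p.2.2.1, p.2.2.2]) : l = l' := by
  induction l generalizing l' with
  | nil =>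
    cases l' with
    | nil => rfl
    | cons p l' => simp at h
  | cons p l ih =>
    cases l' with
    | nil => simp at h
    | cons p' l' =>
      obtain ⟨a, b, c, e⟩ := p
      obtain ⟨a', b', c', e'⟩ := p'
      simp only [List.flatMap_cons, List.cons_append, List.nil_append, List.cons.injEq] at h
      obtain ⟨rfl, rfl, rfl, rfl, h⟩ := h
      rw [ih h]

open Finset in
-- Membership in the problem means that some instance with this description is a yes-instance. The
-- description fixes all that matters, including unit weights and costs on the edges, so every such
-- instance can be analyzed.
theorem isYes_iff (hsymm : ∀ u v, conf u v → conf v u) (hN : N ≤ d) {K : ℕ}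
    (hd : 2 * K * (2 * K + 1) < d) (hK : K * d ≤ (edges conf N d).length)
    {P : MMEIInstance} (hP : P.Encodes (word conf N d K)) (hm : P.m = K) :
    P.IsUnit ∧ (P.IsYes ↔
      ∃ U ⊆ range N, #U = K ∧ ∀ u ∈ U, ∀ v ∈ U, u ≠ v → ¬ conf u v) := by
  obtain ⟨es, h1, h2, h3⟩ := hP
  -- The unary number of vertices is also a block that ends at a separator, so it is decoded like a
  -- number.
  rw [word, ← List.map_replicate, ← List.map_replicate] at h3
  obtain ⟨h4, h5⟩ := map_some_append_none_inj h3
  have hn : P.n = N + N * d := by simpa using (congrArg List.length h4).symm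
  have h6 := encodeNats_injective h5
  rw [List.cons.injEq] at h6
  obtain ⟨hb, h7⟩ := h6
  have h8 : (edges conf N d).map (fun p => (p.1, p.2, 1, 1)) =
      es.map fun p => ((p.1 : ℕ), (p.2 : ℕ), P.w s(p.1, p.2), P.c s(p.1, p.2)) := by
    apply flatMap_block_inj
    rw [List.flatMap_map, List.flatMap_map]
    exact h7
  have hed : es.map (fun p => ((p.1 : ℕ), (p.2 : ℕ))) = edges conf N d := by
    have := congrArg (List.map fun p : ℕ × ℕ × ℕ × ℕ => (p.1, p.2.1)) h8
    simp only [List.map_map, Function.comp_def] at this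
    simpa using this.symm
  have hunit : P.IsUnit := by
    intro e he
    rw [← h2] at he
    obtain ⟨p, hp, rfl⟩ := List.mem_map.1 he
    have h9 : ((p.1 : ℕ), (p.2 : ℕ), P.w s(p.1, p.2), P.c s(p.1, p.2)) ∈
        (edges conf N d).map (fun p => (p.1, p.2, 1, 1)) := by
      rw [h8]; exact List.mem_map.2 ⟨p, hp, rfl⟩
    obtain ⟨q, -, hq⟩ := List.mem_map.1 h9
    simp only [Prod.mk.injEq] at hq
    exact ⟨hq.2.2.1.symm, hq.2.2.2.symm⟩
  refine ⟨hunit, ?_⟩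
  rw [← exists_deleteEdges_iff hsymm hN hn hd hK h1 h2 hed]
  refine exists_congr fun I => and_congr_right fun hI => ?_
  rw [Finset.sum_congr rfl fun e he => (hunit e (hI he)).2, hb, hm,
    maxMatchingWeight_le_iff fun e he => (hunit e (SimpleGraph.edgeSet_mono
      (P.G.deleteEdges_le _) he)).1]
  simp

/-- The instance that the word describes. -/
theorem exists_encodes {K : ℕ} (hK₀ : 1 ≤ K)
    (hK : K * d < (edges conf N d).length) :
    ∃ P : MMEIInstance, P.Encodes (word conf N d K) ∧ P.m = K := by
  obtain ⟨es, hes⟩ : ∃ es : List (Fin (N + N * d) × Fin (N + N * d)),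
      es.map (fun p => ((p.1 : ℕ), (p.2 : ℕ))) = edges conf N d := by
    have hlt : ∀ p ∈ edges conf N d, p.1 < N + N * d ∧ p.2 < N + N * d := fun p hp =>
      ⟨(lt_of_mem_edges hp).trans (snd_lt_of_mem_edges hp), snd_lt_of_mem_edges hp⟩
    refine ⟨(edges conf N d).pmap (fun p hp => (⟨p.1, hp.1⟩, ⟨p.2, hp.2⟩)) hlt, ?_⟩
    rw [List.map_pmap]
    simp
  have hlt : ∀ p ∈ es, (p.1 : ℕ) < p.2 := by
    intro p hp
    apply lt_of_mem_edges (conf := conf) (N := N) (d := d)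
    rw [← hes]
    exact List.mem_map.2 ⟨p, hp, rfl⟩
  have hmem : ∀ e, e ∈ (es.map fun p => s(p.1, p.2)) ↔
      e ∈ (SimpleGraph.fromEdgeSet {e | e ∈ es.map fun p => s(p.1, p.2)}).edgeSet := by
    intro e
    rw [SimpleGraph.edgeSet_fromEdgeSet]
    refine ⟨fun he => ⟨he, ?_⟩, fun he => he.1⟩
    obtain ⟨p, hp, rfl⟩ := List.mem_map.1 he
    have := hlt p hp
    intro h
    have h' : p.1 = p.2 := by simpa using h
    rw [h'] at this
    exact lt_irrefl _ this
  -- The budget must be at least one, which is why the inequality `hK` is strict.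
  refine ⟨⟨N + N * d, .fromEdgeSet {e | e ∈ es.map fun p => s(p.1, p.2)}, fun _ => 1, fun _ => 1,
    (edges conf N d).length - K * d, K, fun _ _ => le_rfl, by omega, hK₀⟩,
    ⟨es, ?_, hmem, ?_⟩, rfl⟩
  · have h1 : es.Nodup := by
      have := nodup_edges (conf := conf) (N := N) (d := d)
      rw [← hes] at this
      exact this.of_map
    refine h1.map_on fun p hp q hq hpq => ?_
    have h2 := hlt p hp
    have h3 := hlt q hq
    -- Each edge is listed with its smaller end first, so two listed pairs cannot be reversals of
    -- each other.
    rcases Sym2.eq_iff.1 hpq with h | h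
    · exact Prod.ext h.1 h.2
    · rw [h.1, h.2] at h2
      omega
  · rw [word]
    congr 4
    conv_lhs => rw [← hes, List.flatMap_map]

open Finset in
theorem mem_iff (hsymm : ∀ u v, conf u v → conf v u) (hN : N ≤ d) {K : ℕ} (hK₀ : 1 ≤ K)
    (hd : 2 * K * (2 * K + 1) < d) (hK : K * d < (edges conf N d).length) :
    ((word conf N d K, K) ∈ UnitMMEI ↔
      ∃ U ⊆ range N, #U = K ∧ ∀ u ∈ U, ∀ v ∈ U, u ≠ v → ¬ conf u v) ∧
    ((word conf N d K, K) ∈ MMEI ↔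
      ∃ U ⊆ range N, #U = K ∧ ∀ u ∈ U, ∀ v ∈ U, u ≠ v → ¬ conf u v) := by
  obtain ⟨P, hP, hPm⟩ := exists_encodes (conf := conf) hK₀ hK
  obtain ⟨hPu, hPy⟩ := isYes_iff hsymm hN hd hK.le hP hPm
  constructor
  · constructor
    · rintro ⟨P', -, hP', hm', hy⟩
      exact (isYes_iff hsymm hN hd hK.le hP' hm').2.1 hy
    · intro h
      exact ⟨P, hPu, hP, hPm, hPy.2 h⟩
  · constructor
    · rintro ⟨P', hP', hm', hy⟩
      exact (isYes_iff hsymm hN hd hK.le hP' hm').2.1 hy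
    · intro h
      exact ⟨P, hP, hPm, hPy.2 h⟩

end ConflictGraph

end

section

/-! ### Selecting `k` positions by choosing gaps -/

/-- The positions of a formula in a word of length `len`: `can a` is the first position of the
variable at position `a`, `first c` tells whether `c` is such a position, and each clause starts
at a position `cl a` and has its last literal at `sec a`. -/
structure Layout where
  len : ℕ
  can : ℕ → ℕ
  first : ℕ → Prop
  cl : ℕ → Prop
  sec : ℕ → ℕ
  sg : ℕ → Prop

namespace Layout

variable (P : Layout)

/-- The literal at position `a` is false if the variables at the positions `p` and `q` are true
and those between them are false; positions are counted from one here. -/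
def Fls (p q a : ℕ) : Prop :=
  (P.sg a → p < P.can a + 1 ∧ P.can a + 1 < q) ∧ (¬ P.sg a → p = P.can a + 1)

/-- Two gaps together make a clause false. -/
def Bad (p q p' q' : ℕ) : Prop :=
  ∃ a < P.len, P.cl a ∧ (P.Fls p q a ∨ P.Fls p' q' a) ∧
    (P.Fls p q (P.sec a) ∨ P.Fls p' q' (P.sec a))

/-- From `p` to `q` there may be the `i`-th of `k + 1` gaps. -/
def Valid (k i p q : ℕ) : Prop :=
  (i = 0 ∧ p = 0 ∧ q = 0) ∨
    (i ≠ 0 ∧ p < q ∧ (q = P.len + 1 ∨ (q ≠ 0 ∧ P.first (q - 1))) ∧ (i = k + 1 → q = P.len + 1))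

/-- Validity of the single triples is included, since every triple of a solution takes part in some
pair. The fit of consecutive slots transfers a right end to the next left end; this is how the left
ends come to be positions of variables although validity does not demand it. -/
def Compatible (k i p q j p' q' : ℕ) : Prop :=
  P.Valid k i p q ∧ P.Valid k j p' q' ∧ i ≠ j ∧ (j = i + 1 → q = p') ∧ (i = j + 1 → q' = p) ∧
    ¬ P.Bad p q p' q'

/-- The conflicts between the numbers of triples. -/
def Conf (k u v : ℕ) : Prop :=
  ¬ P.Compatible k (u / ((P.len + 2) * (P.len + 2))) (u / (P.len + 2) % (P.len + 2))
    (u % (P.len + 2)) (v / ((P.len + 2) * (P.len + 2))) (v / (P.len + 2) % (P.len + 2))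
    (v % (P.len + 2))

variable {P}

theorem Bad.symm {p q p' q' : ℕ} (h : P.Bad p q p' q') : P.Bad p' q' p q := by
  obtain ⟨a, h1, h2, h3, h4⟩ := h
  exact ⟨a, h1, h2, h3.symm, h4.symm⟩

theorem Conf.symm {k u v : ℕ} (h : P.Conf k u v) : P.Conf k v u := by
  intro ⟨h1, h2, h3, h4, h5, h6⟩
  exact h ⟨h2, h1, h3.symm, h5, h4, fun hb => h6 hb.symm⟩

/-- The gap is the one before the first end that is at least `x`. -/
theorem exists_gap {k L x : ℕ} {e : ℕ → ℕ} (h0 : e 0 = 0) (hL : e (k + 1) = L + 1)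
    (h1 : 1 ≤ x) (h2 : x ≤ L) (hx : ∀ i, 1 ≤ i → i ≤ k → e i ≠ x) :
    ∃ i ≤ k, e i < x ∧ x < e (i + 1) := by
  have hex : ∃ j, x ≤ e j := ⟨k + 1, by omega⟩
  classical
  have h3 := Nat.find_spec hex
  have h4 : Nat.find hex ≤ k + 1 := Nat.find_min' hex (by omega)
  have h5 : Nat.find hex ≠ 0 := fun h => by rw [h] at h3; omega
  obtain ⟨i, hi⟩ : ∃ i, Nat.find hex = i + 1 := ⟨_, (Nat.succ_pred_eq_of_ne_zero h5).symm⟩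
  have h6 : ¬ x ≤ e i := Nat.find_min hex (by omega)
  rw [hi] at h3 h4
  refine ⟨i, by omega, by omega, ?_⟩
  rcases eq_or_lt_of_le h4 with h | h
  · rw [h]; omega
  · have := hx (i + 1) (by omega) (by omega)
    omega

theorem lt_of_step {k : ℕ} {e : ℕ → ℕ} (h : ∀ i ≤ k, e i < e (i + 1)) {i j : ℕ} (hij : i < j)
    (hj : j ≤ k + 1) : e i < e j := by
  induction j with
  | zero => omega
  | succ j ih =>
    rcases Nat.lt_or_ge i j with h1 | h1
    · exact (ih h1 (by omega)).trans (h j (by omega))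
    · obtain rfl : i = j := by omega
      exact h i (by omega)

/-- The truth values of literals in terms of gaps. -/
theorem exists_fls_iff {k : ℕ} {e : ℕ → ℕ} (h0 : e 0 = 0) (hL : e (k + 1) = P.len + 1)
    (he : ∀ i ≤ k, e i < e (i + 1)) {a : ℕ} (ha : P.can a < P.len) :
    (∃ i ≤ k, P.Fls (e i) (e (i + 1)) a) ↔
      ¬ ((∃ i, 1 ≤ i ∧ i ≤ k ∧ e i = P.can a + 1) ↔ P.sg a) := by
  by_cases hs : P.sg a
  · simp only [Fls, hs, iff_true, true_imp_iff, not_true_eq_false, false_imp_iff, and_true]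
    constructor
    · rintro ⟨i, hi, h1, h2⟩ ⟨j, hj1, hj2, hj⟩
      rcases Nat.lt_trichotomy j i with h | rfl | h
      · have := lt_of_step he h (by omega); omega
      · omega
      · rcases eq_or_lt_of_le (show i + 1 ≤ j from h) with h' | h'
        · subst h'; omega
        · have := lt_of_step he h' (by omega); omega
    · intro h
      exact exists_gap h0 hL (by omega) (by omega) fun i h1 h2 h3 => h ⟨i, h1, h2, h3⟩
  · simp only [Fls, hs, iff_false, not_not, false_imp_iff, true_and, not_false_eq_true,
      true_imp_iff]
    constructor
    · rintro ⟨i, hi, h⟩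
      refine ⟨i, ?_, hi, h⟩
      by_contra h'
      obtain rfl : i = 0 := by omega
      omega
    · rintro ⟨i, -, hi, h⟩
      exact ⟨i, hi, h⟩

/-- Selecting positions and choosing gaps amount to the same. -/
theorem exists_gaps_iff {k : ℕ} (hfirst : ∀ c, P.first c → c < P.len)
    (hcl : ∀ a, P.cl a → P.can a < P.len ∧ P.can (P.sec a) < P.len) :
    (∃ R : Finset ℕ, R.card = k ∧ (∀ c ∈ R, P.first c) ∧ ∀ a < P.len, P.cl a →
      ((P.can a ∈ R ↔ P.sg a) ∨ (P.can (P.sec a) ∈ R ↔ P.sg (P.sec a)))) ↔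
    ∃ e : ℕ → ℕ, e 0 = 0 ∧ e (k + 1) = P.len + 1 ∧ (∀ i ≤ k, e i < e (i + 1)) ∧
      (∀ i, 1 ≤ i → i ≤ k → P.first (e i - 1)) ∧ ∀ a < P.len, P.cl a →
        ¬ ((∃ i ≤ k, P.Fls (e i) (e (i + 1)) a) ∧ ∃ i ≤ k, P.Fls (e i) (e (i + 1)) (P.sec a)) := by
  constructor
  · rintro ⟨R, hR, hRf, hsat⟩
    -- The chosen positions, shifted by one, between the sentinels; `e` lists them in increasing
    -- order, and its value `0` beyond index `k + 1` is irrelevant.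
    set R' : Finset ℕ := insert 0 (insert (P.len + 1) (R.map (addRightEmbedding 1))) with hR'
    have hmem : ∀ x, x ∈ R' ↔ x = 0 ∨ x = P.len + 1 ∨ ∃ c ∈ R, c + 1 = x := by
      intro x; simp [hR']
    have hle : ∀ x ∈ R', x ≤ P.len + 1 := by
      intro x hx
      rcases (hmem x).1 hx with h | h | ⟨c, hc, h⟩
      · omega
      · omega
      · have := hfirst c (hRf c hc); omega
    have hcard : R'.card = k + 2 := by
      rw [hR', Finset.card_insert_of_notMem, Finset.card_insert_of_notMem, Finset.card_map, hR]
      · simp only [Finset.mem_map, addRightEmbedding_apply, not_exists, not_and]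
        intro c hc
        have := hfirst c (hRf c hc); omega
      · simp
    set e : ℕ → ℕ := fun n => if h : n < k + 2 then R'.orderEmbOfFin hcard ⟨n, h⟩ else 0 with he
    have hlt : ∀ i ≤ k, e i < e (i + 1) := by
      intro i hi
      simp only [he, dif_pos (show i < k + 2 by omega), dif_pos (show i + 1 < k + 2 by omega)]
      exact (R'.orderEmbOfFin hcard).strictMono (by simp [Fin.lt_def])
    have hin : ∀ i < k + 2, e i ∈ R' := by
      intro i hi
      simp only [he, dif_pos hi]
      exact Finset.orderEmbOfFin_mem _ _ _
    have hsurj : ∀ x ∈ R', ∃ i < k + 2, e i = x := by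
      intro x hx
      have : x ∈ Set.range (R'.orderEmbOfFin hcard) := by
        rw [Finset.range_orderEmbOfFin]; exact hx
      obtain ⟨i, hi⟩ := this
      exact ⟨i, i.2, by simp only [he, dif_pos i.2]; exact hi⟩
    have h0 : e 0 = 0 := by
      obtain ⟨i, hi, h⟩ := hsurj 0 ((hmem 0).2 (.inl rfl))
      rcases Nat.eq_zero_or_pos i with rfl | hi'
      · exact h
      · have := lt_of_step hlt hi' (by omega); omega
    have hL : e (k + 1) = P.len + 1 := by
      obtain ⟨i, hi, h⟩ := hsurj (P.len + 1) ((hmem _).2 (.inr (.inl rfl)))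
      rcases eq_or_lt_of_le (show i ≤ k + 1 by omega) with rfl | hi'
      · exact h
      · have := lt_of_step hlt hi' (by omega)
        have := hle _ (hin (k + 1) (by omega)); omega
    have hR1 : ∀ i, 1 ≤ i → i ≤ k → ∃ c ∈ R, c + 1 = e i := by
      intro i h1 h2
      have h3 := lt_of_step hlt (show 0 < i by omega) (by omega)
      have h4 := lt_of_step hlt (show i < k + 1 by omega) (by omega)
      rcases (hmem _).1 (hin i (by omega)) with h | h | h
      · omega
      · omega
      · exact h
    have hR2 : ∀ c, (∃ i, 1 ≤ i ∧ i ≤ k ∧ e i = c + 1) ↔ c ∈ R := by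
      intro c
      constructor
      · rintro ⟨i, h1, h2, h3⟩
        obtain ⟨c', hc', h⟩ := hR1 i h1 h2
        obtain rfl : c' = c := by omega
        exact hc'
      · intro hc
        obtain ⟨i, hi, h⟩ := hsurj (c + 1) ((hmem _).2 (.inr (.inr ⟨c, hc, rfl⟩)))
        have := hfirst c (hRf c hc)
        refine ⟨i, ?_, ?_, h⟩
        · by_contra h'
          obtain rfl : i = 0 := by omega
          omega
        · by_contra h'
          obtain rfl : i = k + 1 := by omega
          omega
    refine ⟨e, h0, hL, hlt, fun i h1 h2 => ?_, fun a ha hc => ?_⟩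
    · obtain ⟨c, hc, h⟩ := hR1 i h1 h2
      rw [← h]; exact hRf c hc
    · rw [exists_fls_iff h0 hL hlt (hcl a hc).1, exists_fls_iff h0 hL hlt (hcl a hc).2, hR2, hR2]
      have := hsat a ha hc
      tauto
  · rintro ⟨e, h0, hL, hlt, hf, hsat⟩
    have hpos : ∀ i, 1 ≤ i → i ≤ k → e i ≠ 0 := fun i h1 h2 => by
      have := lt_of_step hlt (show 0 < i by omega) (by omega); omega
    have hR2 : ∀ c, (∃ i, 1 ≤ i ∧ i ≤ k ∧ e i = c + 1) ↔
        c ∈ (Finset.Icc 1 k).image fun i => e i - 1 := by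
      intro c
      simp only [Finset.mem_image, Finset.mem_Icc]
      constructor
      · rintro ⟨i, h1, h2, h3⟩
        exact ⟨i, ⟨h1, h2⟩, by omega⟩
      · rintro ⟨i, ⟨h1, h2⟩, h3⟩
        have := hpos i h1 h2
        exact ⟨i, h1, h2, by omega⟩
    refine ⟨(Finset.Icc 1 k).image fun i => e i - 1, ?_, ?_, fun a ha hc => ?_⟩
    · rw [Finset.card_image_of_injOn]
      · simp
      · intro i hi j hj hij
        simp only [Finset.coe_Icc, Set.mem_Icc] at hi hj
        have h1 := hpos i hi.1 hi.2
        have h2 := hpos j hj.1 hj.2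
        simp only at hij
        rcases Nat.lt_trichotomy i j with h | h | h
        · have := lt_of_step hlt h (by omega); omega
        · exact h
        · have := lt_of_step hlt h (by omega); omega
    · intro c hc
      obtain ⟨i, h1, h2, h3⟩ := (hR2 c).2 hc
      have := hf i h1 h2
      rwa [h3] at this
    · have := hsat a ha hc
      rw [exists_fls_iff h0 hL hlt (hcl a hc).1, exists_fls_iff h0 hL hlt (hcl a hc).2, hR2,
        hR2] at this
      tauto

/-- Triples are numbered as in base `B`, without a bound on the leading digit, which is the slot. -/
theorem decode_triple {B i p q : ℕ} (hp : p < B) (hq : q < B) :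
    (i * (B * B) + p * B + q) / (B * B) = i ∧ (i * (B * B) + p * B + q) / B % B = p ∧
      (i * (B * B) + p * B + q) % B = q := by
  have hB : 0 < B := by omega
  have h1 : p * B + q < B * B := by
    have : (p + 1) * B ≤ B * B := Nat.mul_le_mul_right B hp
    rw [add_one_mul] at this; omega
  refine ⟨?_, ?_, ?_⟩
  · rw [show i * (B * B) + p * B + q = (p * B + q) + B * B * i by ring,
      Nat.add_mul_div_left _ _ (by positivity), Nat.div_eq_of_lt h1, zero_add]
  · rw [show i * (B * B) + p * B + q = q + B * (i * B + p) by ring,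
      Nat.add_mul_div_left _ _ hB, Nat.div_eq_of_lt hq, zero_add, mul_comm, Nat.mul_add_mod,
      Nat.mod_eq_of_lt hp]
  · rw [show i * (B * B) + p * B + q = B * (i * B + p) + q by ring, Nat.mul_add_mod,
      Nat.mod_eq_of_lt hq]

open Finset in
/-- Choosing gaps amounts to choosing vertices without conflicts. -/
theorem exists_conf_iff {k : ℕ} :
    (∃ e : ℕ → ℕ, e 0 = 0 ∧ e (k + 1) = P.len + 1 ∧ (∀ i ≤ k, e i < e (i + 1)) ∧
      (∀ i, 1 ≤ i → i ≤ k → P.first (e i - 1)) ∧ ∀ a < P.len, P.cl a →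
        ¬ ((∃ i ≤ k, P.Fls (e i) (e (i + 1)) a) ∧
          ∃ i ≤ k, P.Fls (e i) (e (i + 1)) (P.sec a))) ↔
    ∃ U ⊆ range ((k + 2) * ((P.len + 2) * (P.len + 2))), #U = k + 2 ∧
      ∀ u ∈ U, ∀ v ∈ U, u ≠ v → ¬ P.Conf k u v := by
  set B := P.len + 2 with hB
  have hB0 : 0 < B := by omega
  constructor
  · rintro ⟨e, h0, hL, hlt, hf, hsat⟩
    have hle : ∀ i ≤ k + 1, e i < B := by
      intro i hi
      rcases eq_or_lt_of_le hi with rfl | h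
      · omega
      · have := lt_of_step hlt h le_rfl; omega
    set g : ℕ → ℕ := fun i => i * (B * B) + e (i - 1) * B + e i with hg
    have hdec : ∀ i ≤ k + 1, g i / (B * B) = i ∧ g i / B % B = e (i - 1) ∧ g i % B = e i :=
      fun i hi => decode_triple (hle _ (by omega)) (hle _ hi)
    have hvalid : ∀ i ≤ k + 1, P.Valid k i (e (i - 1)) (e i) := by
      intro i hi
      rcases Nat.eq_zero_or_pos i with rfl | hi'
      · exact .inl ⟨rfl, h0, h0⟩
      · refine .inr ⟨by omega, lt_of_step hlt (by omega) hi, ?_, fun h => h ▸ hL⟩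
        rcases eq_or_lt_of_le hi with rfl | h
        · exact .inl hL
        · have := lt_of_step hlt hi' hi
          exact .inr ⟨by omega, hf i hi' (by omega)⟩
    -- The dummy gap from `0` to `0` makes no literal false: nothing lies inside it, and its left
    -- end is not the position of a variable.
    have hnf : ∀ i ≤ k + 1, ∀ a, P.Fls (e (i - 1)) (e i) a →
        ∃ i ≤ k, P.Fls (e i) (e (i + 1)) a := by
      intro i hi a hF
      rcases Nat.eq_zero_or_pos i with rfl | hi'
      · simp only [Fls, h0] at hF
        by_cases hs : P.sg a
        · have := hF.1 hs; omega
        · have := hF.2 hs; omega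
      · obtain ⟨j, rfl⟩ : ∃ j, i = j + 1 := ⟨i - 1, by omega⟩
        exact ⟨j, by omega, hF⟩
    refine ⟨(range (k + 2)).image g, ?_, ?_, ?_⟩
    · intro u hu
      obtain ⟨i, hi, rfl⟩ := mem_image.1 hu
      rw [mem_range] at hi ⊢
      obtain ⟨h1, -, -⟩ := hdec i (by omega)
      rw [Nat.div_eq_iff (by positivity)] at h1
      have : (i + 1) * (B * B) ≤ (k + 2) * (B * B) := Nat.mul_le_mul_right _ (by omega)
      rw [add_one_mul] at this
      have := Nat.mul_pos hB0 hB0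
      omega
    · rw [card_image_of_injOn, card_range]
      intro i hi j hj hij
      simp only [coe_range, Set.mem_Iio] at hi hj
      rw [← (hdec i (by omega)).1, ← (hdec j (by omega)).1]
      rw [hij]
    · intro u hu v hv huv
      obtain ⟨i, hi, rfl⟩ := mem_image.1 hu
      obtain ⟨j, hj, rfl⟩ := mem_image.1 hv
      rw [mem_range] at hi hj
      have hij : i ≠ j := fun h => huv (h ▸ rfl)
      unfold Conf
      rw [not_not, ← hB]
      obtain ⟨h1, h2, h3⟩ := hdec i (by omega)
      obtain ⟨h4, h5, h6⟩ := hdec j (by omega)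
      rw [h1, h2, h3, h4, h5, h6]
      refine ⟨hvalid i (by omega), hvalid j (by omega), hij, fun h => ?_, fun h => ?_, ?_⟩
      · rw [h]; rfl
      · rw [h]; rfl
      · rintro ⟨a, ha, hc, hF1, hF2⟩
        refine hsat a ha hc ⟨?_, ?_⟩
        · exact hF1.elim (hnf i (by omega) a) (hnf j (by omega) a)
        · exact hF2.elim (hnf i (by omega) _) (hnf j (by omega) _)
  · rintro ⟨U, hU, hUk, hind⟩
    -- There are `k + 2 ≥ 2` vertices, so every condition on one vertex is tested in some pair.
    have hother : ∀ u ∈ U, ∃ v ∈ U, u ≠ v := by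
      intro u hu
      obtain ⟨v, hv, h⟩ := exists_mem_ne (show 1 < #U by omega) u
      exact ⟨v, hv, h.symm⟩
    have hcomp : ∀ u ∈ U, ∀ v ∈ U, u ≠ v → P.Compatible k (u / (B * B)) (u / B % B) (u % B)
        (v / (B * B)) (v / B % B) (v % B) := fun u hu v hv huv => by
      have := hind u hu v hv huv
      unfold Conf at this
      rwa [not_not] at this
    have hslot : ∀ i < k + 2, ∃ u ∈ U, u / (B * B) = i := by
      -- Vertices without conflict have different slots, and there are as many of them as slots.
      have h1 : U.image (fun u => u / (B * B)) = range (k + 2) := by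
        apply eq_of_subset_of_card_le
        · intro i hi
          obtain ⟨u, hu, rfl⟩ := mem_image.1 hi
          rw [mem_range]
          exact (Nat.div_lt_iff_lt_mul (by positivity)).2 (mem_range.1 (hU hu))
        · rw [card_image_of_injOn, card_range, hUk]
          intro u hu v hv huv
          by_contra hne
          exact (hcomp u hu v hv hne).2.2.1 huv
      intro i hi
      have : i ∈ U.image fun u => u / (B * B) := by rw [h1]; exact mem_range.2 hi
      simpa using this
    choose! g hgU hgi using hslot
    have hgne : ∀ i < k + 2, ∀ j < k + 2, i ≠ j → g i ≠ g j := fun i hi j hj hij h => by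
      apply hij; rw [← hgi i hi, ← hgi j hj, h]
    have hval : ∀ i < k + 2, P.Valid k i (g i / B % B) (g i % B) := by
      intro i hi
      obtain ⟨v, hv, h⟩ := hother _ (hgU i hi)
      have := (hcomp _ (hgU i hi) v hv h).1
      rwa [hgi i hi] at this
    have hnext : ∀ i ≤ k, g i % B = g (i + 1) / B % B := by
      intro i hi
      have := (hcomp _ (hgU i (by omega)) _ (hgU (i + 1) (by omega))
        (hgne _ (by omega) _ (by omega) (by omega))).2.2.2.1
      exact this (by rw [hgi _ (by omega), hgi _ (by omega)])
    have hlt : ∀ i ≤ k, g i % B < g (i + 1) % B := by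
      intro i hi
      rw [hnext i hi]
      rcases hval (i + 1) (by omega) with h | h
      · omega
      · exact h.2.1
    have hL : g (k + 1) % B = P.len + 1 := by
      rcases hval (k + 1) (by omega) with h | h
      · omega
      · exact h.2.2.2 rfl
    have h0 : g 0 % B = 0 := by
      rcases hval 0 (by omega) with h | h
      · exact h.2.2
      · exact absurd rfl h.1
    refine ⟨fun i => g i % B, h0, hL, hlt, fun i h1 h2 => ?_, fun a ha hc => ?_⟩
    -- An intermediate end lies before the last one, so it is not the sentinel `L + 1`.
    · have h3 := lt_of_step (e := fun i => g i % B) hlt (show i < k + 1 by omega) le_rfl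
      rcases hval i (by omega) with h | ⟨-, -, h | h, -⟩
      · omega
      · omega
      · exact h.2
    · rintro ⟨⟨i, hi, hF1⟩, j, hj, hF2⟩
      simp only [hnext i hi] at hF1
      simp only [hnext j hj] at hF2
      by_cases hij : i = j
      · subst hij
        -- Both literals are made false by the same gap; its conflict with any other vertex excludes
        -- this.
        obtain ⟨v, hv, h⟩ := hother _ (hgU (i + 1) (by omega))
        exact (hcomp _ (hgU (i + 1) (by omega)) v hv h).2.2.2.2.2
          ⟨a, ha, hc, .inl hF1, .inl hF2⟩
      · exact (hcomp _ (hgU (i + 1) (by omega)) _ (hgU (j + 1) (by omega))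
          (hgne _ (by omega) _ (by omega) (by omega))).2.2.2.2.2
          ⟨a, ha, hc, .inl hF1, .inr hF2⟩

end Layout

end

section

/-! ### Reading formulas -/

namespace Computability

theorem getLast?_encodeNat (n : ℕ) : (encodeNat n).getLast? ≠ some false := by
  induction n using Nat.strong_induction_on with
  | _ n ih =>
    rw [encodeNat_eq]
    split_ifs with h
    · simp
    · rcases Nat.eq_zero_or_pos (n / 2) with h2 | h2
      · have h1 : n % 2 = 1 := by omega
        rw [h2, encodeNat_eq]
        simp [h1]
      · have h1 := ih (n / 2) (by omega)
        have h3 : encodeNat (n / 2) ≠ [] := by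
          rw [encodeNat_eq, if_neg (by omega)]; simp
        rw [List.getLast?_cons, List.getLast?_eq_some_getLast h3] at *
        exact h1

/-- The last bit is the most significant one, so the only obstruction is a leading zero. This allows
a finite automaton to recognize numbers. -/
theorem exists_encodeNat {l : List Bool} (h : l.getLast? ≠ some false) :
    ∃ n, l = encodeNat n := by
  induction l with
  | nil => exact ⟨0, rfl⟩
  | cons b l ih =>
    rcases l.eq_nil_or_concat with rfl | ⟨l', b', rfl⟩
    · cases b
      · exact absurd rfl h
      · exact ⟨1, rfl⟩
    · obtain ⟨n, hn⟩ := ih (by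
        rw [List.getLast?_cons] at h
        simpa using h)
      have hn0 : n ≠ 0 := by
        rintro rfl
        rw [encodeNat_eq] at hn
        simp at hn
      refine ⟨2 * n + b.toNat, ?_⟩
      rw [encodeNat_eq, if_neg (by omega), hn]
      congr 1
      · cases b
        · simp
        · simp [Nat.add_mod]
      · congr 1
        cases b
        · simp
        · simp; omega

theorem encodeNat_injective : Function.Injective encodeNat := fun n m h => by
  rw [← decode_encodeNat n, h, decode_encodeNat]

theorem encodeNat_one : encodeNat 1 = [true] := by
  rw [encodeNat_eq, encodeNat_eq]; simp

theorem encodeNat_two : encodeNat 2 = [false, true] := by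
  rw [encodeNat_eq]; simp [encodeNat_one]

end Computability

open Computability

theorem encodeNats_zero : encodeNats [0] = [none] := by
  rw [encodeNats_cons, encodeNat_eq]; rfl

theorem encodeNats_one : encodeNats [1] = [some true, none] := by
  rw [encodeNats_cons, encodeNat_one]; rfl

theorem encodeNats_two : encodeNats [2] = [some false, some true, none] := by
  rw [encodeNats_cons, encodeNat_two]; rfl

theorem encodeNats_append (l l' : List ℕ) :
    encodeNats (l ++ l') = encodeNats l ++ encodeNats l' := by
  simp [encodeNats]

/-- Each number ends with a separator, so the cut falls between two numbers. What the automaton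
knows about a prefix thus becomes a statement about the list. -/
theorem exists_of_encodeNats_eq_append {l l' : List ℕ} {y : List (Option Bool)}
    (h : encodeNats l = encodeNats l' ++ y) : ∃ r, l = l' ++ r ∧ y = encodeNats r := by
  induction l' generalizing l with
  | nil => exact ⟨l, rfl, h.symm⟩
  | cons n l' ih =>
    cases l with
    | nil => rw [encodeNats_cons] at h; simp [encodeNats] at h
    | cons m l =>
      rw [encodeNats_cons, encodeNats_cons, List.append_assoc, List.cons_append] at h
      obtain ⟨h1, h2⟩ := map_some_append_none_inj h
      obtain ⟨r, rfl, h4⟩ := ih h2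
      rw [encodeNat_injective h1]
      exact ⟨r, rfl, h4⟩

namespace CNF

/-- The numbers that describe a literal. -/
def litNats (l : Literal) : List ℕ := [l.1, if l.2 then 1 else 0]

/-- The numbers that describe a formula. -/
def nats (φ : Formula) : List ℕ := φ.flatMap fun C => C.length :: C.flatMap litNats

theorem nats_cons (C : List Literal) (φ : Formula) :
    nats (C :: φ) = C.length :: (C.flatMap litNats ++ nats φ) := by simp [nats]

theorem nats_append (φ φ' : Formula) : nats (φ ++ φ') = nats φ ++ nats φ' := by simp [nats]

theorem length_flatMap_litNats (C : List Literal) :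
    (C.flatMap litNats).length = 2 * C.length := by
  induction C with
  | nil => rfl
  | cons l C ih => simp [litNats] at *; omega

theorem flatMap_litNats_inj : ∀ {C C' : List Literal},
    C.flatMap litNats = C'.flatMap litNats → C = C'
  | [], [], _ => rfl
  | [], _ :: _, h => by simp [litNats] at h
  | _ :: _, [], h => by simp [litNats] at h
  | (n, s) :: C, (n', s') :: C', h => by
    simp only [List.flatMap_cons, litNats, List.cons_append, List.nil_append,
      List.cons.injEq] at h
    obtain ⟨rfl, h1, h2⟩ := h
    rw [flatMap_litNats_inj h2]
    cases s <;> cases s' <;> simp_all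

/-- The length of a clause announces how many numbers belong to it, so whole clauses can be split
off without ambiguity. -/
theorem exists_of_nats_eq {φ φ' : Formula} {n : ℕ} {r : List ℕ} (h : nats φ = nats φ' ++ n :: r) :
    ∃ C φ'', φ = φ' ++ C :: φ'' ∧ C.length = n ∧ r = C.flatMap litNats ++ nats φ'' := by
  induction φ' generalizing φ with
  | nil =>
    cases φ with
    | nil => simp [nats] at h
    | cons C φ =>
      rw [nats_cons] at h
      simp only [nats, List.flatMap_nil, List.nil_append, List.cons.injEq] at h
      exact ⟨C, φ, rfl, h.1, h.2.symm⟩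
  | cons C' φ' ih =>
    cases φ with
    | nil => simp [nats] at h
    | cons C φ =>
      rw [nats_cons, nats_cons, List.cons_append, List.cons.injEq, List.append_assoc] at h
      obtain ⟨h1, h2⟩ := List.append_inj h.2
        (by rw [length_flatMap_litNats, length_flatMap_litNats, h.1])
      obtain rfl := flatMap_litNats_inj h1
      obtain ⟨C, φ'', rfl, h4, h5⟩ := ih h2
      exact ⟨C, φ'', rfl, h4, h5⟩

/-! ### An automaton that checks formulas -/

/-- The places of literals: the first and the second of two, and the only one. -/
inductive Slot : Type
  | fst | snd | single
  deriving DecidableEq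

/-- The states of the automaton: reading the length of a clause, the variable of a literal (with
the last symbol read), or the sign of a literal. -/
inductive Aut : Type
  | len | len1 | len0 | len01
  | var (t : Slot) (s : Option Bool)
  | sgn (t : Slot) | sgn1 (t : Slot)
  | dead
  deriving DecidableEq

instance : Inhabited Aut := ⟨.dead⟩

instance : Finite Slot := by
  refine Finite.of_surjective (fun i : Fin 3 =>
    if i = 0 then Slot.fst else if i = 1 then .snd else .single) fun t => ?_
  cases t
  exacts [⟨0, rfl⟩, ⟨1, rfl⟩, ⟨2, rfl⟩]

instance : Finite Aut := by
  refine Finite.of_surjective (fun i : Fin 5 ⊕ (Slot × Option Bool ⊕ Slot ⊕ Slot) =>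
    i.elim (fun i => if i = 0 then Aut.len else if i = 1 then .len1 else if i = 2 then .len0 else
      if i = 3 then .len01 else .dead)
      (Sum.elim (fun p => .var p.1 p.2) (Sum.elim .sgn .sgn1))) fun q => ?_
  cases q with
  | len => exact ⟨.inl 0, rfl⟩
  | len1 => exact ⟨.inl 1, rfl⟩
  | len0 => exact ⟨.inl 2, rfl⟩
  | len01 => exact ⟨.inl 3, rfl⟩
  | dead => exact ⟨.inl 4, rfl⟩
  | var t s => exact ⟨.inr (.inl (t, s)), rfl⟩
  | sgn t => exact ⟨.inr (.inr (.inl t)), rfl⟩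
  | sgn1 t => exact ⟨.inr (.inr (.inr t)), rfl⟩

/-- The state after a literal. -/
def Slot.next : Slot → Aut
  | .fst => .var .snd none
  | _ => .len

/-- A number that ends with the bit `false` is rejected, as it would not be the encoding of any
number. A sign must be the empty word or a single bit `true`, the encodings of `0` and `1`. -/
def step : Aut → Option Bool → Aut
  | .len, some true => .len1
  | .len, some false => .len0
  | .len1, none => .var .single none
  | .len0, some true => .len01
  | .len01, none => .var .fst none
  | .var t _, some b => .var t (some b)
  | .var t s, none => if s = some false then .dead else .sgn t
  | .sgn t, some true => .sgn1 t
  | .sgn t, none => t.next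
  | .sgn1 t, none => t.next
  | _, _ => .dead

/-- The clauses have one or two literals. -/
def Good (φ : Formula) : Prop := ∀ C ∈ φ, C.length = 1 ∨ C.length = 2

theorem foldl_step_bits (t : Slot) (l : List Bool) :
    (l.map some).foldl step (.var t none) = .var t l.getLast? := by
  induction l using List.reverseRecOn with
  | nil => rfl
  | append_singleton l b ih => simp [ih, step]

theorem foldl_step_lit (t : Slot) (l : Literal) :
    (encodeNats (litNats l)).foldl step (.var t none) = t.next := by
  rw [litNats, encodeNats_cons, List.foldl_append, foldl_step_bits, List.foldl_cons]
  have h : step (.var t (encodeNat l.1).getLast?) none = .sgn t := by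
    rw [step, if_neg (getLast?_encodeNat _)]
  rw [h]
  rcases l with ⟨n, _ | _⟩
  · rw [if_neg (by simp), encodeNats_zero]; rfl
  · rw [if_pos rfl, encodeNats_one]; rfl

theorem foldl_step_encode {φ : Formula} (h : Good φ) :
    (encodeNats (nats φ)).foldl step .len = .len := by
  induction φ with
  | nil => rfl
  | cons C φ ih =>
    rw [nats_cons, encodeNats_cons, List.foldl_append, List.foldl_cons, encodeNats_append,
      List.foldl_append]
    have h1 : (encodeNats (C.flatMap litNats)).foldl step
        (step (((encodeNat C.length).map some).foldl step .len) none) = .len := by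
      rcases h C (by simp) with hC | hC
      · obtain ⟨l, rfl⟩ := List.length_eq_one_iff.1 hC
        rw [List.length_singleton, encodeNat_one, List.flatMap_cons, List.flatMap_nil,
          List.append_nil]
        exact foldl_step_lit .single l
      · obtain ⟨l, l', rfl⟩ := List.length_eq_two.1 hC
        rw [List.flatMap_cons, List.flatMap_cons, List.flatMap_nil, List.append_nil,
          encodeNats_append, List.foldl_append]
        rw [show [l, l'].length = 2 from rfl, encodeNat_two]
        change List.foldl step (List.foldl step (.var .fst none) _) _ = _
        rw [foldl_step_lit]
        exact foldl_step_lit .snd l'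
    rw [h1]
    exact ih fun C hC => h C (by simp [hC])

/-- The numbers before a literal. -/
def Pre (t : Slot) (l : List ℕ) : Prop :=
  ∃ φ, Good φ ∧ match t with
    | .fst => l = nats φ ++ [2]
    | .snd => ∃ l₁, l = nats φ ++ 2 :: litNats l₁
    | .single => l = nats φ ++ [1]

/-- What the automaton has read. -/
def Inv (w : List (Option Bool)) : Aut → Prop
  | .len => ∃ φ, Good φ ∧ w = encodeNats (nats φ)
  | .len1 => ∃ φ, Good φ ∧ w = encodeNats (nats φ) ++ [some true]
  | .len0 => ∃ φ, Good φ ∧ w = encodeNats (nats φ) ++ [some false]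
  | .len01 => ∃ φ, Good φ ∧ w = encodeNats (nats φ) ++ [some false, some true]
  | .var t s => ∃ (l : List ℕ) (b : List Bool), Pre t l ∧ w = encodeNats l ++ b.map some ∧ s = b.getLast?
  | .sgn t => ∃ l n, Pre t l ∧ w = encodeNats (l ++ [n])
  | .sgn1 t => ∃ l n, Pre t l ∧ w = encodeNats (l ++ [n]) ++ [some true]
  | .dead => True

theorem inv_next {t : Slot} {l : List ℕ} (h : Pre t l) (a : Literal) :
    Inv (encodeNats (l ++ litNats a)) t.next := by
  obtain ⟨φ, hφ, h⟩ := h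
  cases t with
  | fst =>
    obtain rfl := h
    exact ⟨nats φ ++ 2 :: litNats a, [], ⟨φ, hφ, a, rfl⟩, by simp, rfl⟩
  | snd =>
    obtain ⟨l₁, rfl⟩ := h
    refine ⟨φ ++ [[l₁, a]], ?_, ?_⟩
    · intro C hC
      rcases List.mem_append.1 hC with h | h
      · exact hφ C h
      · rw [List.mem_singleton] at h; subst h; simp
    · simp [nats]
  | single =>
    obtain rfl := h
    refine ⟨φ ++ [[a]], ?_, ?_⟩
    · intro C hC
      rcases List.mem_append.1 hC with h | h
      · exact hφ C h
      · rw [List.mem_singleton] at h; subst h; simp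
    · simp [nats]

/-- This is the soundness of the automaton: from the state alone, the word read so far can be
parsed. It gives the formula behind an accepted word and the place of every literal in it. -/
theorem inv_step {w : List (Option Bool)} {q : Aut} (h : Inv w q) (y : Option Bool) :
    Inv (w ++ [y]) (step q y) := by
  cases q with
  | len =>
    obtain ⟨φ, hφ, rfl⟩ := h
    rcases y with _ | _ | _
    · trivial
    · exact ⟨φ, hφ, rfl⟩
    · exact ⟨φ, hφ, rfl⟩
  | len1 =>
    obtain ⟨φ, hφ, rfl⟩ := h
    rcases y with _ | _ | _
    · refine ⟨_, [], ⟨φ, hφ, rfl⟩, ?_, rfl⟩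
      rw [encodeNats_append]
      simp [encodeNats_one]
    · trivial
    · trivial
  | len0 =>
    obtain ⟨φ, hφ, rfl⟩ := h
    rcases y with _ | _ | _
    · trivial
    · trivial
    · exact ⟨φ, hφ, by simp⟩
  | len01 =>
    obtain ⟨φ, hφ, rfl⟩ := h
    rcases y with _ | _ | _
    · refine ⟨_, [], ⟨φ, hφ, rfl⟩, ?_, rfl⟩
      rw [encodeNats_append]
      simp [encodeNats_two]
    · trivial
    · trivial
  | var t s =>
    obtain ⟨l, b, hl, rfl, rfl⟩ := h
    rcases y with _ | y
    · by_cases hb : b.getLast? = some false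
      · rw [step, if_pos hb]; trivial
      · rw [step, if_neg hb]
        obtain ⟨n, rfl⟩ := exists_encodeNat hb
        exact ⟨l, n, hl, by rw [encodeNats_append]; simp [encodeNats]⟩
    · exact ⟨l, b ++ [y], hl, by simp, by simp⟩
  | sgn t =>
    obtain ⟨l, n, hl, rfl⟩ := h
    rcases y with _ | _ | _
    · have := inv_next hl (n, false)
      rw [litNats, show l ++ [(n, false).1, if (n, false).2 = true then 1 else 0] = (l ++ [n]) ++ [0]
        by simp, encodeNats_append, encodeNats_zero] at this
      exact this
    · trivial
    · exact ⟨l, n, hl, rfl⟩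
  | sgn1 t =>
    obtain ⟨l, n, hl, rfl⟩ := h
    rcases y with _ | _ | _
    · have := inv_next hl (n, true)
      rw [litNats, show l ++ [(n, true).1, if (n, true).2 = true then 1 else 0] = (l ++ [n]) ++ [1]
        by simp, encodeNats_append, encodeNats_one] at this
      rw [List.append_assoc]
      exact this
    · trivial
    · trivial
  | dead =>
    cases y <;> trivial

theorem inv_foldl (w : List (Option Bool)) : Inv w (w.foldl step .len) := by
  induction w using List.reverseRecOn with
  | nil => exact ⟨[], by simp [Good], rfl⟩
  | append_singleton w y ih =>
    rw [List.foldl_append]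
    exact inv_step ih y

/-- The automaton accepts the encodings of formulas. -/
theorem foldl_step_eq_len_iff {x : List (Option Bool)} :
    x.foldl step .len = .len ↔ ∃ φ, Good φ ∧ x = encodeNats (nats φ) := by
  constructor
  · intro h
    have := inv_foldl x
    rw [h] at this
    exact this
  · rintro ⟨φ, hφ, rfl⟩
    exact foldl_step_encode hφ

end CNF

end

section

open Computability

/-- Expressions have sums but no search. A threshold is found by counting the indices below it; run
lengths of bits, first occurrences and quotients are obtained like this. -/
theorem sum_range_ite_eq {m n : ℕ} {p : ℕ → Prop} [DecidablePred p] (hm : m ≤ n)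
    (h : ∀ j < n, p j ↔ j < m) : (∑ j ∈ Finset.range n, if p j then 1 else 0) = m := by
  rw [← Finset.card_filter]
  have : (Finset.range n).filter p = Finset.range m := by
    ext j
    simp only [Finset.mem_filter, Finset.mem_range]
    constructor
    · rintro ⟨h1, h2⟩; exact (h j h1).1 h2
    · intro h1; exact ⟨by omega, (h j (by omega)).2 h1⟩
  rw [this, Finset.card_range]

namespace CNF

/-! ### Positions in the encoding of a formula -/

section Positions

variable (x : List (Option Bool))

def IsBit (i : ℕ) : Prop := ∃ b, x[i]? = some (some b)

def IsOne (i : ℕ) : Prop := x[i]? = some (some true)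

/-- The state of the automaton before position `a`. -/
def stateAt (a : ℕ) : Aut := (x.take a).foldl step .len

/-- A literal starts at position `a`. -/
def Occ (a : ℕ) : Prop := a < x.length ∧ ∃ t, stateAt x a = .var t none

/-- The first literal of a clause starts at position `a`. -/
def Cl (a : ℕ) : Prop :=
  a < x.length ∧ (stateAt x a = .var .fst none ∨ stateAt x a = .var .single none)

open Classical in
/-- The number of bits from position `a` on. -/
noncomputable def wl (a : ℕ) : ℕ :=
  ∑ j ∈ Finset.range x.length, if ∀ i < j + 1, IsBit x (a + i) then 1 else 0

/-- The start of the next number. -/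
noncomputable def nx (a : ℕ) : ℕ := a + wl x a + 1

/-- The same number starts at the positions `a` and `b`. -/
def Same (a b : ℕ) : Prop :=
  wl x a = wl x b ∧ ∀ i < wl x a, (IsOne x (a + i) ↔ IsOne x (b + i))

open Classical in
/-- The first position of the variable at position `a`. -/
noncomputable def can (a : ℕ) : ℕ :=
  ∑ c ∈ Finset.range x.length, if ∀ c' < c + 1, ¬ (Occ x c' ∧ Same x c' a) then 1 else 0

open Classical in
/-- The position of the last literal of the clause at position `a`. -/
noncomputable def sec (a : ℕ) : ℕ :=
  if a < x.length ∧ stateAt x a = .var .fst none then nx x (nx x a) else a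

noncomputable def layout : Layout where
  len := x.length
  can := can x
  first c := Occ x c ∧ can x c = c
  cl := Cl x
  sec := sec x
  sg a := IsOne x (nx x a)

/-- The number `n` starts at position `a`. -/
def Reads (a n : ℕ) : Prop := ∃ y, x.drop a = (encodeNat n).map some ++ none :: y

end Positions

variable {x : List (Option Bool)}

theorem getElem?_of_drop_eq {a n i : ℕ} {y : List (Option Bool)}
    (h : x.drop a = (encodeNat n).map some ++ none :: y) (hi : i < (encodeNat n).length) :
    x[a + i]? = some (some ((encodeNat n)[i])) := by
  rw [← List.getElem?_drop, h, List.getElem?_append_left (by simpa using hi)]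
  simp [hi]

theorem wl_eq {a n : ℕ} (h : Reads x a n) : wl x a = (encodeNat n).length := by
  classical
  unfold wl
  obtain ⟨y, h⟩ := h
  have hlen := congrArg List.length h
  simp only [List.length_drop, List.length_append, List.length_map, List.length_cons] at hlen
  apply sum_range_ite_eq
  · omega
  · intro j _
    constructor
    · intro hj
      by_contra h'
      obtain ⟨b, hb⟩ := hj (encodeNat n).length (by omega)
      rw [← List.getElem?_drop, h, List.getElem?_append_right (by simp)] at hb
      simp at hb
    · intro hj i hi
      exact ⟨_, getElem?_of_drop_eq h (by omega)⟩

theorem drop_nx {a n : ℕ} {y : List (Option Bool)}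
    (h : x.drop a = (encodeNat n).map some ++ none :: y) : x.drop (nx x a) = y := by
  rw [nx, wl_eq ⟨y, h⟩, add_assoc, ← List.drop_drop, h]
  have : (encodeNat n).length + 1 = ((encodeNat n).map some ++ [none]).length := by simp
  rw [this, List.append_cons _ _ y, List.drop_left]

theorem Reads.unique {a n m : ℕ} (h : Reads x a n) (h' : Reads x a m) : n = m := by
  obtain ⟨y, h⟩ := h
  obtain ⟨y', h'⟩ := h'
  exact encodeNat_injective (map_some_append_none_inj (h.symm.trans h')).1

/-- Equality of binary words can be tested bit by bit, so variables with large numbers are compared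
without computing their values. -/
theorem same_iff {a b n m : ℕ} (h : Reads x a n) (h' : Reads x b m) : Same x a b ↔ n = m := by
  unfold Same
  rw [wl_eq h, wl_eq h']
  constructor
  · rintro ⟨h1, h2⟩
    obtain ⟨y, h⟩ := h
    obtain ⟨y', h'⟩ := h'
    refine encodeNat_injective (List.ext_getElem h1 fun i hi hi' => ?_)
    have h3 := h2 i hi
    rw [IsOne, IsOne, getElem?_of_drop_eq h hi, getElem?_of_drop_eq h' hi'] at h3
    rw [Bool.eq_iff_iff]
    simpa only [Option.some.injEq] using h3
  · rintro rfl
    refine ⟨rfl, fun i hi => ?_⟩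
    obtain ⟨y, h⟩ := h
    obtain ⟨y', h'⟩ := h'
    rw [IsOne, IsOne, getElem?_of_drop_eq h hi, getElem?_of_drop_eq h' hi]

theorem can_spec {a : ℕ} (ha : Occ x a) :
    Occ x (can x a) ∧ Same x (can x a) a ∧ ∀ c, Occ x c → Same x c a → can x a ≤ c := by
  classical
  have hex : ∃ c, Occ x c ∧ Same x c a := ⟨a, ha, rfl, fun _ _ => Iff.rfl⟩
  have hcan : can x a = Nat.find hex := by
    unfold can
    apply sum_range_ite_eq
    · exact (Nat.find_min' hex ⟨ha, rfl, fun _ _ => Iff.rfl⟩).trans ha.1.le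
    · intro c _
      constructor
      · intro h
        by_contra h'
        exact h _ (by omega) (Nat.find_spec hex)
      · intro h c' hc'
        exact Nat.find_min hex (by omega)
  rw [hcan]
  exact ⟨(Nat.find_spec hex).1, (Nat.find_spec hex).2, fun c h1 h2 => Nat.find_min' hex ⟨h1, h2⟩⟩

theorem reads_lit {a : ℕ} {l : Literal} {r : List ℕ}
    (h : x.drop a = encodeNats (litNats l ++ r)) :
    Reads x a l.1 ∧ (IsOne x (nx x a) ↔ l.2 = true) ∧ x.drop (nx x (nx x a)) = encodeNats r := by
  rw [litNats, List.cons_append, encodeNats_cons] at h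
  have h1 := drop_nx h
  have h2 := h1
  rw [List.singleton_append, encodeNats_cons] at h2
  refine ⟨⟨_, h⟩, ?_, drop_nx h2⟩
  rw [IsOne, ← Nat.add_zero (nx x a), ← List.getElem?_drop, h1, List.singleton_append]
  rcases l with ⟨n, _ | _⟩
  · rw [if_neg (by simp), encodeNats_cons, encodeNat_eq]; simp
  · rw [if_pos rfl, encodeNats_cons, encodeNat_one]; simp

variable {φ : Formula}

theorem drop_of_take {a : ℕ} {l : List ℕ} (hx : x = encodeNats (nats φ))
    (h : x.take a = encodeNats l) : ∃ r, nats φ = l ++ r ∧ x.drop a = encodeNats r := by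
  obtain ⟨r, h1, h2⟩ := exists_of_encodeNats_eq_append (l := nats φ) (l' := l) (y := x.drop a)
    (by rw [← h, List.take_append_drop, hx])
  exact ⟨r, h1, h2⟩

/-- The entry `none` for the last symbol means that no bit of the current number has been read, so
the position is exactly the start of a number. -/
theorem pre_of_stateAt {a : ℕ} {t : Slot} (h : stateAt x a = .var t none) :
    ∃ l, Pre t l ∧ x.take a = encodeNats l := by
  have h1 := inv_foldl (x.take a)
  rw [show (x.take a).foldl step .len = .var t none from h] at h1
  obtain ⟨l, b, h2, h3, h4⟩ := h1
  obtain rfl : b = [] := by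
    rcases b.eq_nil_or_concat with rfl | ⟨b, c, rfl⟩
    · rfl
    · simp at h4
  exact ⟨l, h2, by simpa using h3⟩

/-- The two literals at a clause position (which are the same if the clause has one literal). -/
theorem exists_clause_of_cl (hφ : Good φ) (hx : x = encodeNats (nats φ)) {a : ℕ} (ha : Cl x a) :
    Occ x a ∧ Occ x (sec x a) ∧ ∃ C ∈ φ, ∃ l ∈ C, ∃ l' ∈ C, (∀ l'' ∈ C, l'' = l ∨ l'' = l') ∧
      Reads x a l.1 ∧ (IsOne x (nx x a) ↔ l.2 = true) ∧
      Reads x (sec x a) l'.1 ∧ (IsOne x (nx x (sec x a)) ↔ l'.2 = true) := by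
  rcases ha with ⟨h0, ha | ha⟩
  · obtain ⟨l, ⟨φ₁, h1, rfl⟩, h3⟩ := pre_of_stateAt ha
    obtain ⟨r, h4, h5⟩ := drop_of_take hx h3
    rw [List.append_assoc, List.singleton_append] at h4
    obtain ⟨C, φ₂, rfl, hC, rfl⟩ := exists_of_nats_eq h4
    obtain ⟨l, l', rfl⟩ := List.length_eq_two.1 hC
    rw [List.flatMap_cons, List.flatMap_cons, List.flatMap_nil, List.append_nil,
      List.append_assoc] at h5
    obtain ⟨h6, h7, h8⟩ := reads_lit h5
    have hsec : sec x a = nx x (nx x a) := by rw [sec, if_pos ⟨h0, ha⟩]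
    obtain ⟨h9, h10, -⟩ := reads_lit h8
    -- The prefix before the second literal consists of whole numbers, which determines the state
    -- there and shows that a literal starts at this position.
    have htake : x.take (nx x (nx x a)) = encodeNats (nats φ₁ ++ 2 :: litNats l) := by
      have h11 : x = encodeNats (nats φ₁ ++ 2 :: litNats l) ++ x.drop (nx x (nx x a)) := by
        rw [h8, ← encodeNats_append]
        conv_lhs => rw [hx]
        rw [nats_append, nats_cons]
        congr 1
        simp
      have h12 : x.take (nx x (nx x a)) ++ x.drop (nx x (nx x a)) = _ :=
        (List.take_append_drop _ x).trans h11
      exact List.append_cancel_right h12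
    refine ⟨⟨h0, _, ha⟩, ⟨?_, .snd, ?_⟩, [l, l'], by simp, l, by simp, l', by simp, by simp,
      h6, h7, hsec ▸ h9, hsec ▸ h10⟩
    · rw [hsec]
      by_contra h
      obtain ⟨y, hy⟩ := h9
      rw [List.drop_of_length_le (by omega)] at hy
      simp at hy
    · rw [hsec, stateAt, htake, encodeNats_append, List.foldl_append,
        foldl_step_encode (fun C hC => h1 C hC), encodeNats_cons, encodeNat_two]
      exact foldl_step_lit .fst l
  · obtain ⟨l, ⟨φ₁, h1, rfl⟩, h3⟩ := pre_of_stateAt ha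
    obtain ⟨r, h4, h5⟩ := drop_of_take hx h3
    rw [List.append_assoc, List.singleton_append] at h4
    obtain ⟨C, φ₂, rfl, hC, rfl⟩ := exists_of_nats_eq h4
    obtain ⟨l, rfl⟩ := List.length_eq_one_iff.1 hC
    rw [List.flatMap_cons, List.flatMap_nil, List.append_nil] at h5
    obtain ⟨h6, h7, -⟩ := reads_lit h5
    have hsec : sec x a = a := by rw [sec, ha, if_neg (by simp)]
    exact ⟨⟨h0, _, ha⟩, hsec.symm ▸ ⟨h0, _, ha⟩, [l], by simp, l, by simp, l, by simp, by simp,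
      h6, h7, hsec.symm ▸ h6, hsec.symm ▸ h7⟩

theorem exists_cl_of_mem (hφ : Good φ) (hx : x = encodeNats (nats φ)) {C : List Literal}
    (hC : C ∈ φ) : ∃ a, Cl x a ∧ ∃ l ∈ C, ∃ l' ∈ C, (∀ l'' ∈ C, l'' = l ∨ l'' = l') ∧
      Reads x a l.1 ∧ (IsOne x (nx x a) ↔ l.2 = true) ∧
      Reads x (sec x a) l'.1 ∧ (IsOne x (nx x (sec x a)) ↔ l'.2 = true) := by
  obtain ⟨φ₁, φ₂, rfl⟩ := List.append_of_mem hC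
  have h1 : Good φ₁ := fun C' hC' => hφ C' (by simp [hC'])
  have hx' : x = encodeNats (nats φ₁ ++ [C.length]) ++
      encodeNats (C.flatMap litNats ++ nats φ₂) := by
    rw [← encodeNats_append, hx, nats_append, nats_cons]
    congr 1
    simp
  set a := (encodeNats (nats φ₁ ++ [C.length])).length with ha
  have htake : x.take a = encodeNats (nats φ₁ ++ [C.length]) := by
    rw [hx', ha, List.take_left]
  have hdrop : x.drop a = encodeNats (C.flatMap litNats ++ nats φ₂) := by
    rw [hx', ha, List.drop_left]
  have hstate : stateAt x a = (encodeNats [C.length]).foldl step .len := by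
    rw [stateAt, htake, encodeNats_append, List.foldl_append, foldl_step_encode h1]
  have hlt : ∀ n, Reads x a n → a < x.length := by
    rintro n ⟨y, hy⟩
    by_contra h
    rw [List.drop_of_length_le (by omega)] at hy
    simp at hy
  refine ⟨a, ?_⟩
  rcases hφ C hC with h | h
  · obtain ⟨l, rfl⟩ := List.length_eq_one_iff.1 h
    rw [List.flatMap_cons, List.flatMap_nil, List.append_nil] at hdrop
    rw [h, encodeNats_one] at hstate
    change stateAt x a = .var .single none at hstate
    obtain ⟨h6, h7, -⟩ := reads_lit hdrop
    have hsec : sec x a = a := by rw [sec, hstate, if_neg (by simp)]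
    exact ⟨⟨hlt _ h6, .inr hstate⟩, l, by simp, l, by simp, by simp,
      h6, h7, hsec.symm ▸ h6, hsec.symm ▸ h7⟩
  · obtain ⟨l, l', rfl⟩ := List.length_eq_two.1 h
    rw [List.flatMap_cons, List.flatMap_cons, List.flatMap_nil, List.append_nil,
      List.append_assoc] at hdrop
    rw [h, encodeNats_two] at hstate
    change stateAt x a = .var .fst none at hstate
    obtain ⟨h6, h7, h8⟩ := reads_lit hdrop
    obtain ⟨h9, h10, -⟩ := reads_lit h8
    have hsec : sec x a = nx x (nx x a) := by rw [sec, if_pos ⟨hlt _ h6, hstate⟩]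
    exact ⟨⟨hlt _ h6, .inl hstate⟩, l, by simp, l', by simp, by simp,
      h6, h7, hsec ▸ h9, hsec ▸ h10⟩

theorem mem_vars {n : ℕ} : n ∈ vars φ ↔ ∃ C ∈ φ, ∃ l ∈ C, l.1 = n := by
  simp [vars]

theorem exists_reads (hx : x = encodeNats (nats φ)) {a : ℕ} (ha : Occ x a) :
    ∃ n ∈ vars φ, Reads x a n := by
  obtain ⟨-, t, ht⟩ := ha
  obtain ⟨l, ⟨φ₁, h1, h2⟩, h3⟩ := pre_of_stateAt ht
  obtain ⟨r, h4, h5⟩ := drop_of_take hx h3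
  cases t with
  | fst =>
    obtain rfl := h2
    rw [List.append_assoc, List.singleton_append] at h4
    obtain ⟨C, φ₂, rfl, hC, rfl⟩ := exists_of_nats_eq h4
    obtain ⟨l, l', rfl⟩ := List.length_eq_two.1 hC
    rw [List.flatMap_cons, List.append_assoc] at h5
    exact ⟨l.1, mem_vars.2 ⟨[l, l'], by simp, l, by simp, rfl⟩, (reads_lit h5).1⟩
  | snd =>
    obtain ⟨l₁, rfl⟩ := h2
    rw [List.append_assoc, List.cons_append] at h4
    obtain ⟨C, φ₂, rfl, hC, h6⟩ := exists_of_nats_eq h4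
    obtain ⟨l, l', rfl⟩ := List.length_eq_two.1 hC
    rw [List.flatMap_cons, List.append_assoc] at h6
    have h7 := (List.append_inj h6 (by simp [litNats])).2
    rw [h7, List.flatMap_cons, List.append_assoc] at h5
    exact ⟨l'.1, mem_vars.2 ⟨[l, l'], by simp, l', by simp, rfl⟩, (reads_lit h5).1⟩
  | single =>
    obtain rfl := h2
    rw [List.append_assoc, List.singleton_append] at h4
    obtain ⟨C, φ₂, rfl, hC, rfl⟩ := exists_of_nats_eq h4
    obtain ⟨l, rfl⟩ := List.length_eq_one_iff.1 hC
    rw [List.flatMap_cons, List.append_assoc] at h5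
    exact ⟨l.1, mem_vars.2 ⟨[l], by simp, l, by simp, rfl⟩, (reads_lit h5).1⟩

/-- The first positions of the variables. -/
theorem exists_position (hφ : Good φ) (hx : x = encodeNats (nats φ)) {n : ℕ} (hn : n ∈ vars φ) :
    ∃ c, Occ x c ∧ can x c = c ∧ Reads x c n ∧ ∀ a, Occ x a → Reads x a n → can x a = c := by
  obtain ⟨a, ha, har⟩ : ∃ a, Occ x a ∧ Reads x a n := by
    obtain ⟨C, hC, l, hl, rfl⟩ := mem_vars.1 hn
    obtain ⟨a, ha, l₁, -, l₂, -, h3, h4, -, h5, -⟩ := exists_cl_of_mem hφ hx hC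
    obtain ⟨h6, h7, -⟩ := exists_clause_of_cl hφ hx ha
    rcases h3 l hl with rfl | rfl
    · exact ⟨a, h6, h4⟩
    · exact ⟨_, h7, h5⟩
  have key : ∀ b, Occ x b → Reads x b n → can x b = can x a := by
    intro b hb hbr
    obtain ⟨h1, h2, h3⟩ := can_spec ha
    obtain ⟨h4, h5, h6⟩ := can_spec hb
    obtain ⟨m, -, hm⟩ := exists_reads hx h1
    obtain ⟨m', -, hm'⟩ := exists_reads hx h4
    obtain rfl := (same_iff hm har).1 h2
    obtain rfl := (same_iff hm' hbr).1 h5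
    exact le_antisymm (h6 _ h1 ((same_iff hm hbr).2 rfl)) (h3 _ h4 ((same_iff hm' har).2 rfl))
  obtain ⟨h1, h2, h3⟩ := can_spec ha
  obtain ⟨m, -, hm⟩ := exists_reads hx h1
  obtain rfl := (same_iff hm har).1 h2
  exact ⟨can x a, h1, key _ h1 hm, hm, key⟩

/-- Weighted satisfiability in terms of positions. -/
theorem mem_weighted2CNFSat_iff {k : ℕ} : (x, k) ∈ Weighted2CNFSat ↔
    x.foldl step .len = .len ∧ ∃ R : Finset ℕ, R.card = k ∧ (∀ c ∈ R, Occ x c ∧ can x c = c) ∧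
      ∀ a < x.length, Cl x a → ((can x a ∈ R ↔ IsOne x (nx x a)) ∨
        (can x (sec x a) ∈ R ↔ IsOne x (nx x (sec x a)))) := by
  have key : ∀ φ, Good φ → x = encodeNats (nats φ) →
      ((∃ S ⊆ vars φ, S.card = k ∧ Sat φ S) ↔
      ∃ R : Finset ℕ, R.card = k ∧ (∀ c ∈ R, Occ x c ∧ can x c = c) ∧
      ∀ a < x.length, Cl x a → ((can x a ∈ R ↔ IsOne x (nx x a)) ∨
        (can x (sec x a) ∈ R ↔ IsOne x (nx x (sec x a))))) := by
    intro φ hφ hx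
    -- The value `0` for numbers that are not variables only makes the function total.
    have hpos : ∀ n, ∃ c, n ∈ vars φ → Occ x c ∧ can x c = c ∧ Reads x c n ∧
        ∀ a, Occ x a → Reads x a n → can x a = c := fun n => by
      by_cases hn : n ∈ vars φ
      · obtain ⟨c, hc⟩ := exists_position hφ hx hn
        exact ⟨c, fun _ => hc⟩
      · exact ⟨0, fun h => absurd h hn⟩
    choose pos hpos using hpos
    have hinj : Set.InjOn pos (vars φ) := by
      intro n hn m hm h
      have h1 := (hpos n hn).2.2.1
      rw [h] at h1
      exact h1.unique (hpos m hm).2.2.1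
    have hsat : ∀ S ⊆ vars φ, (Sat φ S ↔ ∀ a < x.length, Cl x a →
        ((can x a ∈ S.image pos ↔ IsOne x (nx x a)) ∨
        (can x (sec x a) ∈ S.image pos ↔ IsOne x (nx x (sec x a))))) := by
      intro S hS
      have hcan : ∀ a n, Occ x a → Reads x a n → (can x a ∈ S.image pos ↔ n ∈ S) := by
        intro a n ha hr
        obtain ⟨m, hm, hr'⟩ := exists_reads hx ha
        obtain rfl := hr.unique hr'
        rw [(hpos n hm).2.2.2 a ha hr]
        constructor
        · intro h
          obtain ⟨m, hm', h⟩ := Finset.mem_image.1 h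
          rwa [← hinj (hS hm') hm h]
        · exact Finset.mem_image_of_mem pos
      constructor
      · intro hs a _ ha
        obtain ⟨h1, h2, C, hC, l, hl, l', hl', h3, h4, h5, h6, h7⟩ := exists_clause_of_cl hφ hx ha
        rw [hcan a _ h1 h4, hcan _ _ h2 h6, h5, h7]
        obtain ⟨l'', hl'', h8⟩ := hs C hC
        rcases h3 l'' hl'' with rfl | rfl
        · exact .inl h8
        · exact .inr h8
      · intro hs C hC
        obtain ⟨a, ha, l, hl, l', hl', h3, h4, h5, h6, h7⟩ := exists_cl_of_mem hφ hx hC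
        obtain ⟨h1, h2, -⟩ := exists_clause_of_cl hφ hx ha
        have := hs a ha.1 ha
        rw [hcan a _ h1 h4, hcan _ _ h2 h6, h5, h7] at this
        rcases this with h | h
        · exact ⟨l, hl, h⟩
        · exact ⟨l', hl', h⟩
    constructor
    · rintro ⟨S, hS, hk, hs⟩
      refine ⟨S.image pos, ?_, ?_, (hsat S hS).1 hs⟩
      · rw [Finset.card_image_of_injOn (hinj.mono hS), hk]
      · intro c hc
        obtain ⟨n, hn, rfl⟩ := Finset.mem_image.1 hc
        exact ⟨(hpos n (hS hn)).1, (hpos n (hS hn)).2.1⟩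
    · rintro ⟨R, hR, hRf, hs⟩
      have hS : (vars φ).filter (fun n => pos n ∈ R) ⊆ vars φ := Finset.filter_subset _ _
      have him : ((vars φ).filter (fun n => pos n ∈ R)).image pos = R := by
        ext c
        simp only [Finset.mem_image, Finset.mem_filter]
        constructor
        · rintro ⟨n, ⟨-, h⟩, rfl⟩; exact h
        · intro hc
          obtain ⟨h1, h2⟩ := hRf c hc
          obtain ⟨n, hn, hr⟩ := exists_reads hx h1
          have h3 : pos n = c := by rw [← (hpos n hn).2.2.2 c h1 hr, h2]
          exact ⟨n, ⟨hn, h3 ▸ hc⟩, h3⟩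
      refine ⟨_, hS, ?_, ?_⟩
      · rw [← hR, ← him, Finset.card_image_of_injOn (hinj.mono hS), him]
      · rw [hsat _ hS, him]; exact hs
  constructor
  · rintro ⟨φ, h1, h2, S, hS, hk, hs⟩
    -- Empty clauses cannot be satisfied, so nothing is lost by rejecting them.
    have hφ : Good φ := by
      intro C hC
      have h3 := h1 C hC
      have h4 : C.length ≠ 0 := by
        intro h
        obtain ⟨l, hl, -⟩ := hs C hC
        rw [List.length_eq_zero_iff.1 h] at hl
        simp at hl
      omega
    exact ⟨foldl_step_eq_len_iff.2 ⟨φ, hφ, h2⟩, (key φ hφ h2).1 ⟨S, hS, hk, hs⟩⟩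
  · rintro ⟨h1, h2⟩
    obtain ⟨φ, hφ, hx⟩ := foldl_step_eq_len_iff.1 h1
    refine ⟨φ, fun C hC => ?_, hx, (key φ hφ hx).2 h2⟩
    have := hφ C hC
    omega

open Finset in
/-- Weighted satisfiability in terms of conflicts. -/
theorem mem_weighted2CNFSat_iff_conf {k : ℕ} : (x, k) ∈ Weighted2CNFSat ↔
    ∃ U ⊆ range ((k + 2) * ((x.length + 2) * (x.length + 2))), #U = k + 2 ∧ ∀ u ∈ U, ∀ v ∈ U,
      u ≠ v → ¬ (x.foldl step .len = .len → (layout x).Conf k u v) := by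
  by_cases hx : x.foldl step .len = .len
  · obtain ⟨φ, hφ, hx'⟩ := foldl_step_eq_len_iff.1 hx
    have h1 := Layout.exists_gaps_iff (P := layout x) (k := k) (fun c hc => hc.1.1)
      (fun a ha => by
        obtain ⟨h2, h3, -⟩ := exists_clause_of_cl hφ hx' ha
        exact ⟨(can_spec h2).1.1, (can_spec h3).1.1⟩)
    rw [mem_weighted2CNFSat_iff]
    simp only [hx, true_and, true_imp_iff]
    exact h1.trans Layout.exists_conf_iff
  · rw [mem_weighted2CNFSat_iff]
    simp only [hx, false_and, false_imp_iff, not_true_eq_false, false_iff, not_exists, not_and]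
    intro U _ hU h
    -- For a word that is not accepted, every pair conflicts, and at least two vertices would be
    -- needed.
    obtain ⟨u, hu, v, hv, huv⟩ := Finset.one_lt_card.1 (show 1 < #U by omega)
    exact h u hu v hv huv

end CNF

end

/-! ### The conflict relation as an expression over the annotated word -/

section

open Turing

namespace Counter

variable {A B : Type}

theorem getElem?_annotate {I Q : Type} (δ : Q → I → Q) : ∀ (x : List I) (q : Q) (i : ℕ),
    (annotate δ q x)[i]? = (x[i]?).map fun y => ((x.take i).foldl δ q, y)
  | [], _, i => by simp [annotate]
  | y :: x, q, 0 => by simp [annotate]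
  | y :: x, q, i + 1 => by simp [annotate, getElem?_annotate δ x]

namespace Expr

/-! ### Boolean expressions -/

/-- The truth value of an expression. -/
def Holds (T : List A) (ρ : ℕ → ℕ) (e : Expr A) : Prop := e.eval T ρ ≠ 0

def not (e : Expr A) : Expr A := ifz e (const 1) (const 0)
def and (a b : Expr A) : Expr A := mul a b
def or (a b : Expr A) : Expr A := add a b
def imp (a b : Expr A) : Expr A := or (not a) b
def lt (a b : Expr A) : Expr A := sub b a
def eq (a b : Expr A) : Expr A := not (or (lt a b) (lt b a))
def ind (a : Expr A) : Expr A := not (not a)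
def all (v : ℕ) (e f : Expr A) : Expr A := not (sum v e (not f))
def succ (a : Expr A) : Expr A := add a (const 1)

variable {T : List A} {ρ : ℕ → ℕ}

theorem holds_not {e : Expr A} : Holds T ρ (not e) ↔ ¬ Holds T ρ e := by
  simp only [Holds, not, eval]; split_ifs <;> simp_all

theorem holds_and {a b : Expr A} : Holds T ρ (and a b) ↔ Holds T ρ a ∧ Holds T ρ b := by
  simp [Holds, and, eval]

theorem holds_or {a b : Expr A} : Holds T ρ (or a b) ↔ Holds T ρ a ∨ Holds T ρ b := by
  simp only [Holds, or, eval]; omega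

theorem holds_imp {a b : Expr A} : Holds T ρ (imp a b) ↔ (Holds T ρ a → Holds T ρ b) := by
  rw [imp, holds_or, holds_not]; tauto

theorem holds_lt {a b : Expr A} : Holds T ρ (lt a b) ↔ a.eval T ρ < b.eval T ρ := by
  simp only [Holds, lt, eval]; omega

theorem holds_eq {a b : Expr A} : Holds T ρ (eq a b) ↔ a.eval T ρ = b.eval T ρ := by
  rw [eq, holds_not, holds_or, holds_lt, holds_lt]; omega

theorem holds_sum {v : ℕ} {e f : Expr A} : Holds T ρ (sum v e f) ↔
    ∃ i < e.eval T ρ, Holds T (Function.update ρ v i) f := by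
  simp [Holds, eval, Finset.sum_eq_zero_iff]

theorem holds_all {v : ℕ} {e f : Expr A} : Holds T ρ (all v e f) ↔
    ∀ i < e.eval T ρ, Holds T (Function.update ρ v i) f := by
  rw [all, holds_not, holds_sum]; simp [holds_not]

theorem holds_letE {v : ℕ} {e f : Expr A} : Holds T ρ (letE v e f) ↔
    Holds T (Function.update ρ v (e.eval T ρ)) f := Iff.rfl

theorem holds_tape {f : A → Bool} {e : Expr A} : Holds T ρ (tape f e) ↔
    ∃ a, T[e.eval T ρ]? = some a ∧ f a = true := by
  simp only [Holds, eval]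
  rcases T[e.eval T ρ]? with _ | a
  · simp
  · by_cases h : f a = true <;> simp [h]

theorem eval_ind (e : Expr A) [Decidable (Holds T ρ e)] :
    (ind e).eval T ρ = if Holds T ρ e then 1 else 0 := by
  simp only [ind, not, eval, Holds]
  split_ifs <;> simp_all

theorem eval_ifz (c a b : Expr A) [Decidable (Holds T ρ c)] :
    (ifz c a b).eval T ρ = if Holds T ρ c then b.eval T ρ else a.eval T ρ := by
  simp only [eval, Holds]
  split_ifs <;> simp_all

theorem eval_succ (a : Expr A) : (succ a).eval T ρ = a.eval T ρ + 1 := rfl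

/-! ### Division -/

/-- The quotient of `a` by an expression whose value does not depend on the variables used
here. -/
def div (a b : Expr A) : Expr A :=
  letE 20 a (sum 21 (var 20) (ind (not (lt (var 20) (mul (succ (var 21)) b)))))

def mod (a b : Expr A) : Expr A := sub a (mul b (div a b))

theorem eval_div {a b : Expr A} {c : ℕ} (hc : 0 < c)
    (hb : ∀ ρ' : ℕ → ℕ, ρ' 1 = ρ 1 → b.eval T ρ' = c) :
    (div a b).eval T ρ = a.eval T ρ / c := by
  classical
  simp only [div, eval, Function.update_self]
  simp only [eval_ind, holds_not, holds_lt, eval_succ, eval]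
  rw [← sum_range_ite_eq (p := fun j => ¬ a.eval T ρ < (j + 1) * c) (Nat.div_le_self _ c)]
  · refine Finset.sum_congr rfl fun i _ => ?_
    rw [hb _ (by simp)]
    simp
  · intro j _
    rw [not_lt, Nat.lt_iff_add_one_le, Nat.le_div_iff_mul_le hc]

theorem eval_mod {a b : Expr A} {c : ℕ} (hc : 0 < c)
    (hb : ∀ ρ' : ℕ → ℕ, ρ' 1 = ρ 1 → b.eval T ρ' = c) :
    (mod a b).eval T ρ = a.eval T ρ % c := by
  rw [mod, eval, eval, eval_div hc hb, hb ρ rfl, Nat.mod_eq_sub]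

end Expr

end Counter

namespace CNF

open Counter Counter.Expr

/-! ### The conflicts of a formula as an expression

The variable `0` holds the parameter, and the variable `1` the length of the word. -/

/-- The annotated word. -/
def tapeOf (x : List (Option Bool)) : List (Aut × Option Bool) := annotate step .len x

/-- The argument is bound to a variable outside the sum, so the variables used here cannot capture
those of the argument. The other builders have number ranges of their own. -/
def wlE (a : Expr (Aut × Option Bool)) : Expr (Aut × Option Bool) :=
  letE 10 a (sum 11 (var 1) (ind (all 12 (succ (var 11))
    (tape (fun s => s.2.isSome) (add (var 10) (var 12))))))

def nxE (a : Expr (Aut × Option Bool)) : Expr (Aut × Option Bool) := succ (add a (wlE a))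

def oneE (a : Expr (Aut × Option Bool)) : Expr (Aut × Option Bool) :=
  tape (fun s => s.2 = some true) a

def occE (a : Expr (Aut × Option Bool)) : Expr (Aut × Option Bool) :=
  tape (fun s => s.1 = .var .fst none ∨ s.1 = .var .snd none ∨ s.1 = .var .single none) a

def clE (a : Expr (Aut × Option Bool)) : Expr (Aut × Option Bool) :=
  tape (fun s => s.1 = .var .fst none ∨ s.1 = .var .single none) a

def secE (a : Expr (Aut × Option Bool)) : Expr (Aut × Option Bool) :=
  ifz (tape (fun s => s.1 = .var .fst none) a) a (nxE (nxE a))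

def canE (a : Expr (Aut × Option Bool)) : Expr (Aut × Option Bool) :=
  letE 15 a (sum 16 (var 1) (ind (all 17 (succ (var 16)) (not (and (occE (var 17))
    (and (eq (wlE (var 17)) (wlE (var 15))) (all 18 (wlE (var 17))
      (and (imp (oneE (add (var 17) (var 18))) (oneE (add (var 15) (var 18))))
        (imp (oneE (add (var 15) (var 18))) (oneE (add (var 17) (var 18)))))))))))) 

def flsE (p q a : Expr (Aut × Option Bool)) : Expr (Aut × Option Bool) :=
  and (imp (oneE (nxE a)) (and (lt p (succ (canE a))) (lt (succ (canE a)) q)))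
    (imp (not (oneE (nxE a))) (eq p (succ (canE a))))

def badE (p q p' q' : Expr (Aut × Option Bool)) : Expr (Aut × Option Bool) :=
  sum 40 (var 1) (and (clE (var 40))
    (and (or (flsE p q (var 40)) (flsE p' q' (var 40)))
      (or (flsE p q (secE (var 40))) (flsE p' q' (secE (var 40))))))

def validE (i p q : Expr (Aut × Option Bool)) : Expr (Aut × Option Bool) :=
  or (and (eq i (const 0)) (and (eq p (const 0)) (eq q (const 0))))
    (and (not (eq i (const 0))) (and (lt p q) (and (or (eq q (succ (var 1)))
      (and (not (eq q (const 0))) (and (occE (sub q (const 1)))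
        (eq (canE (sub q (const 1))) (sub q (const 1))))))
      (imp (eq i (succ (var 0))) (eq q (succ (var 1)))))))

def goodE : Expr (Aut × Option Bool) :=
  or (eq (var 1) (const 0)) (tape (fun s => step s.1 s.2 = .len) (sub (var 1) (const 1)))

def baseE : Expr (Aut × Option Bool) := add (var 1) (const 2)

/-- The conflict of the vertices in the variables `2` and `3`. -/
def confE : Expr (Aut × Option Bool) :=
  letE 30 (div (var 2) (mul baseE baseE)) <|
  letE 31 (mod (div (var 2) baseE) baseE) <|
  letE 32 (mod (var 2) baseE) <|
  letE 33 (div (var 3) (mul baseE baseE)) <|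
  letE 34 (mod (div (var 3) baseE) baseE) <|
  letE 35 (mod (var 3) baseE) <|
  imp goodE (not (and (validE (var 30) (var 31) (var 32)) (and (validE (var 33) (var 34) (var 35))
    (and (not (eq (var 30) (var 33))) (and (imp (eq (var 33) (succ (var 30))) (eq (var 32) (var 34)))
      (and (imp (eq (var 30) (succ (var 33))) (eq (var 35) (var 31)))
        (not (badE (var 31) (var 32) (var 34) (var 35)))))))))

variable {x : List (Option Bool)} {ρ : ℕ → ℕ}

theorem getElem?_tapeOf (i : ℕ) : (tapeOf x)[i]? = (x[i]?).map fun y => (stateAt x i, y) :=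
  getElem?_annotate _ _ _ _

theorem holds_tapeOf {f : Aut × Option Bool → Bool} {e : Expr (Aut × Option Bool)} :
    Holds (tapeOf x) ρ (tape f e) ↔ ∃ y, x[e.eval (tapeOf x) ρ]? = some y ∧
      f (stateAt x (e.eval (tapeOf x) ρ), y) = true := by
  rw [holds_tape, getElem?_tapeOf]
  simp

theorem holds_state {f : Aut → Bool} {e : Expr (Aut × Option Bool)} :
    Holds (tapeOf x) ρ (tape (fun s => f s.1) e) ↔ e.eval (tapeOf x) ρ < x.length ∧
      f (stateAt x (e.eval (tapeOf x) ρ)) = true := by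
  rw [holds_tapeOf]
  constructor
  · rintro ⟨y, h1, h2⟩
    exact ⟨(List.getElem?_eq_some_iff.1 h1).1, h2⟩
  · rintro ⟨h1, h2⟩
    exact ⟨x[e.eval (tapeOf x) ρ], List.getElem?_eq_getElem h1, h2⟩

theorem eval_wlE (hρ : ρ 1 = x.length) (a : Expr (Aut × Option Bool)) :
    (wlE a).eval (tapeOf x) ρ = wl x (a.eval (tapeOf x) ρ) := by
  classical
  simp only [wlE, eval, wl, eval_ind, holds_all, holds_tapeOf, eval_succ]
  simp only [Function.update_apply]
  simp only [Nat.reduceEqDiff, if_true, if_false, hρ, OfNat.one_ne_ofNat]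
  refine Finset.sum_congr rfl fun j _ => ?_
  refine if_congr (forall₂_congr fun i _ => ?_) rfl rfl
  constructor
  · rintro ⟨y, h1, h2⟩
    obtain ⟨b, rfl⟩ := Option.isSome_iff_exists.1 h2
    exact ⟨b, h1⟩
  · rintro ⟨b, h⟩
    exact ⟨_, h, rfl⟩

theorem eval_nxE (hρ : ρ 1 = x.length) (a : Expr (Aut × Option Bool)) :
    (nxE a).eval (tapeOf x) ρ = nx x (a.eval (tapeOf x) ρ) := by
  rw [nxE, eval_succ, eval, eval_wlE hρ, nx]

theorem holds_oneE (a : Expr (Aut × Option Bool)) :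
    Holds (tapeOf x) ρ (oneE a) ↔ IsOne x (a.eval (tapeOf x) ρ) := by
  rw [oneE, holds_tapeOf]
  simp [IsOne]

theorem holds_occE (a : Expr (Aut × Option Bool)) :
    Holds (tapeOf x) ρ (occE a) ↔ Occ x (a.eval (tapeOf x) ρ) := by
  rw [occE, holds_state (f := fun s => decide (s = .var .fst none ∨ s = .var .snd none ∨
    s = .var .single none)), Occ]
  refine and_congr_right fun _ => ?_
  rw [decide_eq_true_iff]
  constructor
  · rintro (h | h | h)
    exacts [⟨_, h⟩, ⟨_, h⟩, ⟨_, h⟩]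
  · rintro ⟨_ | _ | _, h⟩
    exacts [.inl h, .inr (.inl h), .inr (.inr h)]

theorem holds_clE (a : Expr (Aut × Option Bool)) :
    Holds (tapeOf x) ρ (clE a) ↔ Cl x (a.eval (tapeOf x) ρ) := by
  rw [clE, holds_state (f := fun s => decide (s = .var .fst none ∨ s = .var .single none)), Cl]
  rw [decide_eq_true_iff]

theorem eval_secE (hρ : ρ 1 = x.length) (a : Expr (Aut × Option Bool)) :
    (secE a).eval (tapeOf x) ρ = sec x (a.eval (tapeOf x) ρ) := by
  classical
  rw [secE, eval_ifz, eval_nxE hρ, eval_nxE hρ, sec]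
  refine if_congr ?_ rfl rfl
  rw [holds_state (f := fun s => decide (s = .var .fst none)), decide_eq_true_iff]

theorem eval_canE (hρ : ρ 1 = x.length) (a : Expr (Aut × Option Bool)) :
    (canE a).eval (tapeOf x) ρ = can x (a.eval (tapeOf x) ρ) := by
  classical
  simp only [canE, eval, can, eval_ind, holds_all, eval_succ, holds_not, holds_and, holds_imp,
    holds_occE, holds_oneE, holds_eq]
  simp only [Function.update_apply, Nat.reduceEqDiff, if_true, if_false, OfNat.one_ne_ofNat, hρ]
  refine Finset.sum_congr rfl fun c _ => ?_
  refine if_congr (forall₂_congr fun c' _ => ?_) rfl rfl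
  rw [eval_wlE (by simp [hρ]), eval_wlE (by simp [hρ])]
  simp only [eval, Function.update_apply, Nat.reduceEqDiff, if_true, if_false, Same, iff_iff_implies_and_implies]

theorem holds_flsE (hρ : ρ 1 = x.length) (p q a : Expr (Aut × Option Bool)) :
    Holds (tapeOf x) ρ (flsE p q a) ↔ (layout x).Fls (p.eval (tapeOf x) ρ)
      (q.eval (tapeOf x) ρ) (a.eval (tapeOf x) ρ) := by
  simp only [flsE, holds_and, holds_imp, holds_oneE, holds_lt, eval_succ, eval_canE hρ,
    eval_nxE hρ, holds_not, holds_eq, Layout.Fls, layout]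

/-- The arguments stand inside the binder of the variable `40`, hence the four inequalities. -/
theorem holds_badE (hρ : ρ 1 = x.length) {p q p' q' : ℕ} (hp : p ≠ 40) (hq : q ≠ 40)
    (hp' : p' ≠ 40) (hq' : q' ≠ 40) :
    Holds (tapeOf x) ρ (badE (var p) (var q) (var p') (var q')) ↔
      (layout x).Bad (ρ p) (ρ q) (ρ p') (ρ q') := by
  rw [badE, holds_sum, Layout.Bad]
  refine exists_congr fun a => and_congr (by rw [eval, hρ]; rfl) ?_
  have h1 : Function.update ρ 40 a 1 = x.length := by simp [hρ]
  simp only [holds_and, holds_or, holds_clE, holds_flsE h1, eval_secE h1, eval]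
  simp only [Function.update_apply, if_neg hp, if_neg hq, if_neg hp', if_neg hq', if_true]
  rfl

theorem holds_validE (hρ : ρ 1 = x.length) (i p q : Expr (Aut × Option Bool)) :
    Holds (tapeOf x) ρ (validE i p q) ↔ (layout x).Valid (ρ 0) (i.eval (tapeOf x) ρ)
      (p.eval (tapeOf x) ρ) (q.eval (tapeOf x) ρ) := by
  simp only [validE, holds_or, holds_and, holds_imp, holds_occE, holds_lt, eval_succ,
    eval_canE hρ, holds_not, holds_eq, Layout.Valid, layout, eval, hρ, ne_eq]

/-- The tape shows the state before each letter but not the final state, which takes one more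
transition from the last letter. The empty word has no last letter and is accepted separately. -/
theorem holds_goodE (hρ : ρ 1 = x.length) :
    Holds (tapeOf x) ρ goodE ↔ x.foldl step .len = .len := by
  simp only [goodE, holds_or, holds_eq, holds_tapeOf, eval, hρ]
  rcases x.eq_nil_or_concat with rfl | ⟨l, y, rfl⟩
  · simp
  · simp [stateAt]

theorem holds_confE (hρ : ρ 1 = x.length) : Holds (tapeOf x) ρ confE ↔
    (x.foldl step .len = .len → (layout x).Conf (ρ 0) (ρ 2) (ρ 3)) := by
  -- The base depends only on the variable `1`, as division requires, and none of the six bindings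
  -- below touches that variable.
  have hb : ∀ {ρ : ℕ → ℕ}, ρ 1 = x.length → ∀ ρ' : ℕ → ℕ, ρ' 1 = ρ 1 →
      baseE.eval (tapeOf x) ρ' = x.length + 2 := fun h ρ' h' => by
    rw [baseE, eval, eval, eval, h', h]
  have hbb : ∀ {ρ : ℕ → ℕ}, ρ 1 = x.length → ∀ ρ' : ℕ → ℕ, ρ' 1 = ρ 1 →
      (mul baseE baseE).eval (tapeOf x) ρ' = (x.length + 2) * (x.length + 2) := fun h ρ' h' => by
    rw [eval, hb h ρ' h']
  have hdiv : ∀ {ρ : ℕ → ℕ} (a : Expr (Aut × Option Bool)), ρ 1 = x.length →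
      (div a (mul baseE baseE)).eval (tapeOf x) ρ =
        a.eval (tapeOf x) ρ / ((x.length + 2) * (x.length + 2)) := fun a h =>
    eval_div (by positivity) (hbb h)
  have hmod : ∀ {ρ : ℕ → ℕ} (a : Expr (Aut × Option Bool)), ρ 1 = x.length →
      (mod a baseE).eval (tapeOf x) ρ = a.eval (tapeOf x) ρ % (x.length + 2) := fun a h =>
    eval_mod (by positivity) (hb h)
  have hdiv' : ∀ {ρ : ℕ → ℕ} (a : Expr (Aut × Option Bool)), ρ 1 = x.length →
      (div a baseE).eval (tapeOf x) ρ = a.eval (tapeOf x) ρ / (x.length + 2) := fun a h =>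
    eval_div (by positivity) (hb h)
  have hu : ∀ {ρ : ℕ → ℕ} (v a : ℕ), v ≠ 1 → ρ 1 = x.length →
      Function.update ρ v a 1 = x.length := fun v a hv h => by
    rw [Function.update_of_ne hv.symm, h]
  set ρ₁ := Function.update ρ 30 (ρ 2 / ((x.length + 2) * (x.length + 2))) with h₁
  set ρ₂ := Function.update ρ₁ 31 (ρ 2 / (x.length + 2) % (x.length + 2)) with h₂
  set ρ₃ := Function.update ρ₂ 32 (ρ 2 % (x.length + 2)) with h₃
  set ρ₄ := Function.update ρ₃ 33 (ρ 3 / ((x.length + 2) * (x.length + 2))) with h₄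
  set ρ₅ := Function.update ρ₄ 34 (ρ 3 / (x.length + 2) % (x.length + 2)) with h₅
  set ρ₆ := Function.update ρ₅ 35 (ρ 3 % (x.length + 2)) with h₆
  have e₁ : ρ₁ 1 = x.length := hu _ _ (by omega) hρ
  have e₂ : ρ₂ 1 = x.length := hu _ _ (by omega) e₁
  have e₃ : ρ₃ 1 = x.length := hu _ _ (by omega) e₂
  have e₄ : ρ₄ 1 = x.length := hu _ _ (by omega) e₃
  have e₅ : ρ₅ 1 = x.length := hu _ _ (by omega) e₄
  have e₆ : ρ₆ 1 = x.length := hu _ _ (by omega) e₅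
  rw [confE, holds_letE, hdiv _ hρ, eval, ← h₁, holds_letE, hmod _ e₁, hdiv' _ e₁, eval,
    show ρ₁ 2 = ρ 2 by simp [h₁], ← h₂, holds_letE, hmod _ e₂, eval,
    show ρ₂ 2 = ρ 2 by simp [h₁, h₂], ← h₃, holds_letE, hdiv _ e₃, eval,
    show ρ₃ 3 = ρ 3 by simp [h₁, h₂, h₃], ← h₄, holds_letE, hmod _ e₄, hdiv' _ e₄, eval,
    show ρ₄ 3 = ρ 3 by simp [h₁, h₂, h₃, h₄], ← h₅, holds_letE, hmod _ e₅, eval,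
    show ρ₅ 3 = ρ 3 by simp [h₁, h₂, h₃, h₄, h₅], ← h₆, holds_imp, holds_goodE e₆]
  refine imp_congr_right fun _ => ?_
  simp only [holds_not, holds_and, holds_imp, holds_validE e₆, holds_eq, eval_succ,
    holds_badE e₆ (show 31 ≠ 40 by omega) (show 32 ≠ 40 by omega) (show 34 ≠ 40 by omega)
      (show 35 ≠ 40 by omega), eval]
  rw [show ρ₆ 0 = ρ 0 by simp [h₁, h₂, h₃, h₄, h₅, h₆],
    show ρ₆ 30 = ρ 2 / ((x.length + 2) * (x.length + 2)) by simp [h₁, h₂, h₃, h₄, h₅, h₆],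
    show ρ₆ 31 = ρ 2 / (x.length + 2) % (x.length + 2) by simp [h₁, h₂, h₃, h₄, h₅, h₆],
    show ρ₆ 32 = ρ 2 % (x.length + 2) by simp [h₁, h₂, h₃, h₄, h₅, h₆],
    show ρ₆ 33 = ρ 3 / ((x.length + 2) * (x.length + 2)) by simp [h₁, h₂, h₃, h₄, h₅, h₆],
    show ρ₆ 34 = ρ 3 / (x.length + 2) % (x.length + 2) by simp [h₁, h₂, h₃, h₄, h₅, h₆],
    show ρ₆ 35 = ρ 3 % (x.length + 2) by simp [h₁, h₂, h₃, h₄, h₅, h₆]]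
  rfl

end CNF

end

/-! ### Writing the graph -/

section

open Turing

namespace Counter

open Counter.Expr

variable {A : Type}

/-- Write a number, followed by a separator. -/
def num (e : Expr A) : Writer A (Option (Option Bool)) :=
  .seq (.nat (fun b => some (some b)) e) (.emit (some none))

theorem word_num (T : List A) (ρ : ℕ → ℕ) (e : Expr A) :
    (num e).word T ρ = (encodeNats [e.eval T ρ]).map some := by
  simp [num, Writer.word, encodeNats, Function.comp_def]

theorem flatMap_emit {α : Type} (b : α) (n : ℕ) :
    ((List.range n).flatMap fun _ => [b]) = List.replicate n b := by
  induction n with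
  | zero => rfl
  | succ n ih => rw [List.range_succ, List.flatMap_append, ih, List.replicate_succ']; rfl

/-! ### Writing the description of a conflict graph

The variables `2` and `3` are those of the conflict relation. -/

section

variable (c N d K : Expr A)

def skipE : Expr A := and (lt (var 3) (var 2)) c

def nbrE : Expr A :=
  ifz (and (lt (var 3) N) (and (not (eq (var 2) (var 3))) c))
    (add (add N (mul (var 2) d)) (var 3)) (var 3)

def lengthE : Expr A := sum 2 N (sum 3 d (not (skipE c)))

def edgesW : Writer A (Option (Option Bool)) :=
  .rep 2 N (.rep 3 d (.ifz (skipE c) (.seq (num (var 2)) (.seq (num (nbrE c N d))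
    (.seq (num (const 1)) (num (const 1))))) .skip))

def graphW : Writer A (Option (Option Bool)) :=
  .seq (.rep 2 K (.emit none)) (.seq (.rep 2 (add N (mul N d)) (.emit (some (some true))))
    (.seq (.emit (some none)) (.seq (num (sub (lengthE c N d) (mul K d))) (edgesW c N d))))

end

variable {T : List A} {ρ : ℕ → ℕ} {c N d K : Expr A} {conf : ℕ → ℕ → Prop} [DecidableRel conf]
  {n m k : ℕ}

theorem eval_lengthE (hc : ∀ u v, Holds T (Function.update (Function.update ρ 2 u) 3 v) c ↔
      conf u v) (hN : N.eval T ρ = n) (hd : ∀ u, d.eval T (Function.update ρ 2 u) = m) :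
    (lengthE c N d).eval T ρ = (ConflictGraph.edges conf n m).length := by
  classical
  rw [ConflictGraph.length_edges, lengthE, eval, hN]
  refine Finset.sum_congr rfl fun u _ => ?_
  rw [eval, hd]
  refine Finset.sum_congr rfl fun v _ => ?_
  rw [Expr.not, eval_ifz]
  refine if_congr ?_ rfl rfl
  rw [skipE, holds_and, holds_lt, hc, eval, eval, Function.update_self,
    Function.update_of_ne (by omega), Function.update_self]

/-- The order and the degree also occur inside the loops over `2` and `3`; `hN'` and `hd'` express
that their values do not change there. -/
theorem word_edgesW (hc : ∀ u v, Holds T (Function.update (Function.update ρ 2 u) 3 v) c ↔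
      conf u v) (hN : N.eval T ρ = n) (hd : ∀ u, d.eval T (Function.update ρ 2 u) = m)
    (hN' : ∀ u v, N.eval T (Function.update (Function.update ρ 2 u) 3 v) = n)
    (hd' : ∀ u v, d.eval T (Function.update (Function.update ρ 2 u) 3 v) = m) :
    (edgesW c N d).word T ρ = (encodeNats ((ConflictGraph.edges conf n m).flatMap
      fun p => [p.1, p.2, 1, 1])).map some := by
  classical
  rw [edgesW, Writer.word, hN, ConflictGraph.edges, List.flatMap_assoc, encodeNats,
    List.flatMap_assoc, List.map_flatMap]
  refine List.flatMap_congr fun u _ => ?_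
  rw [Writer.word, hd, List.flatMap_assoc, List.flatMap_assoc, List.map_flatMap]
  refine List.flatMap_congr fun v _ => ?_
  set ρ' := Function.update (Function.update ρ 2 u) 3 v with hρ'
  have h2 : ρ' 2 = u := by simp [hρ']
  have h3 : ρ' 3 = v := by simp [hρ']
  have hs : Holds T ρ' (skipE c) ↔ v < u ∧ conf u v := by
    rw [skipE, holds_and, holds_lt, hc, eval, eval, h2, h3]
  have hn : (nbrE c N d).eval T ρ' = ConflictGraph.nbr conf n m u v := by
    rw [nbrE, eval_ifz, ConflictGraph.nbr]
    refine if_congr ?_ h3 ?_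
    · rw [holds_and, holds_and, holds_lt, holds_not, holds_eq, hc, hN', eval, eval, h2, h3]
    · simp only [eval, h2, h3]
      rw [hρ', hN', hd']
  rw [Writer.word]
  by_cases h : v < u ∧ conf u v
  · rw [if_pos h, if_neg (hs.2 h)]
    rfl
  · rw [if_neg h, if_pos (not_not.1 (mt hs.1 h))]
    simp only [Writer.word, word_num, hn, eval, h2, encodeNats, List.flatMap_cons,
      List.flatMap_nil, List.append_nil, List.map_append]

theorem word_graphW (hc : ∀ u v, Holds T (Function.update (Function.update ρ 2 u) 3 v) c ↔
      conf u v) (hN : N.eval T ρ = n) (hd : ∀ u, d.eval T (Function.update ρ 2 u) = m)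
    (hN' : ∀ u v, N.eval T (Function.update (Function.update ρ 2 u) 3 v) = n)
    (hd' : ∀ u v, d.eval T (Function.update (Function.update ρ 2 u) 3 v) = m)
    (hd0 : d.eval T ρ = m) (hK : K.eval T ρ = k) :
    (graphW c N d K).word T ρ = encodePair (ConflictGraph.word conf n m k, k) := by
  have h1 : (add N (mul N d)).eval T ρ = n + n * m := by rw [eval, eval, hN, hd0]
  have h2 : (sub (lengthE c N d) (mul K d)).eval T ρ =
      (ConflictGraph.edges conf n m).length - k * m := by
    rw [eval, eval_lengthE hc hN hd, eval, hK, hd0]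
  rw [graphW]
  simp only [Writer.word, word_num, word_edgesW hc hN hd hN' hd', h1, h2, hK, flatMap_emit,
    encodePair, ConflictGraph.word]
  simp [encodeNats]

end Counter

/-! ### Parameterized running time of the combined machine -/

open Polynomial in
theorem Polynomial.exists_eval_le (p : ℕ[X]) : ∃ a e, ∀ n, p.eval n ≤ a * (n + 1) ^ e := by
  induction p using Polynomial.induction_on' with
  | add p q hp hq =>
    obtain ⟨a, e, h⟩ := hp
    obtain ⟨a', e', h'⟩ := hq
    refine ⟨a + a', e + e', fun n => ?_⟩
    have h1 : (n + 1) ^ e ≤ (n + 1) ^ (e + e') := Nat.pow_le_pow_right (by omega) (by omega)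
    have h2 : (n + 1) ^ e' ≤ (n + 1) ^ (e + e') := Nat.pow_le_pow_right (by omega) (by omega)
    rw [eval_add, add_mul]
    exact Nat.add_le_add ((h n).trans (Nat.mul_le_mul_left _ h1))
      ((h' n).trans (Nat.mul_le_mul_left _ h2))
  | monomial e a =>
    refine ⟨a, e, fun n => ?_⟩
    rw [eval_monomial]
    exact Nat.mul_le_mul_left _ (Nat.pow_le_pow_left (by omega) e)

theorem Computable.nat_pow_const {f : ℕ → ℕ} (hf : Computable f) (e : ℕ) :
    Computable fun n => f n ^ e := by
  induction e with
  | zero => simpa using Computable.const 1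
  | succ e ih =>
    simp only [pow_succ]
    exact (Primrec.nat_mul.to_comp).comp ih hf

namespace Counter

open Polynomial in
/-- A parameterized reduction followed by the output of a writer is a parameterized reduction. -/
theorem exists_computesInFPTTime {Γ I Q B : Type} [Finite I] [Finite Q] [Finite B] [Inhabited I]
    [Inhabited Q] {M : TM2ComputableAux (Option Γ) (Option I)}
    {f : List Γ × ℕ → List I × ℕ} {t : ℕ → ℕ} {c : ℕ} (ht : Computable t)
    (hM : ComputesInFPTTime M f t c) (δ : Q → I → Q) (q₀ : Q) (W : Writer (Q × I) (Option B))
    (h : List I × ℕ → List B × ℕ)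
    (hW : ∀ p : List I × ℕ, W.word (annotate δ q₀ p.1)
      (fun i => if i = 0 then p.2 else if i = 1 then p.1.length else 0) = encodePair (h p)) :
    ∃ (M' : TM2ComputableAux (Option Γ) (Option B)) (t' : ℕ → ℕ) (c' : ℕ), Computable t' ∧
      ComputesInFPTTime M' (fun p => h (f p)) t' c' := by
  -- Scratch registers start above `0` and `1`, which hold the parameter and the length even if the
  -- writer does not mention them.
  set r := max W.bound 2 with hr
  obtain ⟨p, hp⟩ := Writer.feasible W
  -- After reading, the head is to the right of the word, so the program begins by rewinding. The
  -- two input registers are emptied at the end for the halting configuration.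
  set P : Prog (Q × I) (Option B) := .seq .rewind (.seq (W.comp r) (.seq (.loop 0 .skip)
    (.loop 1 .skip))) with hP
  have hwf : P.WF := ⟨trivial, Writer.wf_comp _ _ (le_max_left _ _), ⟨trivial, trivial⟩,
    trivial, trivial⟩
  obtain ⟨M', C₀, hM'⟩ := exists_machine M δ q₀ P hwf
  have hrun : ∀ y : List I × ℕ, Does P (start (Option B) δ q₀ y)
      { reg := fun _ => 0, left := [], right := annotate δ q₀ y.1,
        out := (encodePair (h y)).reverse }
      (p.eval (encodePair y).length + 4 * (encodePair y).length + 3) := by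
    intro y
    have hlen : (encodePair y).length = y.2 + y.1.length := by simp [encodePair]
    have h1 := Does.rewind (start (Option B) δ q₀ y)
    set s₁ : State (Q × I) (Option B) := { start (Option B) δ q₀ y with
      left := [], right := annotate δ q₀ y.1 } with hs₁
    have h1' : Does .rewind (start (Option B) δ q₀ y) s₁ (y.1.length + 1) := by
      refine (h1.of_eq ?_).mono ?_
      · simp [hs₁, start]
      · simp [start, length_annotate]
    have h2 := hp (encodePair y).length r s₁ (le_max_left _ _)
      (fun j hj => by
        have : 2 ≤ r := le_max_right _ _
        simp only [hs₁, start]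
        rw [if_neg (by omega), if_neg (by omega)]) rfl
      (by rw [hs₁, hlen, length_annotate]; omega)
      (fun v _ => by
        simp only [hs₁, start]
        split_ifs <;> omega)
    have hword : W.word s₁.right s₁.reg = encodePair (h y) := hW y
    rw [hword] at h2
    refine ((h1'.seq (h2.seq ((Does.clear _ 0).seq (Does.clear _ 1)))).of_eq ?_).mono ?_
    · refine State.ext' (fun x => ?_) rfl rfl ?_
      · simp only [State.set_reg, State.write_reg, hs₁, start]
        split_ifs <;> rfl
      · simp [hs₁, start]
    · simp [hs₁, start, hlen]; omega
  -- The cost of the program enters twice, once for running it and once as a bound for its output.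
  -- The constants are generous.
  obtain ⟨a, e, hae⟩ := ((C 2 * p + C 12 * X + C 10 : ℕ[X])).exists_eval_le
  refine ⟨M', fun k => (a * (2 + (C₀ + 1) * t k) ^ e), (c + 1) * e, ?_, fun y => ?_⟩
  · refine (Primrec.nat_mul.to_comp).comp (Computable.const a) (Computable.nat_pow_const ?_ e)
    exact (Primrec.nat_add.to_comp).comp (Computable.const 2)
      ((Primrec.nat_mul.to_comp).comp (Computable.const (C₀ + 1)) ht)
  · set n := (encodePair y).length with hn
    obtain ⟨h1, h2⟩ := hM' (encodePair y) (f y) _ (hM y)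
    rw [← hn] at h1 h2
    set S := t y.2 * (n + 1) ^ c with hS
    obtain ⟨h3, h4⟩ := hrun (f y)
    rw [h3] at h2
    have h2' := h2 (fun _ => rfl) rfl
    rw [List.reverse_reverse] at h2'
    obtain ⟨o⟩ := h2'
    have h5 : (encodePair (h (f y))).length ≤ P.cost (start (Option B) δ q₀ (f y)) := by
      have := Prog.out_length_le P (start (Option B) δ q₀ (f y))
      rw [h3] at this
      simpa only [List.length_reverse, show (start (Option B) δ q₀ (f y)).out = [] from rfl,
        List.length_nil, zero_add] using this
    refine ⟨⟨o.toEvalsTo, o.steps_le_m.trans ?_⟩⟩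
    beta_reduce
    simp only [length_annotate, List.length_reverse]
    have h6 : (f y).1.length ≤ (encodePair (f y)).length := by simp [encodePair]
    set l := (encodePair (f y)).length with hl
    -- The size of the intermediate instance is at most linear in the time spent on producing it, so
    -- a polynomial in it is still bounded by a function of the parameter times a power of the
    -- original size.
    have h7 : l ≤ n + (C₀ + 1) * S := by rw [add_one_mul]; omega
    have h8 := p.eval_le_eval_of_le h7
    have h9 := hae (n + (C₀ + 1) * S)
    simp only [eval_add, eval_mul, eval_C, eval_X] at h9
    have h10 : n + (C₀ + 1) * S + 1 ≤ (2 + (C₀ + 1) * t y.2) * (n + 1) ^ (c + 1) := by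
      have h11 : (n + 1) ^ c ≤ (n + 1) ^ (c + 1) := Nat.pow_le_pow_right (by omega) (by omega)
      have h12 : n + 1 ≤ (n + 1) ^ (c + 1) := Nat.le_self_pow (by omega) _
      have h13 : (C₀ + 1) * t y.2 * (n + 1) ^ c ≤ (C₀ + 1) * t y.2 * (n + 1) ^ (c + 1) :=
        Nat.mul_le_mul_left _ h11
      rw [hS, ← mul_assoc, add_mul]
      linarith
    have h14 : (a * (n + (C₀ + 1) * S + 1) ^ e) ≤
        a * (2 + (C₀ + 1) * t y.2) ^ e * (n + 1) ^ ((c + 1) * e) := by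
      rw [mul_assoc, pow_mul, ← mul_pow]
      exact Nat.mul_le_mul_left _ (Nat.pow_le_pow_left h10 e)
    have h15 : S ≤ (C₀ + 1) * S := Nat.le_mul_of_pos_left _ (by omega)
    linarith

end Counter

end

/-! ### The reduction and the hardness theorem -/

section

open Turing

namespace CNF

open Counter Counter.Expr

/-- The number of vertices to be chosen. -/
def sizeE : Expr (Aut × Option Bool) := add (var 0) (const 2)

/-- The number of vertices of the conflict relation. -/
def orderE : Expr (Aut × Option Bool) := mul sizeE (mul baseE baseE)

/-- The degree of these vertices. -/
def degreeE : Expr (Aut × Option Bool) :=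
  add orderE (mul (add (mul (const 2) sizeE) (const 1)) (add (mul (const 2) sizeE) (const 1)))

def order (k l : ℕ) : ℕ := (k + 2) * ((l + 2) * (l + 2))

def degree (k l : ℕ) : ℕ := order k l + (2 * (k + 2) + 1) * (2 * (k + 2) + 1)

open Classical in
/-- The reduction from weighted satisfiability. -/
noncomputable def reduction (p : List (Option Bool) × ℕ) : List (Option Bool) × ℕ :=
  (ConflictGraph.word (fun u v => p.1.foldl step .len = .len → (layout p.1).Conf p.2 u v)
    (order p.2 p.1.length) (degree p.2 p.1.length) (p.2 + 2), p.2 + 2)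

theorem word_reduction (p : List (Option Bool) × ℕ) :
    (graphW confE orderE degreeE sizeE).word (annotate step .len p.1)
      (fun i => if i = 0 then p.2 else if i = 1 then p.1.length else 0) =
      encodePair (reduction p) := by
  classical
  set ρ : ℕ → ℕ := fun i => if i = 0 then p.2 else if i = 1 then p.1.length else 0 with hρ
  have hN : ∀ ρ' : ℕ → ℕ, ρ' 0 = p.2 → ρ' 1 = p.1.length →
      orderE.eval (annotate step .len p.1) ρ' = order p.2 p.1.length := by
    intro ρ' h0 h1
    simp only [orderE, sizeE, baseE, eval, h0, h1, order]
  have hd : ∀ ρ' : ℕ → ℕ, ρ' 0 = p.2 → ρ' 1 = p.1.length →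
      degreeE.eval (annotate step .len p.1) ρ' = degree p.2 p.1.length := by
    intro ρ' h0 h1
    rw [degreeE, eval, hN ρ' h0 h1]
    simp only [sizeE, eval, h0, degree]
  refine word_graphW (fun u v => ?_) (hN _ rfl rfl) (fun u => hd _ ?_ ?_) (fun u v => hN _ ?_ ?_)
    (fun u v => hd _ ?_ ?_) (hd _ rfl rfl) rfl
  · have h := holds_confE (x := p.1) (ρ := Function.update (Function.update ρ 2 u) 3 v)
      (by simp [hρ])
    have h0 : Function.update (Function.update ρ 2 u) 3 v 0 = p.2 := by simp [hρ]
    have h2 : Function.update (Function.update ρ 2 u) 3 v 2 = u := by simp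
    have h3 : Function.update (Function.update ρ 2 u) 3 v 3 = v := by simp
    rw [h0, h2, h3] at h
    exact h
  all_goals simp [hρ]

/-- The first inequality is what the counting of edges needs. The second one makes the budget
positive, as `N (d - N)` edges always exist; with `X = (2K + 1)^2` it reads `K (N + X) < N X` and
follows from `N ≥ 4K` and `X ≥ 4K`. -/
theorem degree_spec (k l : ℕ) : 2 * (k + 2) * (2 * (k + 2) + 1) < degree k l ∧
    (k + 2) * degree k l < order k l * (degree k l - order k l) := by
  obtain ⟨K, hK⟩ : ∃ K, K = k + 2 := ⟨_, rfl⟩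
  have hK2 : 2 ≤ K := by omega
  have hN : 4 * K ≤ order k l := by
    rw [order, ← hK, mul_comm 4]
    refine Nat.mul_le_mul_left _ ?_
    nlinarith
  rw [degree, ← hK, Nat.add_sub_cancel_left]
  generalize order k l = N at hN
  constructor
  · nlinarith
  · obtain ⟨j, rfl⟩ : ∃ j, N = 4 * K + j := ⟨N - 4 * K, by omega⟩
    have hX : 4 * K ≤ (2 * K + 1) * (2 * K + 1) := by nlinarith
    generalize (2 * K + 1) * (2 * K + 1) = X at hX
    have h1 : j * K ≤ j * X := Nat.mul_le_mul_left j (by omega)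
    have h2 : K * (4 * K) ≤ K * X := Nat.mul_le_mul_left K hX
    have h3 : 0 < K * K := by positivity
    linarith

theorem mem_reduction (p : List (Option Bool) × ℕ) :
    (p ∈ Weighted2CNFSat ↔ reduction p ∈ UnitMMEI) ∧
      (p ∈ Weighted2CNFSat ↔ reduction p ∈ MMEI) := by
  classical
  obtain ⟨h1, h2⟩ := degree_spec p.2 p.1.length
  have h3 := ConflictGraph.mem_iff
    (conf := fun u v => p.1.foldl step .len = .len → (layout p.1).Conf p.2 u v)
    (N := order p.2 p.1.length) (d := degree p.2 p.1.length) (K := p.2 + 2)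
    (fun u v h hx => (h hx).symm) (Nat.le_add_right _ _) (by omega) h1
    (h2.trans_le ConflictGraph.le_length_edges)
  have h4 := mem_weighted2CNFSat_iff_conf (x := p.1) (k := p.2)
  exact ⟨h4.trans h3.1.symm, h4.trans h3.2.symm⟩

end CNF

open CNF Counter in
/-- A problem to which `reduction` reduces weighted satisfiability is hard. -/
theorem W1Hard.of_reduction {R : ParamProblem (Option Bool)}
    (hR : ∀ p, p ∈ Weighted2CNFSat ↔ reduction p ∈ R) : W1Hard R := by
  rintro Γ _ Q ⟨f, g, t, c, M, hg, ht, hf, hfg, hM⟩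
  obtain ⟨M', t', c', ht', hM'⟩ := exists_computesInFPTTime ht hM step .len
    (graphW confE orderE degreeE sizeE) reduction word_reduction
  refine ⟨fun p => reduction (f p), fun k => g k + 2, t', c', M', ?_, ht',
    fun p => (hf p).trans (hR _), fun p => ?_, hM'⟩
  · exact (Primrec.nat_add.to_comp).comp hg (Computable.const 2)
  · exact Nat.add_le_add_right (hfg p) 2

end

theorem theorem3 : W1Hard UnitMMEI ∧ W1Hard MMEI :=
  ⟨.of_reduction fun p => (CNF.mem_reduction p).1, .of_reduction fun p => (CNF.mem_reduction p).2⟩
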